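/- There is an absolute constant $C>0$ such that the following holds. Let $2\le m\le n$ be integers, let the edges of the complete graph $K_n$ carry independent exponential weights with mean $1$, and let $T$ be a set of $m$ vertices (terminals) of $K_n$ with a distinguished terminal $r\in T$ (the root). Let $X$ be the weight of the minimum Steiner tree for $T$, i.e. the minimum total edge weight of a subtree of $K_n$ whose vertex set contains $T$ (and possibly other vertices). For an integer $k$, let $X_k$ be the minimum total edge weight of such a subtree in which, in addition, every vertex is at tree distance at most $k$ (number of edges) from $r$. If $k=\log_2\log n+\Delta$, where the real number $\Delta$ satisfies $$\Delta\ \ge\ \frac{n}{m\log(en/m)},$$ then $X_k$ and $X$ are integrable and $$\mathbb{E}\left[X_k-X\right]\ \le\ C\sqrt{\frac{m\log(en/m)}{n\,\Delta}}.$$ -/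

import Mathlib

open MeasureTheory ProbabilityTheory

namespace BoundedDepthSteiner

variable {V : Type*} {G : SimpleGraph V}

/-- A Steiner tree of `G` for the terminal set `T`: a subgraph of `G` that is a tree and whose
vertex set contains every terminal (it may contain other vertices of `G` as well). -/
def IsSteinerTree (T : Finset V) (H : G.Subgraph) : Prop :=
  (∀ v ∈ T, v ∈ H.verts) ∧ H.coe.IsTree

/-- The subgraph `H` contains the root `r`, and each of its vertices is at distance at most `k`
from `r`, the distance being the number of edges of a shortest path inside `H`. -/
def HasDepthAtMost (r : V) (k : ℕ) (H : G.Subgraph) : Prop :=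
  ∃ hr : r ∈ H.verts, ∀ v : H.verts, H.coe.edist ⟨r, hr⟩ v ≤ (k : ℕ∞)

open Classical in
/-- The weight of a subgraph: the sum of the weights of its edges. -/
noncomputable def weight [Fintype V] (w : G.edgeSet → ℝ) (H : G.Subgraph) : ℝ :=
  ∑ e : G.edgeSet, if e.val ∈ H.edgeSet then w e else 0

/-- The weight of a minimum Steiner tree of the edge-weighted graph `G` with terminals `T`. -/
noncomputable def minSteinerWeight [Fintype V] (w : G.edgeSet → ℝ) (T : Finset V) : ℝ :=
  sInf (weight w '' {H : G.Subgraph | IsSteinerTree T H})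

/-- The weight of a minimum depth-`k` Steiner tree, rooted at `r`, of the edge-weighted graph `G`
with terminals `T`. -/
noncomputable def minDepthSteinerWeight [Fintype V] (w : G.edgeSet → ℝ) (T : Finset V)
    (r : V) (k : ℕ) : ℝ :=
  sInf (weight w '' {H : G.Subgraph | IsSteinerTree T H ∧ HasDepthAtMost r k H})

/-- The infimum defining `minSteinerWeight` is a minimum as soon as a Steiner tree exists. -/
theorem isLeast_minSteinerWeight [Fintype V] (w : G.edgeSet → ℝ) (T : Finset V)
    (h : ∃ H : G.Subgraph, IsSteinerTree T H) :
    IsLeast (weight w '' {H : G.Subgraph | IsSteinerTree T H}) (minSteinerWeight w T) := by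
  have hf := (Set.toFinite {H : G.Subgraph | IsSteinerTree T H}).image (weight w)
  obtain ⟨H, hH⟩ := h
  exact ⟨Set.Nonempty.csInf_mem ⟨_, H, hH, rfl⟩ hf, fun x hx => csInf_le hf.bddBelow hx⟩

/-- The infimum defining `minDepthSteinerWeight` is a minimum as soon as a Steiner tree of the
required depth exists. -/
theorem isLeast_minDepthSteinerWeight [Fintype V] (w : G.edgeSet → ℝ) (T : Finset V)
    (r : V) (k : ℕ) (h : ∃ H : G.Subgraph, IsSteinerTree T H ∧ HasDepthAtMost r k H) :
    IsLeast (weight w '' {H : G.Subgraph | IsSteinerTree T H ∧ HasDepthAtMost r k H})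
      (minDepthSteinerWeight w T r k) := by
  have hf := (Set.toFinite
    {H : G.Subgraph | IsSteinerTree T H ∧ HasDepthAtMost r k H}).image (weight w)
  obtain ⟨H, hH⟩ := h
  exact ⟨Set.Nonempty.csInf_mem ⟨_, H, hH, rfl⟩ hf, fun x hx => csInf_le hf.bddBelow hx⟩

end BoundedDepthSteiner

open scoped ENNReal

namespace BoundedDepthSteiner

/-! ### Minima and scaling of independent exponential variables -/

section Exponential

/-! Put q = m log(en/m)/n and ε = √(q/Δ). The claim is an excess of O(ε), and the hypothesis on Δ
says Δq ≥ 1, that is, ε ≤ q. A tree of depth at most k is built from an optimal Steiner tree by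
adding shortcuts to a hub set A of order εn vertices at depth K = ⌊log₂ log n⌋.

The hub is grown from the root in K levels. Up to geometric factors each level size is the square of
the previous one on the scale of fractions of εn, so K levels lead from one vertex to order εn.
Joining the t cheapest of order n candidates to a level of size s costs O(t²/(ns)). The sizes make
t²/s geometric, so all levels cost O(ε) (`levelCost_levelSizes_le`). On the vertices not yet used,
take an optimal Steiner tree for the remaining terminals and one extra neighbour b of the root. Cut
it at the vertices whose depth lies in one residue class modulo D + 1 = k - K ≥ Δ, and join these to
A by their cheapest edges, each of mean 1/|A|. Averaging over the classes, O(nq) tree edges lead to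
a shortcut cost O(nq/(εnΔ)) = O(ε) (`labelCost_le_tree_add_div`, `meanLabel_le_cutCost`).

Three estimates support this. The mean Steiner cost is O(q): terminals are added one by one, and
each addition is a first passage problem solved by memorylessness (`lintegral_hitCost_le`,
`meanSteinerNum_le`). An optimal tree has O(nq) edges on average: a first moment over all rooted
trees shows that many edges with small total weight are unlikely (`IsRootedTree.card_le`,
`lintegral_treeSum_le`). Deleting a ≤ n/2 vertices raises the mean Steiner cost by O(a/n): graphs on
N + 1 and N vertices are compared by identifying an average pair of vertices
(`meanSteinerNum_sub_le`).

Independence enters through `map_inf'_cross_pi_expMeasure`: the cheapest edges from A to the outside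
vertices are independent of the edges outside A, so each stage starts with a fresh complete graph.
Costs live on all of `Sym2 V`. The loops never matter, and deletion and relabelling of vertices
become `Sym2.map`. -/

instance isProbabilityMeasure_expMeasure_one : IsProbabilityMeasure (expMeasure 1) :=
  isProbabilityMeasure_expMeasure one_pos

instance isFiniteMeasure_expMeasure (r : ℝ) : IsFiniteMeasure (expMeasure r) := by
  rcases lt_or_ge 0 r with hr | hr
  · have := isProbabilityMeasure_expMeasure hr
    infer_instance
  · have : expMeasure r = 0 := by
      change volume.withDensity (exponentialPDF r) = 0
      rw [withDensity_eq_zero_iff (by unfold exponentialPDF; fun_prop)]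
      refine Filter.Eventually.of_forall fun x => ?_
      rw [exponentialPDF_eq]
      split_ifs
      · exact ENNReal.ofReal_of_nonpos (mul_nonpos_of_nonpos_of_nonneg hr (Real.exp_pos _).le)
      · simp
    rw [this]
    infer_instance

theorem expMeasure_eq_withDensity (r : ℝ) :
    expMeasure r = volume.withDensity (exponentialPDF r) := rfl

@[fun_prop]
theorem measurable_exponentialPDF (r : ℝ) : Measurable (exponentialPDF r) := by
  unfold exponentialPDF; fun_prop

theorem expMeasure_Iic {r : ℝ} (hr : 0 < r) (x : ℝ) :
    expMeasure r (Set.Iic x) = ENNReal.ofReal (if 0 ≤ x then 1 - Real.exp (-(r * x)) else 0) := by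
  rw [expMeasure_eq_withDensity, withDensity_apply _ measurableSet_Iic,
    lintegral_exponentialPDF_eq_antiDeriv hr]

theorem noAtoms_expMeasure (r x : ℝ) : expMeasure r {x} = 0 :=
  withDensity_absolutelyContinuous _ _ (by simp)

theorem expMeasure_Ici {r : ℝ} (hr : 0 < r) (x : ℝ) :
    expMeasure r (Set.Ici x) = ENNReal.ofReal (Real.exp (-(r * max x 0))) := by
  have := isProbabilityMeasure_expMeasure hr
  have h1 : expMeasure r (Set.Ici x) = expMeasure r (Set.Ioi x) := by
    refine measure_congr ?_
    have : ∀ᵐ y ∂(expMeasure r), y ≠ x := by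
      rw [ae_iff]; simpa using noAtoms_expMeasure r x
    filter_upwards [this] with y hy
    exact propext ⟨fun h => lt_of_le_of_ne h (Ne.symm hy), fun h => le_of_lt h⟩
  rw [h1, ← Set.compl_Iic, measure_compl measurableSet_Iic (measure_ne_top _ _), measure_univ,
    expMeasure_Iic hr, ← ENNReal.ofReal_one, ← ENNReal.ofReal_sub]
  · congr 1
    split_ifs with h
    · rw [max_eq_left h]; ring
    · rw [max_eq_right (not_le.1 h).le]; simp
  · split_ifs with h
    · have : Real.exp (-(r * x)) ≤ 1 := Real.exp_le_one_iff.2 (by nlinarith)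
      linarith
    · exact le_rfl

theorem ae_nonneg_expMeasure (r : ℝ) : ∀ᵐ x ∂(expMeasure r), 0 ≤ x := by
  rw [expMeasure_eq_withDensity, ae_withDensity_iff (by fun_prop)]
  refine Filter.Eventually.of_forall fun x hx => ?_
  by_contra h
  exact hx (exponentialPDF_of_neg (not_le.1 h))

theorem map_const_mul_expMeasure {r s : ℝ} (hr : 0 < r) (hs : 0 < s) :
    (expMeasure (s * r)).map (fun x => s * x) = expMeasure r := by
  have := isProbabilityMeasure_expMeasure hr
  have := isProbabilityMeasure_expMeasure (mul_pos hs hr)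
  refine Measure.ext_of_Ici _ _ fun a => ?_
  rw [Measure.map_apply (by fun_prop) measurableSet_Ici, expMeasure_Ici hr]
  have : (fun x => s * x) ⁻¹' Set.Ici a = Set.Ici (a / s) := by
    ext x; simp [div_le_iff₀' hs]
  rw [this, expMeasure_Ici (mul_pos hs hr)]
  congr 3
  have : max a 0 = s * max (a / s) 0 := by
    rw [mul_max_of_nonneg _ _ hs.le, mul_div_cancel₀ _ hs.ne', mul_zero]
  rw [this]; ring

theorem lintegral_exp_neg_mul_expMeasure {r l : ℝ} (hr : 0 < r) (hl : 0 ≤ l) :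
    ∫⁻ x, ENNReal.ofReal (Real.exp (-(l * x))) ∂(expMeasure r) = ENNReal.ofReal (r / (r + l)) := by
  have hrl : 0 < r + l := by linarith
  rw [expMeasure_eq_withDensity, lintegral_withDensity_eq_lintegral_mul _ (by fun_prop)
    (by fun_prop)]
  have : ∀ x, (exponentialPDF r * fun x => ENNReal.ofReal (Real.exp (-(l * x)))) x
      = ENNReal.ofReal (r / (r + l)) * exponentialPDF (r + l) x := by
    intro x
    simp only [Pi.mul_apply, exponentialPDF_eq]
    split_ifs
    · rw [← ENNReal.ofReal_mul (by positivity), ← ENNReal.ofReal_mul (by positivity)]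
      congr 1
      rw [mul_assoc, ← Real.exp_add, ← mul_assoc, div_mul_cancel₀ _ hrl.ne']
      congr 2; ring
    · simp
  simp_rw [this]
  rw [lintegral_const_mul _ (by fun_prop), lintegral_exponentialPDF_eq_one hrl, mul_one]

theorem lintegral_ofReal_expMeasure {r : ℝ} (hr : 0 < r) :
    ∫⁻ x, ENNReal.ofReal x ∂(expMeasure r) = ENNReal.ofReal (1 / r) := by
  rw [lintegral_eq_lintegral_meas_le _ (ae_nonneg_expMeasure r) (by fun_prop)]
  have h : ∀ t ∈ Set.Ioi (0 : ℝ), expMeasure r {a | t ≤ a}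
      = ENNReal.ofReal (1 / r) * exponentialPDF r t := by
    intro t ht
    have ht' : (0 : ℝ) < t := ht
    rw [exponentialPDF_of_nonneg ht'.le, ← ENNReal.ofReal_mul (by positivity)]
    have := expMeasure_Ici hr t
    rw [max_eq_left ht'.le] at this
    change expMeasure r (Set.Ici t) = _
    rw [this]
    congr 1
    field_simp
  rw [setLIntegral_congr_fun measurableSet_Ioi h, lintegral_const_mul _ (by fun_prop)]
  have : ∫⁻ a in Set.Ioi 0, exponentialPDF r a = 1 := by
    have h1 := lintegral_add_compl (μ := volume) (exponentialPDF r)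
      (measurableSet_Ioi (a := (0 : ℝ)))
    rwa [Set.compl_Ioi, setLIntegral_congr (Iio_ae_eq_Iic (a := (0 : ℝ))).symm,
      lintegral_exponentialPDF_of_nonpos le_rfl, add_zero, lintegral_exponentialPDF_eq_one hr]
      at h1
  rw [this, mul_one]

@[fun_prop]
theorem measurable_inf'_apply {ι : Type*} (s : Finset ι) (hs : s.Nonempty) :
    Measurable fun c : ι → ℝ => s.inf' hs c := by
  have : Measurable (s.inf' hs fun i (c : ι → ℝ) => c i) :=
    Finset.inf'_induction hs _ (fun _ hf _ hg => hf.inf hg) fun i _ => measurable_pi_apply i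
  convert this using 1
  ext c
  simp [Finset.inf'_apply]

/-- The joint law of the minima of independent exponential variables over disjoint blocks. -/
theorem map_inf'_pi_expMeasure {ι κ : Type*} [Fintype ι] [Fintype κ] (r : ι → ℝ)
    (hr : ∀ i, 0 < r i) (S : κ → Finset ι) (hne : ∀ j, (S j).Nonempty)
    (hS : Pairwise fun j j' => Disjoint (S j) (S j')) :
    (Measure.pi fun i => expMeasure (r i)).map (fun c j => (S j).inf' (hne j) c) =
      Measure.pi fun j => expMeasure (∑ i ∈ S j, r i) := by
  classical
  have hp : ∀ i, IsProbabilityMeasure (expMeasure (r i)) := fun i =>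
    isProbabilityMeasure_expMeasure (hr i)
  have hpos : ∀ j, 0 < ∑ i ∈ S j, r i := fun j => Finset.sum_pos (fun i _ => hr i) (hne j)
  have hmeas : Measurable (fun (c : ι → ℝ) j => (S j).inf' (hne j) c) :=
    measurable_pi_iff.2 fun j => measurable_inf'_apply (S j) (hne j)
  symm
  -- Upper half-lines are the right π-system: under block minima the preimage of a box of them is
  -- again such a box, and the exponential tails multiply by adding rates.
  refine Measure.pi_eq_generateFrom (C := fun _ => Set.range Set.Ici)
    (fun _ => (borel_eq_generateFrom_Ici ℝ).symm.trans (BorelSpace.measurable_eq).symm)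
    (fun _ => isPiSystem_Ici) (fun j => ⟨fun n => Set.Ici (-(n : ℝ)), fun n => ⟨_, rfl⟩,
      fun n => measure_lt_top _ _, ?_⟩) ?_
  · refine Set.eq_univ_of_forall fun x => Set.mem_iUnion.2 ?_
    obtain ⟨n, hn⟩ := exists_nat_ge (-x)
    exact ⟨n, by simp only [Set.mem_Ici]; linarith⟩
  · intro s hs
    choose t ht using hs
    obtain rfl : s = fun j => Set.Ici (t j) := funext fun j => (ht j).symm
    rw [Measure.map_apply hmeas (MeasurableSet.univ_pi fun _ => measurableSet_Ici)]
    have hset : (fun (c : ι → ℝ) j => (S j).inf' (hne j) c) ⁻¹' Set.univ.pi (fun j => Set.Ici (t j))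
        = Set.univ.pi (fun i => ⋂ j ∈ {j | i ∈ S j}, Set.Ici (t j)) := by
      ext c
      simp only [Set.mem_preimage, Set.mem_univ_pi, Set.mem_Ici, Finset.le_inf'_iff,
        Set.mem_iInter, Set.mem_ofPred_eq]
      exact ⟨fun h i j hij => h j i hij, fun h j i hij => h i j hij⟩
    rw [hset, Measure.pi_pi]
    have hblock : ∀ j, ∀ i ∈ S j, (⋂ j ∈ {j | i ∈ S j}, Set.Ici (t j)) = Set.Ici (t j) := by
      intro j i hi
      ext x
      simp only [Set.mem_iInter, Set.mem_ofPred_eq, Set.mem_Ici]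
      refine ⟨fun h => h j hi, fun h j' hj' => ?_⟩
      by_cases hjj : j' = j
      · exact hjj ▸ h
      · exact absurd hi (Finset.disjoint_left.1 (hS hjj) hj')
    have hout : ∀ i ∉ Finset.univ.biUnion S,
        expMeasure (r i) (⋂ j ∈ {j | i ∈ S j}, Set.Ici (t j)) = 1 := by
      intro i hi
      have : (⋂ j ∈ {j | i ∈ S j}, Set.Ici (t j)) = Set.univ := by
        refine Set.eq_univ_of_forall fun x => ?_
        simp only [Set.mem_iInter, Set.mem_ofPred_eq]
        exact fun j hj => absurd (Finset.mem_biUnion.2 ⟨j, Finset.mem_univ _, hj⟩) hi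
      rw [this, measure_univ]
    rw [← Finset.prod_subset (Finset.subset_univ (Finset.univ.biUnion S)) (fun i _ hi => hout i hi),
      Finset.prod_biUnion (fun j _ j' _ h => hS h)]
    refine Finset.prod_congr rfl fun j _ => ?_
    rw [expMeasure_Ici (hpos j), Finset.prod_congr rfl (fun i hi => by
      rw [hblock j i hi, expMeasure_Ici (hr i)]), ← ENNReal.ofReal_prod_of_nonneg
      (fun _ _ => (Real.exp_pos _).le), ← Real.exp_sum, Finset.sum_neg_distrib, Finset.sum_mul]

/-- Splitting the blocks into two families also gives the independence of the families. This is how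
costs leaving a vertex set are separated from the costs beyond it. -/
theorem map_inf'_pi_expMeasure_prod {ι κ κ' : Type*} [Fintype ι] [Fintype κ] [Fintype κ']
    (r : ι → ℝ) (hr : ∀ i, 0 < r i) (S : κ → Finset ι) (S' : κ' → Finset ι)
    (hne : ∀ j, (S j).Nonempty) (hne' : ∀ j, (S' j).Nonempty)
    (hS : Pairwise fun j j' => Disjoint (S j) (S j'))
    (hS' : Pairwise fun j j' => Disjoint (S' j) (S' j')) (hSS' : ∀ j j', Disjoint (S j) (S' j')) :
    (Measure.pi fun i => expMeasure (r i)).map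
        (fun c => (fun j => (S j).inf' (hne j) c, fun j => (S' j).inf' (hne' j) c)) =
      (Measure.pi fun j => expMeasure (∑ i ∈ S j, r i)).prod
        (Measure.pi fun j => expMeasure (∑ i ∈ S' j, r i)) := by
  have h := map_inf'_pi_expMeasure r hr (Sum.elim S S') (by rintro (j | j); exacts [hne j, hne' j])
    (by
      rintro (j | j) (j' | j') h
      · exact hS fun e => h (by rw [e])
      · exact hSS' j j'
      · exact (hSS' j' j).symm
      · exact hS' fun e => h (by rw [e]))
  have h2 := (measurePreserving_sumPiEquivProdPi
    (fun j : κ ⊕ κ' => expMeasure (∑ i ∈ Sum.elim S S' j, r i))).map_eq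
  rw [← h, Measure.map_map (by fun_prop) (by fun_prop)] at h2
  exact h2

theorem map_comp_pi_expMeasure {ι κ : Type*} [Fintype ι] [Fintype κ] {r : ℝ} (hr : 0 < r)
    (f : κ → ι) (hf : Function.Injective f) :
    (Measure.pi fun _ : ι => expMeasure r).map (fun c j => c (f j)) =
      Measure.pi fun _ : κ => expMeasure r := by
  classical
  have h := map_inf'_pi_expMeasure (fun _ : ι => r) (fun _ => hr) (fun j => {f j})
    (fun j => Finset.singleton_nonempty _) (fun j j' hj => by simpa using fun e => hj (hf e))
  simpa using h

theorem ae_nonneg_pi_expMeasure {ι : Type*} [Fintype ι] (r : ι → ℝ) :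
    ∀ᵐ c ∂(Measure.pi fun i => expMeasure (r i)), ∀ i, 0 ≤ c i := by
  rw [ae_all_iff]
  intro i
  exact (Measure.quasiMeasurePreserving_eval _ i).ae (ae_nonneg_expMeasure (r i))

end Exponential


/-! ### Memoryless property of exponential vectors -/

theorem map_sub_restrict_expMeasure {k s : ℝ} (hk : 0 < k) (hs : 0 ≤ s) :
    ((expMeasure k).restrict (Set.Ici s)).map (fun x => x - s) =
      ENNReal.ofReal (Real.exp (-(k * s))) • expMeasure k := by
  refine Measure.ext_of_Ici _ _ fun t => ?_
  rw [Measure.map_apply (by fun_prop) measurableSet_Ici,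
    Measure.restrict_apply (measurableSet_Ici.preimage (by fun_prop)), Measure.smul_apply,
    expMeasure_Ici hk]
  have : (fun x => x - s) ⁻¹' Set.Ici t ∩ Set.Ici s = Set.Ici (max t 0 + s) := by
    ext x
    simp only [Set.mem_inter_iff, Set.mem_preimage, Set.mem_Ici]
    constructor
    · rintro ⟨h1, h2⟩
      rcases max_cases t 0 with h | h <;> linarith
    · intro h
      constructor
      · linarith [le_max_left t 0]
      · linarith [le_max_right t 0]
  rw [this, expMeasure_Ici hk, smul_eq_mul, ← ENNReal.ofReal_mul (Real.exp_pos _).le,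
    ← Real.exp_add]
  congr 2
  rw [max_eq_left (a := max t 0 + s) (by positivity)]
  ring

theorem pi_const_smul {ι : Type*} [Fintype ι] (μ : Measure ℝ) [IsFiniteMeasure μ] (c : ℝ≥0∞)
    (hc : c ≠ ∞) :
    (Measure.pi fun _ : ι => c • μ) = c ^ Fintype.card ι • Measure.pi fun _ : ι => μ := by
  have : IsFiniteMeasure (c • μ) := Measure.smul_finite _ hc
  refine Measure.pi_eq fun s _ => ?_
  simp [Measure.pi_pi, Finset.prod_mul_distrib]

theorem lintegral_pi_sub_of_le {ι : Type*} [Fintype ι] {k s : ℝ} (hk : 0 < k) (hs : 0 ≤ s)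
    (G : (ι → ℝ) → ℝ≥0∞) (hG : Measurable G) :
    ∫⁻ y in {y | ∀ x, s ≤ y x}, G (fun x => y x - s) ∂(Measure.pi fun _ : ι => expMeasure k) =
      ENNReal.ofReal (Real.exp (-(k * s * Fintype.card ι))) *
        ∫⁻ y, G y ∂(Measure.pi fun _ : ι => expMeasure k) := by
  have hset : {y : ι → ℝ | ∀ x, s ≤ y x} = Set.univ.pi fun _ => Set.Ici s := by
    ext y; simp only [Set.mem_ofPred_eq, Set.mem_univ_pi, Set.mem_Ici]
  rw [hset, Measure.restrict_pi_pi]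
  have h1 : (Measure.pi fun _ : ι => (expMeasure k).restrict (Set.Ici s)).map
      (fun y x => y x - s) = ENNReal.ofReal (Real.exp (-(k * s * Fintype.card ι))) •
        (Measure.pi fun _ : ι => expMeasure k) := by
    have h := Measure.pi_map_pi (μ := fun _ : ι => (expMeasure k).restrict (Set.Ici s))
      (f := fun _ x => x - s) (fun _ => by fun_prop)
    rw [h, map_sub_restrict_expMeasure hk hs, pi_const_smul _ _ ENNReal.ofReal_ne_top,
      ← ENNReal.ofReal_pow (Real.exp_pos _).le, ← Real.exp_nat_mul]
    congr 3
    ring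
  rw [← lintegral_map hG (by fun_prop), h1, lintegral_smul_measure, smul_eq_mul]

/-- The weight exp(-ksn) is the chance that n further rate `k` clocks exceed s. Against the density
of rate `k` it gives the law of the minimum of n + 1 clocks, times the chance 1/(n + 1) of a given
clock being first. -/
theorem lintegral_exp_neg_mul {k : ℝ} (hk : 0 < k) (n : ℕ) (F : ℝ → ℝ≥0∞) (hF : Measurable F) :
    ∫⁻ s, ENNReal.ofReal (Real.exp (-(k * s * n))) * F s ∂(expMeasure k) =
      ENNReal.ofReal (1 / (n + 1)) * ∫⁻ s, F s ∂(expMeasure (k * (n + 1))) := by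
  rw [expMeasure_eq_withDensity, expMeasure_eq_withDensity,
    lintegral_withDensity_eq_lintegral_mul _ (by fun_prop) (by fun_prop),
    lintegral_withDensity_eq_lintegral_mul _ (by fun_prop) (by fun_prop),
    ← lintegral_const_mul _ (by fun_prop)]
  refine lintegral_congr fun s => ?_
  simp only [Pi.mul_apply, exponentialPDF_eq]
  rw [← mul_assoc, ← mul_assoc]
  congr 1
  split_ifs
  · rw [← ENNReal.ofReal_mul (by positivity), ← ENNReal.ofReal_mul (by positivity), mul_assoc,
      ← Real.exp_add]
    congr 1
    have h : -(k * s) + -(k * s * n) = -(k * (n + 1) * s) := by ring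
    rw [h]
    field_simp
  · simp

theorem map_eval_prod_pi_expMeasure {V : Type*} [Fintype V] [DecidableEq V] {k : ℝ} (hk : 0 < k)
    (a : V) :
    (Measure.pi fun _ : V => expMeasure k).map (fun z => (z a, fun x : {x // x ≠ a} => z x)) =
      (expMeasure k).prod (Measure.pi fun _ : {x // x ≠ a} => expMeasure k) := by
  have h := map_inf'_pi_expMeasure_prod (fun _ : V => k) (fun _ => hk) (fun _ : Unit => {a})
    (fun x : {x // x ≠ a} => {(x : V)}) (fun _ => Finset.singleton_nonempty _)
    (fun _ => Finset.singleton_nonempty _) (fun j j' h => absurd rfl h)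
    (fun x y hxy => by simpa using fun e => hxy (Subtype.ext e))
    (fun _ x => by simpa using x.2.symm)
  simp only [Finset.inf'_singleton, Finset.sum_singleton] at h
  have h2 := ((measurePreserving_funUnique (expMeasure k) Unit).prod
    (MeasurePreserving.id (Measure.pi fun _ : {x // x ≠ a} => expMeasure k))).map_eq
  rw [← h, Measure.map_map (by fun_prop) (by fun_prop)] at h2
  exact h2

/-- Memoryless property at the minimum: on the event that the coordinate `a` is minimal, the
residuals of the other coordinates are again independent exponentials, independent of the
minimum. -/
theorem lintegral_argmin_residual {V : Type*} [Fintype V] [DecidableEq V] {k : ℝ} (hk : 0 < k)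
    (a : V) (G : ℝ → ({x // x ≠ a} → ℝ) → ℝ≥0∞) (hG : Measurable (Function.uncurry G)) :
    ∫⁻ z in {z | ∀ x : {x // x ≠ a}, z a ≤ z x}, G (z a) (fun x => z x - z a)
        ∂(Measure.pi fun _ : V => expMeasure k) =
      ENNReal.ofReal (1 / Fintype.card V) * ∫⁻ s, ∫⁻ y, G s y
        ∂(Measure.pi fun _ : {x // x ≠ a} => expMeasure k)
          ∂(expMeasure (k * Fintype.card V)) := by
  have hm : Measurable fun p : ℝ × ({x // x ≠ a} → ℝ) => G p.1 (fun x => p.2 x - p.1) :=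
    hG.comp (f := fun p : ℝ × ({x // x ≠ a} → ℝ) => (p.1, fun x => p.2 x - p.1)) (by fun_prop)
  have hset : MeasurableSet {p : ℝ × ({x // x ≠ a} → ℝ) | ∀ x, p.1 ≤ p.2 x} := by
    simp only [Set.ofPred_forall]
    exact MeasurableSet.iInter fun x => measurableSet_le (by fun_prop) (by fun_prop)
  have h1 : ∫⁻ z in {z | ∀ x : {x // x ≠ a}, z a ≤ z x}, G (z a) (fun x => z x - z a)
        ∂(Measure.pi fun _ : V => expMeasure k) =
      ∫⁻ s, ∫⁻ y in {y | ∀ x, s ≤ y x}, G s (fun x => y x - s)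
        ∂(Measure.pi fun _ : {x // x ≠ a} => expMeasure k) ∂(expMeasure k) := by
    have h2 : ∫⁻ p in {p : ℝ × ({x // x ≠ a} → ℝ) | ∀ x, p.1 ≤ p.2 x},
        G p.1 (fun x => p.2 x - p.1) ∂((expMeasure k).prod
          (Measure.pi fun _ : {x // x ≠ a} => expMeasure k)) =
      ∫⁻ s, ∫⁻ y in {y | ∀ x, s ≤ y x}, G s (fun x => y x - s)
        ∂(Measure.pi fun _ : {x // x ≠ a} => expMeasure k) ∂(expMeasure k) := by
      rw [← lintegral_indicator hset, lintegral_prod _ (hm.indicator hset).aemeasurable]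
      refine lintegral_congr fun s => ?_
      rw [← lintegral_indicator]
      · rfl
      · exact hset.preimage (measurable_prodMk_left (x := s))
    rw [← h2, ← map_eval_prod_pi_expMeasure hk a,
      setLIntegral_map hset hm (by fun_prop)]
    rfl
  rw [h1]
  have hmi : Measurable fun s => ∫⁻ y, G s y ∂(Measure.pi fun _ : {x // x ≠ a} => expMeasure k) :=
    Measurable.lintegral_prod_right hG
  have h3 : ∫⁻ s, ∫⁻ y in {y | ∀ x, s ≤ y x}, G s (fun x => y x - s)
        ∂(Measure.pi fun _ : {x // x ≠ a} => expMeasure k) ∂(expMeasure k) =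
      ∫⁻ s, ENNReal.ofReal (Real.exp (-(k * s * (Fintype.card {x // x ≠ a} : ℕ)))) *
        ∫⁻ y, G s y ∂(Measure.pi fun _ : {x // x ≠ a} => expMeasure k) ∂(expMeasure k) := by
    refine lintegral_congr_ae ?_
    filter_upwards [ae_nonneg_expMeasure k] with s hs
    exact lintegral_pi_sub_of_le hk hs (G s) (hG.comp measurable_prodMk_left)
  have hcard : ((Fintype.card {x // x ≠ a} : ℕ) : ℝ) + 1 = Fintype.card V := by
    have : Fintype.card {x // x ≠ a} + 1 = Fintype.card V := by
      rw [Fintype.card_subtype_compl, Fintype.card_subtype_eq]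
      have := Fintype.card_pos_iff.2 ⟨a⟩
      omega
    exact_mod_cast this
  rw [h3, lintegral_exp_neg_mul hk _ _ hmi, hcard]


/-! ### Edge sets and rooted trees given by parent maps -/

section Graph

variable {V W : Type*}

theorem reachable_of_forall_adj {G : SimpleGraph V} {H : SimpleGraph W} (f : V → W)
    (h : ∀ u v, G.Adj u v → H.Reachable (f u) (f v)) {a b : V} (hab : G.Reachable a b) :
    H.Reachable (f a) (f b) := by
  obtain ⟨p⟩ := hab
  induction p with
  | nil => exact SimpleGraph.Reachable.refl _
  | cons hadj _ ih => exact (h _ _ hadj).trans ih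

/-- The graph spanned by a finite set of edges. -/
abbrev edgeGraph (F : Finset (Sym2 V)) : SimpleGraph V :=
  SimpleGraph.fromEdgeSet (F : Set (Sym2 V))

theorem edgeGraph_adj {F : Finset (Sym2 V)} {u v : V} :
    (edgeGraph F).Adj u v ↔ s(u, v) ∈ F ∧ u ≠ v := by
  simp [edgeGraph]

theorem edgeGraph_mono {F F' : Finset (Sym2 V)} (h : F ⊆ F') : edgeGraph F ≤ edgeGraph F' :=
  SimpleGraph.fromEdgeSet_mono (by exact_mod_cast h)

/-- The total cost of a finite set of edges. -/
noncomputable def cost (c : Sym2 V → ℝ) (F : Finset (Sym2 V)) : ℝ≥0∞ :=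
  ∑ e ∈ F, ENNReal.ofReal (c e)

theorem cost_union_le [DecidableEq V] (c : Sym2 V → ℝ) (F F' : Finset (Sym2 V)) :
    cost c (F ∪ F') ≤ cost c F + cost c F' := by
  unfold cost
  rw [← Finset.sum_union_inter]
  exact le_self_add

theorem cost_image_le [DecidableEq V] {ι : Type*} (c : Sym2 V → ℝ) (s : Finset ι)
    (f : ι → Sym2 V) : cost c (s.image f) ≤ ∑ i ∈ s, ENNReal.ofReal (c (f i)) :=
  Finset.sum_image_le_of_nonneg (g := f) (f := fun e => ENNReal.ofReal (c e))
    fun _ _ => zero_le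

theorem cost_mono (c : Sym2 V → ℝ) {F F' : Finset (Sym2 V)} (h : F ⊆ F') :
    cost c F ≤ cost c F' :=
  Finset.sum_le_sum_of_subset h

@[fun_prop]
theorem measurable_cost (F : Finset (Sym2 V)) : Measurable fun c : Sym2 V → ℝ => cost c F := by
  unfold cost; fun_prop

theorem edgeGraph_image_reachable [DecidableEq W] (f : V → W) {F : Finset (Sym2 V)} {a b : V}
    (h : (edgeGraph F).Reachable a b) :
    (edgeGraph (F.image (Sym2.map f))).Reachable (f a) (f b) := by
  refine reachable_of_forall_adj f (fun u v huv => ?_) h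
  by_cases hf : f u = f v
  · rw [hf]
  · refine SimpleGraph.Adj.reachable (edgeGraph_adj.2 ⟨?_, hf⟩)
    exact Finset.mem_image.2 ⟨s(u, v), (edgeGraph_adj.1 huv).1, rfl⟩

/-- The homomorphism of edge graphs induced by an injection of the vertices. -/
def edgeGraphHom [DecidableEq W] (f : V → W) (hf : Function.Injective f) (F : Finset (Sym2 V)) :
    edgeGraph F →g edgeGraph (F.image (Sym2.map f)) where
  toFun := f
  map_rel' {u v} h := edgeGraph_adj.2
    ⟨Finset.mem_image.2 ⟨s(u, v), (edgeGraph_adj.1 h).1, rfl⟩, fun e => h.ne (hf e)⟩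

/-- A parent structure: a tree with root `r`, remaining vertices `S`, parent map `p` and depth
function `d`. -/
structure IsRootedTree (r : V) (S : Finset V) (p : V → V) (d : V → ℕ) : Prop where
  root_notMem : r ∉ S
  depth_root : d r = 0
  parent_mem : ∀ v ∈ S, p v = r ∨ p v ∈ S
  depth_parent : ∀ v ∈ S, d v = d (p v) + 1

namespace IsRootedTree

variable {r : V} {S : Finset V} {p : V → V} {d : V → ℕ}

theorem injOn (h : IsRootedTree r S p d) : Set.InjOn (fun v => s(v, p v)) S := by
  intro u hu v hv huv
  rcases Sym2.eq_iff.1 huv with ⟨h1, -⟩ | ⟨h1, h2⟩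
  · exact h1
  · have hu' := h.depth_parent u hu
    have hv' := h.depth_parent v hv
    rw [h2] at hu'
    rw [← h1] at hv'
    omega

theorem parent_ne (h : IsRootedTree r S p d) {v : V} (hv : v ∈ S) : v ≠ p v := fun e => by
  have := h.depth_parent v hv
  rw [← e] at this
  omega

theorem exists_ancestor (h : IsRootedTree r S p d) {F : Finset (Sym2 V)}
    (hF : ∀ v ∈ S, s(v, p v) ∈ F) (m : ℕ) :
    ∀ v, (v = r ∨ v ∈ S) → m ≤ d v → ∃ u, (u = r ∨ u ∈ S) ∧ d u + m = d v ∧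
      ∃ q : (edgeGraph F).Walk u v, q.length = m := by
  induction m with
  | zero => exact fun v hv _ => ⟨v, hv, rfl, .nil, rfl⟩
  | succ m ih =>
    intro v hv hm
    have hvS : v ∈ S := hv.resolve_left (by rintro rfl; rw [h.depth_root] at hm; omega)
    have hd := h.depth_parent v hvS
    obtain ⟨u, hu, hum, q, hq⟩ := ih (p v) (h.parent_mem v hvS) (by omega)
    have hadj : (edgeGraph F).Adj (p v) v :=
      edgeGraph_adj.2 ⟨by rw [Sym2.eq_swap]; exact hF v hvS, (h.parent_ne hvS).symm⟩
    exact ⟨u, hu, by omega, q.concat hadj, by rw [SimpleGraph.Walk.length_concat, hq]⟩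

end IsRootedTree

/-- Breadth-first search: the parent is the next vertex on a shortest path to `r`. Hence any
connecting edge set contains a tree, and its depths are graph distances, which the depth bound
needs. -/
theorem exists_isRootedTree [Fintype V] (G : SimpleGraph V) (r : V) :
    ∃ S p, IsRootedTree r S p (G.dist r) ∧ (∀ v ∈ S, G.Adj v (p v)) ∧
      ∀ v, v ∈ S ↔ v ≠ r ∧ G.Reachable r v := by
  classical
  have hp : ∀ v, ∃ u, v ≠ r ∧ G.Reachable r v →
      G.Adj v u ∧ G.Reachable r u ∧ G.dist r v = G.dist r u + 1 := by
    intro v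
    by_cases hv : v ≠ r ∧ G.Reachable r v
    · obtain ⟨hne, hr⟩ := hv
      obtain ⟨q, hq⟩ := hr.symm.exists_walk_length_eq_dist
      cases q with
      | nil => exact absurd rfl hne
      | @cons _ u _ hadj q =>
        refine ⟨u, fun _ => ⟨hadj, ⟨q.reverse⟩, ?_⟩⟩
        rw [SimpleGraph.Walk.length_cons] at hq
        have h1 : G.dist r u ≤ q.length := by
          rw [SimpleGraph.dist_comm]; exact SimpleGraph.dist_le q
        have h2 : G.dist r v ≤ G.dist r u + 1 := by
          obtain ⟨q', hq'⟩ := (SimpleGraph.Walk.reachable q.reverse).exists_walk_length_eq_dist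
          rw [← hq']
          have := SimpleGraph.dist_le (q'.concat hadj.symm)
          rwa [SimpleGraph.Walk.length_concat] at this
        rw [SimpleGraph.dist_comm] at hq
        omega
    · exact ⟨v, fun h => absurd h hv⟩
  choose p hp using hp
  refine ⟨Finset.univ.filter fun v => v ≠ r ∧ G.Reachable r v, p, ⟨by simp, by simp, ?_, ?_⟩,
    ?_, ?_⟩
  · intro v hv
    obtain ⟨-, h2, -⟩ := hp v (Finset.mem_filter.1 hv).2
    by_cases h : p v = r
    · exact Or.inl h
    · exact Or.inr (Finset.mem_filter.2 ⟨Finset.mem_univ _, h, h2⟩)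
  · exact fun v hv => (hp v (Finset.mem_filter.1 hv).2).2.2
  · exact fun v hv => (hp v (Finset.mem_filter.1 hv).2).1
  · simp

theorem IsRootedTree.sum_le_cost {r : V} {S : Finset V} {p : V → V} {d : V → ℕ}
    (h : IsRootedTree r S p d) (c : Sym2 V → ℝ) {F : Finset (Sym2 V)}
    (hF : ∀ v ∈ S, s(v, p v) ∈ F) : ∑ v ∈ S, ENNReal.ofReal (c s(v, p v)) ≤ cost c F := by
  classical
  rw [← Finset.sum_image (g := fun v => s(v, p v)) (f := fun e => ENNReal.ofReal (c e))
    (fun u hu v hv huv => h.injOn hu hv huv)]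
  exact cost_mono c (Finset.image_subset_iff.2 hF)

end Graph

/-! ### Steiner, first passage and labelled connection costs -/

section Steiner

variable {V : Type*}

/-- The minimum cost of an edge set connecting all terminals. -/
noncomputable def steinerCost (T : Finset V) (c : Sym2 V → ℝ) : ℝ≥0∞ :=
  ⨅ F ∈ {F : Finset (Sym2 V) | ∀ s ∈ T, ∀ t ∈ T, (edgeGraph F).Reachable s t}, cost c F

/-- The minimum cost of an edge set joining the target `v` to some vertex `a`, when starting at `a`
costs `z a`. -/
noncomputable def hitCost (v : V) (z : V → ℝ) (c : Sym2 V → ℝ) : ℝ≥0∞ :=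
  ⨅ F : Finset (Sym2 V), ⨅ a ∈ {a | (edgeGraph F).Reachable a v}, (ENNReal.ofReal (z a) + cost c F)

/-- The minimum cost of an edge set in which every terminal is joined to some vertex `u` by a walk
of length at most `k - L u`. -/
noncomputable def labelCost (k : ℕ) (L : V → ℕ∞) (T : Finset V) (c : Sym2 V → ℝ) : ℝ≥0∞ :=
  ⨅ F ∈ {F : Finset (Sym2 V) | ∀ t ∈ T, ∃ u, ∃ p : (edgeGraph F).Walk u t, L u + p.length ≤ k},
    cost c F

variable [Finite V]

@[fun_prop]
theorem measurable_steinerCost (T : Finset V) : Measurable (steinerCost T) :=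
  Measurable.biInf _ (Set.to_countable _) fun F _ => measurable_cost F

@[fun_prop]
theorem measurable_labelCost (k : ℕ) (L : V → ℕ∞) (T : Finset V) : Measurable (labelCost k L T) :=
  Measurable.biInf _ (Set.to_countable _) fun F _ => measurable_cost F

@[fun_prop]
theorem measurable_hitCost (v : V) : Measurable (Function.uncurry (hitCost v)) := by
  refine Measurable.iInf fun F => Measurable.biInf _ (Set.to_countable _) fun a _ => ?_
  exact ((measurable_pi_apply a).comp measurable_fst).ennreal_ofReal.add
    ((measurable_cost F).comp measurable_snd)

omit [Finite V] in
theorem steinerCost_le {T : Finset V} {F : Finset (Sym2 V)}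
    (hF : ∀ s ∈ T, ∀ t ∈ T, (edgeGraph F).Reachable s t) (c : Sym2 V → ℝ) :
    steinerCost T c ≤ cost c F := iInf₂_le F hF

omit [Finite V] in
theorem labelCost_le {k : ℕ} {L : V → ℕ∞} {T : Finset V} {F : Finset (Sym2 V)}
    (hF : ∀ t ∈ T, ∃ u, ∃ p : (edgeGraph F).Walk u t, L u + p.length ≤ k) (c : Sym2 V → ℝ) :
    labelCost k L T c ≤ cost c F := iInf₂_le F hF

theorem exists_cost_eq_steinerCost (T : Finset V) (c : Sym2 V → ℝ) :
    ∃ F : Finset (Sym2 V), (∀ s ∈ T, ∀ t ∈ T, (edgeGraph F).Reachable s t) ∧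
      cost c F = steinerCost T c := by
  classical
  have := Fintype.ofFinite V
  have hne : {F : Finset (Sym2 V) |
      ∀ s ∈ T, ∀ t ∈ T, (edgeGraph F).Reachable s t}.Nonempty := by
    refine ⟨Finset.univ, fun s _ t _ => ?_⟩
    by_cases h : s = t
    · rw [h]
    · exact SimpleGraph.Adj.reachable (edgeGraph_adj.2 ⟨Finset.mem_univ _, h⟩)
  obtain ⟨F, hF, h⟩ := (Set.toFinite _).exists_minimalFor (fun F => cost c F) _ hne
  refine ⟨F, hF, le_antisymm (le_iInf₂ fun F' hF' => ?_) (steinerCost_le hF c)⟩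
  exact (le_total (cost c F) (cost c F')).elim id (h hF')

omit [Finite V] in
theorem steinerCost_mono {T T' : Finset V} (h : T ⊆ T') (c : Sym2 V → ℝ) :
    steinerCost T c ≤ steinerCost T' c :=
  le_iInf₂ fun _ hF => steinerCost_le (fun s hs t ht => hF s (h hs) t (h ht)) c

/-- An optimal Steiner edge set can be taken to be a tree, given by parents. -/
theorem exists_isRootedTree_sum_le_steinerCost [DecidableEq V] {T : Finset V} {r : V} (hr : r ∈ T)
    (c : Sym2 V → ℝ) :
    ∃ S p d, IsRootedTree r S p d ∧ T ⊆ insert r S ∧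
      ∑ v ∈ S, ENNReal.ofReal (c s(v, p v)) ≤ steinerCost T c := by
  have := Fintype.ofFinite V
  obtain ⟨F, hF, hc⟩ := exists_cost_eq_steinerCost T c
  obtain ⟨S, p, h, hadj, hS⟩ := exists_isRootedTree (edgeGraph F) r
  refine ⟨S, p, _, h, fun t ht => ?_, ?_⟩
  · by_cases htr : t = r
    · simp [htr]
    · exact Finset.mem_insert_of_mem ((hS t).2 ⟨htr, hF r hr t ht⟩)
  · rw [← hc]
    exact h.sum_le_cost c fun v hv => (edgeGraph_adj.1 (hadj v hv)).1

end Steiner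


/-! ### Pointwise inequalities: exploring, attaching levels, cutting a tree -/

section Deterministic

variable {V : Type*}

theorem hitCost_le {v : V} {F : Finset (Sym2 V)} {a : V} (h : (edgeGraph F).Reachable a v)
    (z : V → ℝ) (c : Sym2 V → ℝ) : hitCost v z c ≤ ENNReal.ofReal (z a) + cost c F :=
  (iInf_le _ F).trans (iInf₂_le a h)

theorem hitCost_self_le (v : V) (z : V → ℝ) (c : Sym2 V → ℝ) :
    hitCost v z c ≤ ENNReal.ofReal (z v) := by
  have := hitCost_le (F := ∅) (SimpleGraph.Reachable.refl v) z c
  simpa [cost] using this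

variable [DecidableEq V]

theorem cost_image_map_le {W : Type*} (f : W → V) (c : Sym2 V → ℝ) (F : Finset (Sym2 W)) :
    cost c (F.image (Sym2.map f)) ≤ cost (fun e => c (e.map f)) F :=
  cost_image_le c F _

theorem cost_insert_le (c : Sym2 V → ℝ) (e : Sym2 V) (F : Finset (Sym2 V)) :
    cost c (insert e F) ≤ ENNReal.ofReal (c e) + cost c F := by
  have := cost_union_le c {e} F
  rwa [← Finset.insert_eq, cost, cost, Finset.sum_singleton] at this

/-- One step of first passage percolation: after the vertex `a` closest to the source has been
reached, it is merged with the source. -/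
theorem hitCost_le_add_residual (a : V) (v : {x // x ≠ a}) (z : V → ℝ) (c : Sym2 V → ℝ) :
    hitCost (v : V) z c ≤ ENNReal.ofReal (z a) +
      hitCost v (fun x : {x // x ≠ a} => min (z x - z a) (c s(a, x)))
        (fun e => c (e.map Subtype.val)) := by
  conv_rhs => unfold hitCost
  simp_rw [ENNReal.add_iInf]
  refine le_iInf fun F => le_iInf₂ fun x hx => ?_
  have hx' := edgeGraph_image_reachable (Subtype.val : {x // x ≠ a} → V) hx
  have hc := cost_image_map_le (Subtype.val : {x // x ≠ a} → V) c F
  rw [← add_assoc]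
  -- The minimum tells whether the optimal route enters `x` directly from the source, having waited
  -- for `a` in the meantime, or through `a`.
  rcases le_total (z x - z a) (c s(a, x)) with h | h
  · rw [min_eq_left h]
    refine (hitCost_le hx' z c).trans (add_le_add ?_ hc)
    refine le_trans (ENNReal.ofReal_le_ofReal ?_) ENNReal.ofReal_add_le
    linarith
  · rw [min_eq_right h, add_assoc]
    have hr : (edgeGraph (insert s(a, (x : V)) (F.image (Sym2.map Subtype.val)))).Reachable
        a v := by
      refine SimpleGraph.Reachable.trans (SimpleGraph.Adj.reachable (v := (x : V)) ?_)
        (hx'.mono (edgeGraph_mono (Finset.subset_insert _ _)))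
      exact edgeGraph_adj.2 ⟨Finset.mem_insert_self _ _, x.2.symm⟩
    refine (hitCost_le hr z c).trans (add_le_add le_rfl ?_)
    exact (cost_insert_le _ _ _).trans (add_le_add le_rfl hc)

/-- Contract `T` to a source. Reaching `x` from it costs the cheapest edge from `T` to `x`, and the
rest of the route uses only edges outside `T`, which is a first passage problem. -/
theorem steinerCost_insert_le {T : Finset V} (hT : T.Nonempty) (v : {x // x ∉ T})
    (c : Sym2 V → ℝ) :
    steinerCost (insert (v : V) T) c ≤ steinerCost T c +
      hitCost v (fun x : {x // x ∉ T} => T.inf' hT fun t => c s(t, x))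
        (fun e => c (e.map Subtype.val)) := by
  unfold hitCost
  conv_rhs => lhs; unfold steinerCost
  simp_rw [ENNReal.iInf_add, ENNReal.add_iInf]
  refine le_iInf₂ fun F₁ hF₁ => le_iInf fun F₂ => le_iInf₂ fun x hx => ?_
  obtain ⟨t, ht, hmin⟩ := Finset.exists_mem_eq_inf' hT fun t => c s(t, (x : V))
  rw [hmin]
  set F := F₁ ∪ insert s(t, (x : V)) (F₂.image (Sym2.map Subtype.val)) with hF
  have h1 : ∀ s ∈ T, (edgeGraph F).Reachable t s := fun s hs =>
    (hF₁ t ht s hs).mono (edgeGraph_mono Finset.subset_union_left)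
  have h2 : (edgeGraph F).Reachable t v := by
    refine SimpleGraph.Reachable.trans (v := (x : V)) (SimpleGraph.Adj.reachable ?_) ?_
    · exact edgeGraph_adj.2 ⟨by simp [hF], fun e => x.2 (e ▸ ht)⟩
    · exact (edgeGraph_image_reachable (Subtype.val : {x // x ∉ T} → V) hx).mono
        (edgeGraph_mono ((Finset.subset_insert _ _).trans Finset.subset_union_right))
  have h3 : ∀ s ∈ insert (v : V) T, (edgeGraph F).Reachable t s := by
    intro s hs
    rcases Finset.mem_insert.1 hs with rfl | hs
    · exact h2
    · exact h1 s hs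
  refine (steinerCost_le (fun s hs s' hs' => (h3 s hs).symm.trans (h3 s' hs')) c).trans ?_
  refine (cost_union_le _ _ _).trans (add_le_add le_rfl ((cost_insert_le _ _ _).trans ?_))
  exact add_le_add le_rfl (cost_image_map_le _ c F₂)

/-- Attaching a level: the vertices of `A` are removed after the vertices of `A'` have been joined
to them. -/
theorem labelCost_le_sum_add {k j : ℕ} (hjk : j ≤ k) {L : V → ℕ∞} (T : Finset V) {A : Finset V}
    (hA : A.Nonempty) (hL : ∀ a ∈ A, L a ≤ j) (A' : Finset {x // x ∉ A}) {L' : {x // x ∉ A} → ℕ∞}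
    (hL' : ∀ x ∈ A', (j + 1 : ℕ∞) ≤ L' x) (hLL' : ∀ x ∉ A', L x ≤ L' x) (c : Sym2 V → ℝ) :
    labelCost k L T c ≤ ∑ x ∈ A', ENNReal.ofReal (A.inf' hA fun a => c s(a, x)) +
      labelCost k L' (T.subtype (· ∉ A)) (fun e => c (e.map Subtype.val)) := by
  conv_rhs => rhs; unfold labelCost
  simp_rw [ENNReal.add_iInf]
  refine le_iInf₂ fun F' hF' => ?_
  choose α hα hmin using fun x : {x // x ∉ A} =>
    Finset.exists_mem_eq_inf' hA fun a => c s(a, (x : V))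
  set F := A'.image (fun x => s(α x, (x : V))) ∪ F'.image (Sym2.map Subtype.val) with hF
  refine (labelCost_le (F := F) (fun t ht => ?_) c).trans ?_
  · by_cases htA : t ∈ A
    · exact ⟨t, .nil, by simpa using (hL t htA).trans (by exact_mod_cast hjk)⟩
    · obtain ⟨u, q, hq⟩ := hF' ⟨t, htA⟩ (by simpa using ht)
      let q' : (edgeGraph F).Walk u t := (q.map (edgeGraphHom Subtype.val Subtype.val_injective F')
        ).mapLe (edgeGraph_mono Finset.subset_union_right)
      have hq' : q'.length = q.length :=
        (SimpleGraph.Walk.length_map _ _).trans (SimpleGraph.Walk.length_map _ _)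
      by_cases hu : u ∈ A'
      · have hadj : (edgeGraph F).Adj (α u) u := by
          refine edgeGraph_adj.2 ⟨Finset.mem_union_left _ (Finset.mem_image.2 ⟨u, hu, rfl⟩), ?_⟩
          exact fun e => u.2 (e ▸ hα u)
        refine ⟨α u, .cons hadj q', ?_⟩
        rw [SimpleGraph.Walk.length_cons, hq']
        refine le_trans ?_ hq
        calc L (α u) + ((q.length + 1 : ℕ) : ℕ∞) ≤ j + ((q.length + 1 : ℕ) : ℕ∞) :=
              add_le_add (hL _ (hα u)) le_rfl
          _ = (j + 1) + q.length := by push_cast; ring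
          _ ≤ L' u + q.length := add_le_add (hL' u hu) le_rfl
      · exact ⟨u, q', by rw [hq']; exact (add_le_add (hLL' u hu) le_rfl).trans hq⟩
  · refine (cost_union_le _ _ _).trans (add_le_add ?_ (cost_image_map_le _ c F'))
    refine (cost_image_le _ _ _).trans (le_of_eq ?_)
    exact Finset.sum_congr rfl fun x _ => by rw [hmin x]

/-- Cutting a tree at all vertices whose depth lies in a fixed residue class and joining these
vertices to the set `A`. -/
theorem labelCost_le_tree_add {k K D : ℕ} (hk : K + 1 + D ≤ k) {L : V → ℕ∞} {T A : Finset V}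
    (hA : A.Nonempty) (hL : ∀ a ∈ A, L a ≤ K) {b : {x // x ∉ A}} (hb : L b ≤ 1)
    {S : Finset {x // x ∉ A}} {p : {x // x ∉ A} → {x // x ∉ A}} {d : {x // x ∉ A} → ℕ}
    (h : IsRootedTree b S p d) (hT : T.subtype (· ∉ A) ⊆ insert b S) (c : Sym2 V → ℝ)
    {i : ℕ} (hi : i ≤ D) :
    labelCost k L T c ≤ ∑ v ∈ S, ENNReal.ofReal (c s((v : V), p v)) +
      ∑ v ∈ S with d v % (D + 1) = i, ENNReal.ofReal (A.inf' hA fun a => c s(a, (v : V))) := by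
  set A' := S.filter fun v => d v % (D + 1) = i with hA'
  -- The value ⊤ forbids every start other than the cut vertices, which hang below `A`, and the root
  -- `b` of the tree.
  set L' : {x // x ∉ A} → ℕ∞ := fun x => if x ∈ A' then (K + 1 : ℕ∞) else if x = b then 1 else ⊤
    with hL'
  refine (labelCost_le_sum_add (j := K) (by omega) T hA hL A' (L' := L') ?_ ?_ c).trans ?_
  · intro x hx
    simp only [hL', if_pos hx, le_refl]
  · intro x hx
    simp only [hL', if_neg hx]
    split_ifs with hxb
    · rw [hxb]; exact hb
    · exact le_top
  rw [add_comm]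
  refine add_le_add ?_ le_rfl
  set F := S.image fun v => s(v, p v)
  have hF : ∀ v ∈ S, s(v, p v) ∈ F := fun v hv => Finset.mem_image.2 ⟨v, hv, rfl⟩
  refine (labelCost_le (F := F) ?_ _).trans (cost_image_le _ _ _)
  intro t ht
  have ht' := Finset.mem_insert.1 (hT ht)
  by_cases hd : d t ≤ D
  · obtain ⟨u, hu, hdu, q, hq⟩ := h.exists_ancestor hF (d t) t ht' le_rfl
    have hub : u = b := by
      refine hu.resolve_right fun hu => ?_
      have := h.depth_parent u hu
      omega
    subst hub
    refine ⟨u, q, ?_⟩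
    have : u ∉ A' := fun hu => h.root_notMem (Finset.mem_filter.1 hu).1
    simp only [hL', if_neg this, if_true, hq]
    exact_mod_cast (by omega : 1 + d t ≤ k)
  -- This is `d t - i` modulo `D + 1` without negative numbers: the distance up to the nearest
  -- ancestor of residue `i`. As m ≤ D < `d t`, that ancestor is not `b`.
  · set m := (d t + (D + 1 - i)) % (D + 1) with hm
    have hmD : m < D + 1 := Nat.mod_lt _ (by omega)
    obtain ⟨u, hu, hdu, q, hq⟩ := h.exists_ancestor hF m t ht' (by omega)
    have huS : u ∈ S := hu.resolve_left fun e => by rw [e, h.depth_root] at hdu; omega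
    have hmod : d u % (D + 1) = i := by
      have h1 : (d u + m) ≡ i + m [MOD (D + 1)] := by
        rw [hdu]
        have h2 : i + m ≡ i + (d t + (D + 1 - i)) [MOD (D + 1)] :=
          Nat.ModEq.add_left _ (Nat.mod_modEq _ _)
        have h3 : i + (d t + (D + 1 - i)) = d t + (D + 1) := by omega
        rw [h3] at h2
        exact (h2.trans (by simp [Nat.ModEq])).symm
      have h4 := Nat.ModEq.add_right_cancel' m h1
      rwa [Nat.ModEq, Nat.mod_eq_of_lt (by omega : i < D + 1)] at h4
    have huA : u ∈ A' := Finset.mem_filter.2 ⟨huS, hmod⟩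
    refine ⟨u, q, ?_⟩
    simp only [hL', if_pos huA, hq]
    exact_mod_cast (by omega : K + 1 + m ≤ k)

/-- Averaging `labelCost_le_tree_add` over the residue classes. -/
theorem labelCost_le_tree_add_div {k K D : ℕ} (hk : K + 1 + D ≤ k) {L : V → ℕ∞} {T A : Finset V}
    (hA : A.Nonempty) (hL : ∀ a ∈ A, L a ≤ K) {b : {x // x ∉ A}} (hb : L b ≤ 1)
    {S : Finset {x // x ∉ A}} {p : {x // x ∉ A} → {x // x ∉ A}} {d : {x // x ∉ A} → ℕ}
    (h : IsRootedTree b S p d) (hT : T.subtype (· ∉ A) ⊆ insert b S) (c : Sym2 V → ℝ) :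
    labelCost k L T c ≤ ∑ v ∈ S, ENNReal.ofReal (c s((v : V), p v)) +
      (∑ v ∈ S, ENNReal.ofReal (A.inf' hA fun a => c s(a, (v : V)))) / (D + 1 : ℕ) := by
  have h1 := Finset.sum_le_sum fun i (hi : i ∈ Finset.range (D + 1)) =>
    labelCost_le_tree_add hk hA hL hb h hT c (Nat.lt_succ_iff.1 (Finset.mem_range.1 hi))
  rw [Finset.sum_const, Finset.sum_add_distrib, Finset.sum_const, Finset.card_range,
    Finset.sum_fiberwise_of_maps_to (fun v _ => Finset.mem_range.2 (Nat.mod_lt _ (by omega))),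
    nsmul_eq_mul, nsmul_eq_mul] at h1
  have h0 : ((D + 1 : ℕ) : ℝ≥0∞) ≠ 0 := by simp
  have ht : ((D + 1 : ℕ) : ℝ≥0∞) ≠ ∞ := ENNReal.natCast_ne_top _
  calc labelCost k L T c = ((D + 1 : ℕ) : ℝ≥0∞) * labelCost k L T c / (D + 1 : ℕ) := by
        rw [mul_comm, ENNReal.mul_div_cancel_right h0 ht]
    _ ≤ _ := ENNReal.div_le_div_right h1 _
    _ = _ := by
      rw [ENNReal.add_div, mul_comm, ENNReal.mul_div_cancel_right h0 ht]

end Deterministic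


/-! ### Mean first passage cost -/

section FirstPassage

/-- Merging `a` with the source races the residual clock of rate `k` against the edge from `a` of
rate 1. The new source costs have rate `k + 1`, and they are independent of the edges avoiding `a`.
-/
theorem map_min_prod_pi_expMeasure {V : Type*} [Fintype V] [DecidableEq V] {k : ℝ} (hk : 0 < k)
    (a : V) :
    ((Measure.pi fun _ : {x // x ≠ a} => expMeasure k).prod
        (Measure.pi fun _ : Sym2 V => expMeasure 1)).map
      (fun q => (fun x : {x // x ≠ a} => min (q.1 x) (q.2 s(a, (x : V))),
        fun e : Sym2 {x // x ≠ a} => q.2 (e.map Subtype.val))) =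
      (Measure.pi fun _ : {x // x ≠ a} => expMeasure (k + 1)).prod
        (Measure.pi fun _ : Sym2 {x // x ≠ a} => expMeasure 1) := by
  have hr : ∀ i : {x // x ≠ a} ⊕ Sym2 V, 0 < Sum.elim (fun _ => k) (fun _ => (1 : ℝ)) i := by
    rintro (i | i) <;> simp [hk]
  have h := map_inf'_pi_expMeasure_prod (Sum.elim (fun _ : {x // x ≠ a} => k)
    (fun _ : Sym2 V => (1 : ℝ))) hr (fun x : {x // x ≠ a} => {Sum.inl x, Sum.inr s(a, (x : V))})
    (fun e : Sym2 {x // x ≠ a} => {Sum.inr (e.map Subtype.val)})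
    (fun _ => Finset.insert_nonempty _ _)
    (fun _ => Finset.singleton_nonempty _)
    (fun x y hxy => by
      simp only [Finset.disjoint_insert_left, Finset.disjoint_singleton_left, Finset.mem_insert,
        Finset.mem_singleton, Sum.inl.injEq, Sum.inr.injEq, reduceCtorEq, or_false, false_or]
      exact ⟨hxy, fun e => hxy (Subtype.ext (Sym2.congr_right.1 e))⟩)
    (fun e e' h => by
      simp only [Finset.disjoint_singleton, ne_eq, Sum.inr.injEq]
      exact fun h' => h (Sym2.map.injective Subtype.val_injective h'))
    (fun x e => by
      simp only [Finset.disjoint_singleton_right, Finset.mem_insert, Finset.mem_singleton,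
        Sum.inr.injEq, reduceCtorEq, false_or]
      intro h'
      have : a ∈ e.map Subtype.val := h' ▸ Sym2.mem_mk_left _ _
      obtain ⟨y, -, hy⟩ := Sym2.mem_map.1 this
      exact y.2 hy)
  have h2 := (measurePreserving_sumPiEquivProdPi
    (fun i : {x // x ≠ a} ⊕ Sym2 V => expMeasure
      (Sum.elim (fun _ => k) (fun _ => (1 : ℝ)) i))).map_eq
  have h3 : ∀ x : {x // x ≠ a}, ∑ i ∈ ({Sum.inl x, Sum.inr s(a, (x : V))} :
      Finset ({x // x ≠ a} ⊕ Sym2 V)), Sum.elim (fun _ => k) (fun _ => (1 : ℝ)) i = k + 1 := by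
    intro x
    rw [Finset.sum_pair (by simp)]
    rfl
  simp only [h3, Finset.sum_singleton, Sum.elim_inr, Finset.inf'_singleton] at h
  simp only [Sum.elim_inl, Sum.elim_inr] at h2
  rw [← h, ← h2, Measure.map_map (by fun_prop) (by fun_prop)]
  congr 1

/-- The first vertex reached is uniform among the N and appears after mean time 1/(kN). Unless it is
the target, the same problem remains with N - 1 vertices and rate k + 1. The bound solves this
recursion. -/
theorem lintegral_hitCost_le.{u} (N : ℕ) : ∀ (V : Type u) [Fintype V] [DecidableEq V] (v : V)
    (k : ℝ), 0 < k → Fintype.card V = N →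
    ∫⁻ c, ∫⁻ z, hitCost v z c ∂(Measure.pi fun _ : V => expMeasure k)
      ∂(Measure.pi fun _ : Sym2 V => expMeasure 1) ≤
      ENNReal.ofReal (1 / N * ∑ i ∈ Finset.range N, 1 / (k + i)) := by
  induction N with
  | zero =>
    intro V _ _ v k _ hV
    exact absurd hV (Fintype.card_pos_iff.2 ⟨v⟩).ne'
  | succ N ih =>
    intro V _ _ v k hk hV
    have := isProbabilityMeasure_expMeasure hk
    have hN : (0 : ℝ) < N + 1 := by positivity
    have hcard : (Fintype.card V : ℝ) = N + 1 := by rw [hV]; push_cast; rfl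
    -- The remaining cost once `a` is reached; it vanishes when `a` is the target.
    let H : (a : V) → ({x // x ≠ a} → ℝ) → (Sym2 V → ℝ) → ℝ≥0∞ := fun a y c =>
      if h : v ≠ a then hitCost (⟨v, h⟩ : {x // x ≠ a}) (fun x => min (y x) (c s(a, (x : V))))
        (fun e => c (e.map Subtype.val)) else 0
    have hHm : ∀ a, Measurable (Function.uncurry (H a)) := by
      intro a
      by_cases h : v ≠ a
      · have : Function.uncurry (H a) = (fun q => Function.uncurry
            (hitCost (⟨v, h⟩ : {x // x ≠ a})) q) ∘
            (fun q : ({x // x ≠ a} → ℝ) × (Sym2 V → ℝ) =>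
              (fun x : {x // x ≠ a} => min (q.1 x) (q.2 s(a, (x : V))),
                fun e : Sym2 {x // x ≠ a} => q.2 (e.map Subtype.val))) := by
          ext q; simp [H, h, Function.uncurry]
        rw [this]
        exact (measurable_hitCost _).comp (by fun_prop)
      · have : Function.uncurry (H a) = fun _ => 0 := by
          ext q; simp [H, h, Function.uncurry]
        rw [this]
        fun_prop
    have hstep : ∀ c, ∫⁻ z, hitCost v z c ∂(Measure.pi fun _ : V => expMeasure k) ≤
        ∑ a : V, ENNReal.ofReal (1 / (N + 1)) * (ENNReal.ofReal (1 / (k * (N + 1))) +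
          ∫⁻ y, H a y c ∂(Measure.pi fun _ : {x // x ≠ a} => expMeasure k)) := by
      intro c
      have hcover : (⋃ a : V, {z : V → ℝ | ∀ x : {x // x ≠ a}, z a ≤ z x}) = Set.univ := by
        refine Set.eq_univ_of_forall fun z => Set.mem_iUnion.2 ?_
        have : Nonempty V := ⟨v⟩
        obtain ⟨a, ha⟩ := Finite.exists_min z
        exact ⟨a, fun x => ha x⟩
      -- The events that `a` is minimal overlap at ties, which is harmless for an upper bound.
      rw [← setLIntegral_univ, ← hcover]
      refine (lintegral_iUnion_le _ _).trans ?_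
      rw [tsum_fintype]
      refine Finset.sum_le_sum fun a _ => ?_
      have h1 : ∫⁻ z in {z | ∀ x : {x // x ≠ a}, z a ≤ z x}, hitCost v z c
          ∂(Measure.pi fun _ : V => expMeasure k) ≤
          ∫⁻ z in {z | ∀ x : {x // x ≠ a}, z a ≤ z x},
            (fun s y => ENNReal.ofReal s + H a y c) (z a) (fun x : {x // x ≠ a} => z x - z a)
            ∂(Measure.pi fun _ : V => expMeasure k) := by
        refine lintegral_mono fun z => ?_
        by_cases h : v ≠ a
        · simpa only [H, dif_pos h] using hitCost_le_add_residual a ⟨v, h⟩ z c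
        · simp only [H, dif_neg h, add_zero]
          rw [← not_not.1 h]
          exact hitCost_self_le v z c
      refine h1.trans ?_
      rw [lintegral_argmin_residual hk a (fun s y => ENNReal.ofReal s + H a y c)
        (by
          have := (hHm a).comp (measurable_snd.prodMk (measurable_const (a := c)) :
            Measurable fun q : ℝ × ({x // x ≠ a} → ℝ) => (q.2, c))
          exact (measurable_fst.ennreal_ofReal).add this), hcard]
      refine mul_le_mul_right (le_of_eq ?_) _
      have h2 : ∀ s : ℝ, ∫⁻ y, (ENNReal.ofReal s + H a y c)
          ∂(Measure.pi fun _ : {x // x ≠ a} => expMeasure k) = ENNReal.ofReal s +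
          ∫⁻ y, H a y c ∂(Measure.pi fun _ : {x // x ≠ a} => expMeasure k) := by
        intro s
        rw [lintegral_add_left measurable_const, lintegral_const, measure_univ, mul_one]
      have hp := isProbabilityMeasure_expMeasure (r := k * (N + 1)) (by positivity)
      simp_rw [h2]
      rw [lintegral_add_right _ measurable_const, lintegral_const, measure_univ, mul_one,
        lintegral_ofReal_expMeasure (by positivity)]
    have hH : ∀ a, ∫⁻ c, ∫⁻ y, H a y c ∂(Measure.pi fun _ : {x // x ≠ a} => expMeasure k)
        ∂(Measure.pi fun _ : Sym2 V => expMeasure 1) ≤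
        if v = a then 0 else
          ENNReal.ofReal (1 / N * ∑ i ∈ Finset.range N, 1 / (k + 1 + i)) := by
      intro a
      split_ifs with h
      · simp [H, h]
      · have hc : Fintype.card {x // x ≠ a} = N := by
          rw [Fintype.card_subtype_compl, Fintype.card_subtype_eq]
          omega
        refine le_trans (le_of_eq ?_) (ih {x // x ≠ a} ⟨v, h⟩ (k + 1) (by linarith) hc)
        have hk1 := isProbabilityMeasure_expMeasure (r := k + 1) (by linarith)
        have e1 := lintegral_prod_symm' (μ := Measure.pi fun _ : {x // x ≠ a} => expMeasure k)
          (ν := Measure.pi fun _ : Sym2 V => expMeasure 1) _ (hHm a)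
        have e2 := lintegral_prod_symm'
          (μ := Measure.pi fun _ : {x // x ≠ a} => expMeasure (k + 1))
          (ν := Measure.pi fun _ : Sym2 {x // x ≠ a} => expMeasure 1) _
          (measurable_hitCost (⟨v, h⟩ : {x // x ≠ a}))
        refine e1.symm.trans (Eq.trans ?_ e2)
        rw [← map_min_prod_pi_expMeasure hk a, lintegral_map (measurable_hitCost _) (by fun_prop)]
        refine lintegral_congr fun q => ?_
        simp only [H, Function.uncurry, ne_eq, h, not_false_eq_true, dite_true]
    refine (lintegral_mono hstep).trans ?_
    have hmeas : ∀ a, Measurable fun c => ∫⁻ y, H a y c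
        ∂(Measure.pi fun _ : {x // x ≠ a} => expMeasure k) := fun a =>
      Measurable.lintegral_prod_left (hHm a)
    rw [lintegral_finsetSum _ (fun a _ => by
      exact ((hmeas a).const_add _).const_mul _)]
    have hs : 0 ≤ ∑ i ∈ Finset.range N, 1 / (k + 1 + i) :=
      Finset.sum_nonneg fun i _ => by positivity
    calc _ ≤ ∑ a : V, ENNReal.ofReal (1 / (N + 1)) * (ENNReal.ofReal (1 / (k * (N + 1))) +
          if v = a then 0 else
          ENNReal.ofReal (1 / N * ∑ i ∈ Finset.range N, 1 / (k + 1 + i))) := by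
          refine Finset.sum_le_sum fun a _ => ?_
          rw [lintegral_const_mul _ ((hmeas a).const_add _),
            lintegral_add_left measurable_const, lintegral_const, measure_univ, mul_one]
          exact mul_le_mul_right (add_le_add le_rfl (hH a)) _
      _ = ENNReal.ofReal (1 / (N + 1)) * ((N + 1 : ℕ) * ENNReal.ofReal (1 / (k * (N + 1))) +
          N * ENNReal.ofReal (1 / N * ∑ i ∈ Finset.range N, 1 / (k + 1 + i))) := by
          rw [← Finset.mul_sum, Finset.sum_add_distrib, Finset.sum_const, Finset.card_univ, hV,
            nsmul_eq_mul, Finset.sum_ite, Finset.sum_const_zero, zero_add, Finset.sum_const,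
            nsmul_eq_mul]
          congr 4
          rw [Finset.filter_not, Finset.filter_eq, if_pos (Finset.mem_univ _),
            Finset.card_sdiff_of_subset (by simp), Finset.card_univ, hV]
          simp
      _ ≤ _ := by
          rw [← ENNReal.ofReal_natCast, ← ENNReal.ofReal_natCast N,
            ← ENNReal.ofReal_mul (by positivity), ← ENNReal.ofReal_mul (by positivity),
            ← ENNReal.ofReal_add (by positivity) (by positivity),
            ← ENNReal.ofReal_mul (by positivity)]
          refine ENNReal.ofReal_le_ofReal ?_
          rw [Finset.sum_range_succ']
          push_cast
          rw [mul_le_mul_iff_right₀ (by positivity)]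
          have h1 : ((N : ℝ) + 1) * (1 / (k * (N + 1))) = 1 / (k + 0) := by
            rw [add_zero]; field_simp
          have h2 : ∑ i ∈ Finset.range N, 1 / (k + 1 + i) =
              ∑ i ∈ Finset.range N, 1 / (k + ((i : ℝ) + 1)) :=
            Finset.sum_congr rfl fun i _ => by ring_nf
          rw [h1, ← h2, add_comm]
          refine add_le_add ?_ le_rfl
          rcases Nat.eq_zero_or_pos N with h0 | h0
          · simp [h0]
          · have : (0 : ℝ) < N := by exact_mod_cast h0
            rw [← mul_assoc, mul_one_div_cancel this.ne', one_mul]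

end FirstPassage


/-! ### Mean Steiner cost and the price of one more terminal -/

section MeanSteiner

theorem map_comp_sym2Map {V W : Type*} [Fintype V] [DecidableEq V] [Fintype W] [DecidableEq W]
    (f : V → W) (hf : Function.Injective f) :
    (Measure.pi fun _ : Sym2 W => expMeasure 1).map (fun c (e : Sym2 V) => c (e.map f)) =
      Measure.pi fun _ : Sym2 V => expMeasure 1 :=
  map_comp_pi_expMeasure one_pos _ (Sym2.map.injective hf)

/-- The expected cost of a minimum Steiner tree with independent mean one exponential costs. -/
noncomputable def meanSteiner {V : Type*} [Fintype V] [DecidableEq V] (T : Finset V) : ℝ≥0∞ :=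
  ∫⁻ c, steinerCost T c ∂(Measure.pi fun _ : Sym2 V => expMeasure 1)

theorem steinerCost_image_le {V W : Type*} [DecidableEq W] (f : V → W) (T : Finset V)
    (c : Sym2 W → ℝ) :
    steinerCost (T.image f) c ≤ steinerCost T (fun e => c (e.map f)) := by
  refine le_iInf₂ fun F hF => ?_
  refine (steinerCost_le (F := F.image (Sym2.map f)) ?_ c).trans (cost_image_map_le f c F)
  intro s hs t ht
  obtain ⟨s', hs', rfl⟩ := Finset.mem_image.1 hs
  obtain ⟨t', ht', rfl⟩ := Finset.mem_image.1 ht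
  exact edgeGraph_image_reachable f (hF s' hs' t' ht')

variable {V W : Type*} [Fintype V] [DecidableEq V] [Fintype W] [DecidableEq W]

theorem meanSteiner_image_le (f : V → W) (hf : Function.Injective f) (T : Finset V) :
    meanSteiner (T.image f) ≤ meanSteiner T := by
  unfold meanSteiner
  rw [← map_comp_sym2Map f hf, lintegral_map (by fun_prop) (by fun_prop)]
  exact lintegral_mono fun c => steinerCost_image_le f T c

theorem meanSteiner_mono {T T' : Finset V} (h : T ⊆ T') : meanSteiner T ≤ meanSteiner T' :=
  lintegral_mono fun c => steinerCost_mono h c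

theorem exists_equiv_image_eq {T : Finset V} {T' : Finset W} (hV : Fintype.card V = Fintype.card W)
    (hT : T.card = T'.card) : ∃ e : V ≃ W, T.image e = T' := by
  have e₁ : {x // x ∈ T} ≃ {x // x ∈ T'} := Finset.equivOfCardEq hT
  have e₂ : {x // x ∉ T} ≃ {x // x ∉ T'} := Fintype.equivOfCardEq (by
    rw [Fintype.card_subtype_compl, Fintype.card_subtype_compl]
    simp [hV, hT])
  refine ⟨(Equiv.sumCompl (· ∈ T)).symm.trans ((Equiv.sumCongr e₁ e₂).trans
    (Equiv.sumCompl (· ∈ T'))), ?_⟩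
  refine Finset.eq_of_subset_of_card_le ?_ ?_
  · intro y hy
    obtain ⟨x, hx, rfl⟩ := Finset.mem_image.1 hy
    simp [Equiv.sumCompl_symm_apply_of_pos hx]
  · rw [Finset.card_image_of_injective _ (Equiv.injective _), hT]

/-- The costs are exchangeable, so only the numbers of vertices and terminals matter. This justifies
`meanSteinerNum`. -/
theorem meanSteiner_le_of_card_le {T : Finset V} {T' : Finset W}
    (hV : Fintype.card V = Fintype.card W) (hT : T'.card ≤ T.card) :
    meanSteiner T' ≤ meanSteiner T := by
  obtain ⟨T₀, hT₀, hc⟩ := Finset.exists_subset_card_eq hT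
  obtain ⟨e, rfl⟩ := exists_equiv_image_eq hV hc
  exact (meanSteiner_image_le e e.injective T₀).trans (meanSteiner_mono hT₀)

/-- `meanSteiner` for `M` terminals among `N` vertices. -/
noncomputable def meanSteinerNum (N M : ℕ) : ℝ≥0∞ :=
  meanSteiner (Finset.univ.filter fun i : Fin N => (i : ℕ) < M)

theorem card_fin_filter_lt {N M : ℕ} (h : M ≤ N) :
    (Finset.univ.filter fun i : Fin N => (i : ℕ) < M).card = M := by
  rw [Fin.card_filter_val_lt, min_eq_right h]

theorem meanSteiner_eq {T : Finset V} {N M : ℕ} (hV : Fintype.card V = N) (hT : T.card = M) :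
    meanSteiner T = meanSteinerNum N M := by
  have hM : M ≤ N := by rw [← hV, ← hT]; exact Finset.card_le_univ T
  have hV' : Fintype.card V = Fintype.card (Fin N) := by rw [hV, Fintype.card_fin]
  have hT' := hT.trans (card_fin_filter_lt hM).symm
  exact le_antisymm (meanSteiner_le_of_card_le hV'.symm hT'.le)
    (meanSteiner_le_of_card_le hV' hT'.ge)

theorem meanSteinerNum_mono {N M M' : ℕ} (h : M ≤ M') :
    meanSteinerNum N M ≤ meanSteinerNum N M' :=
  meanSteiner_mono fun i hi => by
    simp only [Finset.mem_filter, Finset.mem_univ, true_and] at hi ⊢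
    omega

theorem meanSteinerNum_one (N : ℕ) : meanSteinerNum N 1 = 0 := by
  have : ∀ c, steinerCost (Finset.univ.filter fun i : Fin N => (i : ℕ) < 1) c = 0 := by
    intro c
    refine le_antisymm ((steinerCost_le (F := ∅) ?_ c).trans (by simp [cost])) zero_le
    intro s hs t ht
    have hs' : (s : ℕ) < 1 := (Finset.mem_filter.1 hs).2
    have ht' : (t : ℕ) < 1 := (Finset.mem_filter.1 ht).2
    obtain rfl : s = t := Fin.ext (by omega)
    rfl
  simp only [meanSteinerNum, meanSteiner, this, lintegral_zero]

/-- The costs from a set `A` to the vertices outside, together with the costs of the edges outside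
`A`. -/
theorem map_inf'_cross_pi_expMeasure {A : Finset V} (hA : A.Nonempty) :
    (Measure.pi fun _ : Sym2 V => expMeasure 1).map
      (fun c => (fun x : {x // x ∉ A} => A.inf' hA fun a => c s(a, (x : V)),
        fun e : Sym2 {x // x ∉ A} => c (e.map Subtype.val))) =
      (Measure.pi fun _ : {x // x ∉ A} => expMeasure A.card).prod
        (Measure.pi fun _ : Sym2 {x // x ∉ A} => expMeasure 1) := by
  have hinj : ∀ x : V, Set.InjOn (fun a => s(a, x)) A := fun x a _ b _ h => Sym2.congr_left.1 h
  have h := map_inf'_pi_expMeasure_prod (fun _ : Sym2 V => (1 : ℝ)) (fun _ => one_pos)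
    (fun x : {x // x ∉ A} => A.image fun a => s(a, (x : V)))
    (fun e : Sym2 {x // x ∉ A} => {e.map Subtype.val})
    (fun _ => hA.image _)
    (fun _ => Finset.singleton_nonempty _)
    (fun x y hxy => by
      refine Finset.disjoint_left.2 ?_
      rintro e he he'
      obtain ⟨a, ha, rfl⟩ := Finset.mem_image.1 he
      obtain ⟨b, hb, h⟩ := Finset.mem_image.1 he'
      rcases Sym2.eq_iff.1 h with ⟨-, h⟩ | ⟨h, -⟩
      · exact hxy (Subtype.ext h.symm)
      · exact x.2 (h ▸ hb))
    (fun e e' h => by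
      simp only [Finset.disjoint_singleton]
      exact fun h' => h (Sym2.map.injective Subtype.val_injective h'))
    (fun x e => by
      rw [Finset.disjoint_singleton_right]
      intro h'
      obtain ⟨a, ha, h⟩ := Finset.mem_image.1 h'
      have : a ∈ e.map Subtype.val := h ▸ Sym2.mem_mk_left _ _
      obtain ⟨y, -, hy⟩ := Sym2.mem_map.1 this
      exact y.2 (hy ▸ ha))
  have h3 : ∀ x : {x // x ∉ A}, ∑ i ∈ A.image (fun a => s(a, (x : V))), (1 : ℝ) = A.card := by
    intro x
    rw [Finset.sum_const, Finset.card_image_of_injOn (hinj x), nsmul_eq_mul, mul_one]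
  simp only [h3, Finset.sum_singleton, Finset.inf'_singleton, Finset.inf'_image] at h
  exact h

omit [Fintype V] [DecidableEq V] in
@[fun_prop]
theorem measurable_inf'_cross {A : Finset V} (hA : A.Nonempty) (x : V) :
    Measurable fun c : Sym2 V → ℝ => A.inf' hA fun a => c s(a, x) :=
  (measurable_inf'_apply A hA).comp (g := fun z : V → ℝ => A.inf' hA z) (by fun_prop)

/-- The cheapest edge from `T` to an outside vertex has rate |T| and is independent of the edges
outside `T`, so `lintegral_hitCost_le` applies with k = |T|. -/
theorem meanSteiner_insert_le {T : Finset V} (hT : T.Nonempty) {v : V} (hv : v ∉ T) :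
    meanSteiner (insert v T) ≤ meanSteiner T +
      ENNReal.ofReal (1 / (Fintype.card V - T.card : ℕ) *
        ∑ i ∈ Finset.range (Fintype.card V - T.card), 1 / ((T.card : ℝ) + i)) := by
  have hT0 : (0 : ℝ) < T.card := by exact_mod_cast hT.card_pos
  have := isProbabilityMeasure_expMeasure hT0
  have hc : Fintype.card {x // x ∉ T} = Fintype.card V - T.card := by
    rw [Fintype.card_subtype_compl]; simp
  refine (lintegral_mono fun c => steinerCost_insert_le hT ⟨v, hv⟩ c).trans ?_
  rw [lintegral_add_left (by fun_prop)]
  refine add_le_add le_rfl ?_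
  refine le_trans (le_of_eq ?_) (lintegral_hitCost_le _ {x // x ∉ T} ⟨v, hv⟩ T.card hT0 hc)
  have e2 := lintegral_prod_symm' (μ := Measure.pi fun _ : {x // x ∉ T} => expMeasure T.card)
    (ν := Measure.pi fun _ : Sym2 {x // x ∉ T} => expMeasure 1) _
    (measurable_hitCost (⟨v, hv⟩ : {x // x ∉ T}))
  refine Eq.trans ?_ e2
  rw [← map_inf'_cross_pi_expMeasure hT, lintegral_map (measurable_hitCost _) (by fun_prop)]
  rfl

theorem meanSteinerNum_succ_le {N M : ℕ} (hM : 1 ≤ M) (hMN : M < N) :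
    meanSteinerNum N (M + 1) ≤ meanSteinerNum N M +
      ENNReal.ofReal (1 / (N - M : ℕ) * ∑ i ∈ Finset.range (N - M), 1 / ((M : ℝ) + i)) := by
  set T := Finset.univ.filter fun i : Fin N => (i : ℕ) < M with hT
  have hcard : T.card = M := card_fin_filter_lt hMN.le
  have hne : T.Nonempty := Finset.card_pos.1 (by omega)
  have hv : (⟨M, hMN⟩ : Fin N) ∉ T := by simp [hT]
  have h := meanSteiner_insert_le hne hv
  rwa [meanSteiner_eq (Fintype.card_fin N) hcard, meanSteiner_eq (Fintype.card_fin N)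
    (by rw [Finset.card_insert_of_notMem hv, hcard]), Fintype.card_fin, hcard] at h

/-- A cruder bound, kept to restore a terminal that is lost when two vertices are identified. -/
theorem meanSteinerNum_succ_le' {N M : ℕ} (hM : 1 ≤ M) (hMN : M < N) :
    meanSteinerNum N (M + 1) ≤ meanSteinerNum N M + ENNReal.ofReal (1 / M) := by
  refine (meanSteinerNum_succ_le hM hMN).trans (add_le_add le_rfl (ENNReal.ofReal_le_ofReal ?_))
  have hM0 : (0 : ℝ) < M := by exact_mod_cast hM
  have hN : (0 : ℝ) < (N - M : ℕ) := by exact_mod_cast (by omega : 0 < N - M)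
  have : ∑ i ∈ Finset.range (N - M), 1 / ((M : ℝ) + i) ≤ (N - M : ℕ) * (1 / M) := by
    refine (Finset.sum_le_card_nsmul _ _ (1 / (M : ℝ)) fun i _ => ?_).trans (by simp)
    exact one_div_le_one_div_of_le hM0 (by linarith [Nat.cast_nonneg (α := ℝ) i])
  calc _ ≤ 1 / ((N - M : ℕ) : ℝ) * ((N - M : ℕ) * (1 / M)) := by gcongr
    _ = 1 / M := by field_simp

end MeanSteiner


/-! ### Identifying two vertices -/

section Merge

variable {V : Type*} [DecidableEq V]

/-- The map identifying the vertex `v` with the vertex `u`. -/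
def mergeVertex {u v : V} (huv : u ≠ v) (x : V) : {x // x ≠ v} :=
  if h : x = v then ⟨u, huv⟩ else ⟨x, h⟩

/-- The section of `mergeVertex` that maps `u` to `v`. -/
def unmergeVertex (u v : V) (x : {x // x ≠ v}) : V :=
  if (x : V) = u then v else x

variable {u v : V} (huv : u ≠ v)

theorem mergeVertex_val (x : {x // x ≠ v}) : mergeVertex huv x = x := by
  simp [mergeVertex, x.2]

theorem mergeVertex_unmergeVertex (x : {x // x ≠ v}) :
    mergeVertex huv (unmergeVertex u v x) = x := by
  unfold unmergeVertex
  split_ifs with h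
  · simp only [mergeVertex, dif_pos]
    exact Subtype.ext h.symm
  · exact mergeVertex_val huv x

/-- The edges that become the edge `e` when `u` and `v` are identified, except loops. -/
def mergeBlock (u v : V) (e : Sym2 {x // x ≠ v}) : Finset (Sym2 V) :=
  {e.map Subtype.val, e.map (unmergeVertex u v)}

theorem mergeBlock_nonempty (u v : V) (e : Sym2 {x // x ≠ v}) : (mergeBlock u v e).Nonempty :=
  Finset.insert_nonempty _ _

theorem map_mergeVertex_of_mem_mergeBlock {e : Sym2 {x // x ≠ v}} {f : Sym2 V}
    (h : f ∈ mergeBlock u v e) : f.map (mergeVertex huv) = e := by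
  rcases Finset.mem_insert.1 h with rfl | h
  · rw [Sym2.map_map, show mergeVertex huv ∘ Subtype.val = id from funext (mergeVertex_val huv),
      Sym2.map_id, id]
  · rw [Finset.mem_singleton.1 h, Sym2.map_map, show mergeVertex huv ∘ unmergeVertex u v = id from
      funext (mergeVertex_unmergeVertex huv), Sym2.map_id, id]

theorem mem_mergeBlock {e : Sym2 V} (he : ¬ (e.map (mergeVertex huv)).IsDiag) :
    e ∈ mergeBlock u v (e.map (mergeVertex huv)) := by
  induction e with
  | _ x y =>
  simp only [mergeBlock, Finset.mem_insert, Finset.mem_singleton, Sym2.map_mk]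
  simp only [Sym2.map_mk, Sym2.mk_isDiag_iff] at he
  by_cases hx : x = v
  · subst hx
    by_cases hy : y = x
    · exact absurd (by rw [hy]) he
    · have hyu : y ≠ u := by
        rintro rfl
        exact he (Subtype.ext (by simp [mergeVertex, hy]))
      right
      simp [mergeVertex, unmergeVertex, hy, hyu]
  · by_cases hy : y = v
    · subst hy
      have hxu : x ≠ u := by
        rintro rfl
        exact he (Subtype.ext (by simp [mergeVertex, hx]))
      right
      simp [mergeVertex, unmergeVertex, hx, hxu]
    · left
      simp [mergeVertex, hx, hy]

theorem card_mergeBlock_le (e : Sym2 V) :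
    (mergeBlock u v (e.map (mergeVertex huv))).card ≤
      1 + (if u ∈ e then 1 else 0) + (if v ∈ e then 1 else 0) := by
  by_cases h : u ∈ e ∨ v ∈ e
  · refine (Finset.card_insert_le _ _).trans ?_
    rw [Finset.card_singleton]
    rcases h with h | h
    · simp only [if_pos h]; omega
    · simp only [if_pos h]; omega
  · push Not at h
    have heq : (e.map (mergeVertex huv)).map (unmergeVertex u v) =
        (e.map (mergeVertex huv)).map Subtype.val := by
      rw [Sym2.map_map, Sym2.map_map]
      refine Sym2.map_congr fun x hx => ?_
      have hxu : x ≠ u := fun e' => h.1 (e' ▸ hx)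
      have hxv : x ≠ v := fun e' => h.2 (e' ▸ hx)
      simp [mergeVertex, unmergeVertex, hxu, hxv]
    rw [mergeBlock, heq]
    simp [h.1, h.2]

/-- The rescaled minima over the blocks. -/
noncomputable def mergeCost (u v : V) (c : Sym2 V → ℝ) (e : Sym2 {x // x ≠ v}) : ℝ :=
  (mergeBlock u v e).card * (mergeBlock u v e).inf' (mergeBlock_nonempty u v e) c

-- A minimum over a block of b edges has rate b, and multiplication by b restores mean one. The
-- blocks are disjoint because each determines the edge it is merged into.
include huv in
theorem map_mergeCost [Fintype V] :
    (Measure.pi fun _ : Sym2 V => expMeasure 1).map (mergeCost u v) =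
      Measure.pi fun _ : Sym2 {x // x ≠ v} => expMeasure 1 := by
  have h := map_inf'_pi_expMeasure (fun _ : Sym2 V => (1 : ℝ)) (fun _ => one_pos)
    (mergeBlock u v) (mergeBlock_nonempty u v) (fun e e' hee' => Finset.disjoint_left.2
      fun f hf hf' => hee' ((map_mergeVertex_of_mem_mergeBlock huv hf).symm.trans
        (map_mergeVertex_of_mem_mergeBlock huv hf')))
  simp only [Finset.sum_const, nsmul_eq_mul, mul_one] at h
  have hpos : ∀ e, (0 : ℝ) < (mergeBlock u v e).card := fun e => by
    exact_mod_cast (mergeBlock_nonempty u v e).card_pos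
  have h2 := Measure.pi_map_pi
    (μ := fun e : Sym2 {x // x ≠ v} => expMeasure ((mergeBlock u v e).card : ℝ))
    (f := fun e x => ((mergeBlock u v e).card : ℝ) * x) (fun _ => by fun_prop)
  have h3 : ∀ e : Sym2 {x // x ≠ v}, (expMeasure ((mergeBlock u v e).card : ℝ)).map
      (fun x => ((mergeBlock u v e).card : ℝ) * x) = expMeasure 1 := fun e => by
    have := map_const_mul_expMeasure one_pos (hpos e)
    rwa [mul_one] at this
  simp only [h3] at h2
  rw [← h, Measure.map_map (by fun_prop) (by fun_prop)] at h2
  exact h2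

theorem measurable_mergeCost (u v : V) : Measurable (mergeCost u v) := by
  unfold mergeCost; fun_prop

/-- The image of `F`, with loops discarded, connects the merged terminals. An edge is charged the
size of its block, which can exceed 1 only when the edge meets `u` or `v`. -/
theorem steinerCost_mergeCost_le (T : Finset V) (c : Sym2 V → ℝ) {F : Finset (Sym2 V)}
    (hF : ∀ s ∈ T, ∀ t ∈ T, (edgeGraph F).Reachable s t) :
    steinerCost (T.image (mergeVertex huv)) (mergeCost u v c) ≤
      ∑ e ∈ F, (1 + (if u ∈ e then 1 else 0) + (if v ∈ e then 1 else 0)) *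
        ENNReal.ofReal (c e) := by
  set F' := (F.filter fun e => ¬ (e.map (mergeVertex huv)).IsDiag).image
    (Sym2.map (mergeVertex huv)) with hF'
  have hreach : ∀ s ∈ T.image (mergeVertex huv), ∀ t ∈ T.image (mergeVertex huv),
      (edgeGraph F').Reachable s t := by
    intro s hs t ht
    obtain ⟨s', hs', rfl⟩ := Finset.mem_image.1 hs
    obtain ⟨t', ht', rfl⟩ := Finset.mem_image.1 ht
    refine reachable_of_forall_adj (mergeVertex huv) (fun x y hxy => ?_) (hF s' hs' t' ht')
    by_cases h : mergeVertex huv x = mergeVertex huv y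
    · rw [h]
    · refine SimpleGraph.Adj.reachable (edgeGraph_adj.2 ⟨?_, h⟩)
      refine Finset.mem_image.2 ⟨s(x, y), Finset.mem_filter.2 ⟨(edgeGraph_adj.1 hxy).1, ?_⟩, rfl⟩
      simpa using h
  refine (steinerCost_le hreach _).trans ((cost_image_le _ _ _).trans ?_)
  refine le_trans (Finset.sum_le_sum fun e he => ?_)
    (Finset.sum_le_sum_of_subset (Finset.filter_subset _ _))
  have hmem := mem_mergeBlock huv (Finset.mem_filter.1 he).2
  have h1 : mergeCost u v c (e.map (mergeVertex huv)) ≤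
      (mergeBlock u v (e.map (mergeVertex huv))).card * c e :=
    mul_le_mul_of_nonneg_left (Finset.inf'_le _ hmem) (Nat.cast_nonneg _)
  refine (ENNReal.ofReal_le_ofReal h1).trans ?_
  rw [ENNReal.ofReal_mul (Nat.cast_nonneg _), ENNReal.ofReal_natCast]
  refine mul_le_mul_left ?_ _
  have := card_mergeBlock_le huv e
  have h2 : (((mergeBlock u v (e.map (mergeVertex huv))).card : ℕ) : ℝ≥0∞) ≤
    ((1 + (if u ∈ e then 1 else 0) + (if v ∈ e then 1 else 0) : ℕ) : ℝ≥0∞) := by exact_mod_cast this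
  refine h2.trans (le_of_eq ?_)
  push_cast
  rfl

theorem card_image_mergeVertex {T : Finset V} :
    T.card ≤ (T.image (mergeVertex huv)).card + (if u ∈ T ∧ v ∈ T then 1 else 0) := by
  have hinj : Set.InjOn (mergeVertex huv) (T.erase v) := by
    intro x hx y hy h
    have hx' : x ≠ v := Finset.ne_of_mem_erase hx
    have hy' : y ≠ v := Finset.ne_of_mem_erase hy
    simpa [mergeVertex, hx', hy'] using h
  by_cases hv : v ∈ T
  · have h1 := Finset.card_erase_add_one hv
    rw [← Finset.card_image_of_injOn hinj] at h1
    by_cases hu : u ∈ T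
    · rw [if_pos ⟨hu, hv⟩, ← h1]
      exact Nat.add_le_add_right (Finset.card_le_card
        (Finset.image_subset_image (Finset.erase_subset _ _))) 1
    · rw [if_neg (fun h => hu h.1), add_zero, ← h1]
      have hnot : (⟨u, huv⟩ : {x // x ≠ v}) ∉ (T.erase v).image (mergeVertex huv) := by
        intro h
        obtain ⟨x, hx, hxu⟩ := Finset.mem_image.1 h
        have hx' : x ≠ v := Finset.ne_of_mem_erase hx
        simp only [mergeVertex, dif_neg hx', Subtype.mk.injEq] at hxu
        exact hu (hxu ▸ Finset.mem_of_mem_erase hx)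
      rw [← Finset.card_insert_of_notMem hnot]
      refine Finset.card_le_card (Finset.insert_subset ?_
        (Finset.image_subset_image (Finset.erase_subset _ _)))
      exact Finset.mem_image.2 ⟨v, hv, by simp [mergeVertex]⟩
  · rw [Finset.erase_eq_of_notMem hv] at hinj
    rw [Finset.card_image_of_injOn hinj]
    exact Nat.le_add_right _ _

/-- A terminal disappears only if `u` and `v` are both terminals, and it is put back at cost 1/(M -
1). The minimum with `N` is needed because all N + 1 vertices may have been terminals. -/
theorem meanSteinerNum_le_meanSteiner_merge [Fintype V] {N M : ℕ} (hV : Fintype.card V = N + 1)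
    {T : Finset V} (hT : T.card = M) :
    meanSteinerNum N (min M N) ≤ meanSteiner (T.image (mergeVertex huv)) +
      if u ∈ T ∧ v ∈ T then ENNReal.ofReal (1 / (M - 1)) else 0 := by
  have hV' : Fintype.card {x // x ≠ v} = N := by
    rw [Fintype.card_subtype_compl, Fintype.card_subtype_eq]; omega
  rw [meanSteiner_eq hV' rfl]
  have h1 := card_image_mergeVertex huv (T := T)
  rw [hT] at h1
  split_ifs at h1 ⊢ with h
  · have hM2 : 2 ≤ M := by
      rw [← hT, ← Finset.card_pair huv]
      exact Finset.card_le_card (Finset.insert_subset h.1 (Finset.singleton_subset_iff.2 h.2))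
    rcases le_or_gt (min M N) (T.image (mergeVertex huv)).card with h2 | h2
    · exact (meanSteinerNum_mono h2).trans le_self_add
    · have h3 : (T.image (mergeVertex huv)).card = M - 1 := by omega
      have h4 := meanSteinerNum_succ_le' (N := N) (M := M - 1) (by omega) (by omega)
      rw [h3]
      rw [Nat.sub_add_cancel (by omega), Nat.cast_sub (by omega), Nat.cast_one] at h4
      exact (meanSteinerNum_mono (min_le_left _ _)).trans h4
  · rw [add_zero]
    exact meanSteinerNum_mono ((min_le_left _ _).trans (by simpa using h1))

end Merge


/-! ### Upper bounds for the mean Steiner cost -/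

section Bounds

theorem sum_range_succ_one_div_add_le {j : ℕ} (hj : 1 ≤ j) (l : ℕ) :
    ∑ i ∈ Finset.range (l + 1), 1 / ((j : ℝ) + i) ≤ 1 + (Real.log (j + l) - Real.log j) := by
  have hj0 : (1 : ℝ) ≤ j := by exact_mod_cast hj
  induction l with
  | zero => simpa using inv_le_one_of_one_le₀ hj0
  | succ l ih =>
    rw [Finset.sum_range_succ]
    have hl : (0 : ℝ) < j + l := by positivity
    have h1 := Real.one_sub_inv_le_log_of_pos (x := ((j : ℝ) + (l + 1)) / (j + l)) (by positivity)
    rw [Real.log_div (by positivity) (by positivity), inv_div] at h1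
    have h2 : 1 / ((j : ℝ) + (l + 1)) = 1 - (j + l) / (j + (l + 1)) := by field_simp; ring
    push_cast
    linarith

/-- For j ≤ n/2 the prefactor is at most 2/n and the harmonic sum is logarithmic. For larger j each
summand, hence the average, is at most 1/j ≤ 2/n. -/
theorem one_div_mul_sum_le {n j : ℕ} (hj : 1 ≤ j) (hjn : j < n) :
    1 / ((n - j : ℕ) : ℝ) * ∑ i ∈ Finset.range (n - j), 1 / ((j : ℝ) + i) ≤
      2 / n * (1 + Real.log n - Real.log j) := by
  have hj0 : (0 : ℝ) < j := by exact_mod_cast hj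
  have hn0 : (0 : ℝ) < n := by exact_mod_cast (by omega : 0 < n)
  have hjn' : (j : ℝ) ≤ n := by exact_mod_cast hjn.le
  have hnj : (0 : ℝ) < ((n - j : ℕ) : ℝ) := by exact_mod_cast (by omega : 0 < n - j)
  have hlog : Real.log j ≤ Real.log n := Real.log_le_log hj0 hjn'
  rcases le_or_gt (2 * j) n with h | h
  · have h1 : 1 / ((n - j : ℕ) : ℝ) ≤ 2 / n := by
      rw [div_le_div_iff₀ hnj hn0, Nat.cast_sub hjn.le]
      have : (2 : ℝ) * j ≤ n := by exact_mod_cast h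
      linarith
    refine mul_le_mul h1 ?_ (Finset.sum_nonneg fun i _ => by positivity) (by positivity)
    have h2 := sum_range_succ_one_div_add_le hj (n - j - 1)
    rw [show n - j - 1 + 1 = n - j by omega] at h2
    have h3 : Real.log ((j : ℝ) + (n - j - 1 : ℕ)) ≤ Real.log n := by
      refine Real.log_le_log (by positivity) ?_
      exact_mod_cast (by omega : j + (n - j - 1) ≤ n)
    linarith
  · have h1 : ∑ i ∈ Finset.range (n - j), 1 / ((j : ℝ) + i) ≤ (n - j : ℕ) * (1 / j) := by
      refine (Finset.sum_le_card_nsmul _ _ (1 / (j : ℝ)) fun i _ => ?_).trans (by simp)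
      exact one_div_le_one_div_of_le hj0 (by linarith [Nat.cast_nonneg (α := ℝ) i])
    have h2 : (n : ℝ) ≤ 2 * j := by exact_mod_cast h.le
    calc _ ≤ 1 / ((n - j : ℕ) : ℝ) * ((n - j : ℕ) * (1 / j)) := by gcongr
      _ = 1 / j := by field_simp
      _ ≤ 2 / n := by rw [div_le_div_iff₀ hj0 hn0]; linarith
      _ ≤ 2 / n * (1 + Real.log n - Real.log j) :=
        le_mul_of_one_le_right (by positivity) (by linarith)

theorem mul_one_add_log_sub_nonneg {n m : ℕ} (hm : 1 ≤ m) (hmn : m ≤ n) :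
    0 ≤ ((m - 1 : ℕ) : ℝ) * (1 + Real.log n) - Real.log ((m - 1).factorial) := by
  have hn : (0 : ℝ) < n := by exact_mod_cast (by omega : 0 < n)
  have h1 : Real.log ((m - 1).factorial) ≤ ((m - 1 : ℕ) : ℝ) * Real.log n := by
    rw [← Real.log_pow]
    refine Real.log_le_log (by exact_mod_cast Nat.factorial_pos _) ?_
    have h2 : (m - 1).factorial ≤ n ^ (m - 1) :=
      (Nat.factorial_le_pow _).trans (Nat.pow_le_pow_left (by omega) _)
    exact_mod_cast h2
  have : (0 : ℝ) ≤ (m - 1 : ℕ) := Nat.cast_nonneg _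
  linarith

/-- The terminals are added one at a time, and the terms 1 + log n - log j are summed over 1 ≤ j <
m. -/
theorem meanSteinerNum_le_log_factorial {n m : ℕ} (hm : 1 ≤ m) (hmn : m ≤ n) :
    meanSteinerNum n m ≤ ENNReal.ofReal
      (2 / n * (((m - 1 : ℕ) : ℝ) * (1 + Real.log n) - Real.log ((m - 1).factorial))) := by
  induction m, hm using Nat.le_induction with
  | base => rw [meanSteinerNum_one]; exact zero_le
  | succ m hm ih =>
    refine (meanSteinerNum_succ_le hm (by omega)).trans ?_
    refine (add_le_add (ih (by omega))
      (ENNReal.ofReal_le_ofReal (one_div_mul_sum_le hm (by omega)))).trans ?_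
    have hm0 : (1 : ℝ) ≤ m := by exact_mod_cast hm
    have hlog : Real.log m ≤ Real.log n :=
      Real.log_le_log (by linarith) (by exact_mod_cast (by omega : m ≤ n))
    rw [← ENNReal.ofReal_add (mul_nonneg (by positivity)
      (mul_one_add_log_sub_nonneg hm (by omega))) (mul_nonneg (by positivity) (by linarith)),
      ← mul_add]
    refine ENNReal.ofReal_le_ofReal (mul_le_mul_of_nonneg_left (le_of_eq ?_) (by positivity))
    have hf : m.factorial = m * (m - 1).factorial := (Nat.mul_factorial_pred (by omega)).symm
    rw [Nat.add_sub_cancel, hf, Nat.cast_mul, Real.log_mul (by linarith)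
      (by exact_mod_cast (Nat.factorial_pos _).ne'), Nat.cast_sub hm, Nat.cast_one]
    ring

theorem log_factorial_pred_ge {m : ℕ} (hm : 1 ≤ m) :
    m * Real.log m - m - Real.log m ≤ Real.log ((m - 1).factorial) := by
  have hm0 : (1 : ℝ) ≤ m := by exact_mod_cast hm
  have hf : m.factorial = m * (m - 1).factorial := (Nat.mul_factorial_pred (by omega)).symm
  have hpos : (0 : ℝ) < m.factorial := by exact_mod_cast Nat.factorial_pos _
  have h1 := Real.pow_div_factorial_le_exp (x := m) (by linarith) m
  rw [div_le_iff₀ hpos] at h1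
  have h2 := Real.log_le_log (by positivity) h1
  rw [Real.log_pow, Real.log_mul (Real.exp_pos _).ne' hpos.ne', Real.log_exp, hf, Nat.cast_mul,
    Real.log_mul (by linarith) (by exact_mod_cast (Nat.factorial_pos _).ne')] at h2
  linarith

/-- The elementary Stirling bound m^m/m! ≤ e^m turns the factorial into m log m, leaving 2m(1 +
log(n/m)). -/
theorem meanSteinerNum_le {n m : ℕ} (hm : 1 ≤ m) (hmn : m ≤ n) :
    meanSteinerNum n m ≤ ENNReal.ofReal (4 * (m * (1 + Real.log (n / m)) / n)) := by
  refine (meanSteinerNum_le_log_factorial hm hmn).trans (ENNReal.ofReal_le_ofReal ?_)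
  have hm0 : (1 : ℝ) ≤ m := by exact_mod_cast hm
  have hmn' : (m : ℝ) ≤ n := by exact_mod_cast hmn
  have hn0 : (0 : ℝ) < n := by linarith
  have hlog : Real.log m ≤ Real.log n := Real.log_le_log (by linarith) hmn'
  have h1 := log_factorial_pred_ge hm
  rw [Real.log_div hn0.ne' (by linarith), Nat.cast_sub hm, Nat.cast_one]
  have h2 : ((m : ℝ) - 1) * (1 + Real.log n) - Real.log ((m - 1).factorial) ≤
      2 * (m * (1 + (Real.log n - Real.log m))) := by
    have h3 : 0 ≤ (m : ℝ) * (Real.log n - Real.log m) := mul_nonneg (by linarith) (by linarith)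
    nlinarith
  calc _ ≤ 2 / (n : ℝ) * (2 * (m * (1 + (Real.log n - Real.log m)))) := by gcongr
    _ = _ := by ring

theorem meanSteinerNum_le_four (n m : ℕ) : meanSteinerNum n m ≤ ENNReal.ofReal 4 := by
  rcases Nat.eq_zero_or_pos n with rfl | hn
  · have : meanSteinerNum 0 m = meanSteinerNum 0 1 := by
      unfold meanSteinerNum
      congr 1
    rw [this, meanSteinerNum_one]
    exact zero_le
  · have h1 : meanSteinerNum n m ≤ meanSteinerNum n n := meanSteiner_mono fun i _ => by
      simp
    refine h1.trans ((meanSteinerNum_le hn le_rfl).trans (ENNReal.ofReal_le_ofReal (le_of_eq ?_)))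
    have : (n : ℝ) ≠ 0 := by exact_mod_cast hn.ne'
    rw [div_self this, Real.log_one]
    field_simp
    ring

end Bounds

/-! ### Mean Steiner cost after deleting vertices -/

section MergeBounds

theorem sum_offDiag_mem_le {V : Type*} [Fintype V] [DecidableEq V] {N : ℕ}
    (hV : Fintype.card V = N + 1) (e : Sym2 V) :
    ∑ q ∈ (Finset.univ : Finset V).offDiag,
      (1 + (if q.1 ∈ e then 1 else 0) + (if q.2 ∈ e then 1 else 0)) ≤ (N + 1) * N + 4 * N := by
  induction e with
  | _ x y =>
  have hfst : ∀ x : V, ∑ q ∈ (Finset.univ : Finset V).offDiag, (if q.1 = x then 1 else 0) ≤ N := by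
    intro x
    rw [← Finset.card_filter]
    have : (Finset.univ : Finset V).offDiag.filter (fun q => q.1 = x) ⊆
        (Finset.univ.erase x).image fun y => (x, y) := by
      rintro ⟨a, b⟩ h
      simp only [Finset.mem_filter, Finset.mem_offDiag, Finset.mem_univ, true_and] at h
      obtain ⟨h1, rfl⟩ := h
      exact Finset.mem_image.2 ⟨b, Finset.mem_erase.2 ⟨fun e => h1 e.symm, Finset.mem_univ _⟩, rfl⟩
    refine (Finset.card_le_card this).trans (Finset.card_image_le.trans ?_)
    rw [Finset.card_erase_of_mem (Finset.mem_univ _), Finset.card_univ, hV]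
    omega
  have hsnd : ∀ x : V, ∑ q ∈ (Finset.univ : Finset V).offDiag, (if q.2 = x then 1 else 0) ≤ N := by
    intro x
    rw [← Finset.card_filter]
    have : (Finset.univ : Finset V).offDiag.filter (fun q => q.2 = x) ⊆
        (Finset.univ.erase x).image fun y => (y, x) := by
      rintro ⟨a, b⟩ h
      simp only [Finset.mem_filter, Finset.mem_offDiag, Finset.mem_univ, true_and] at h
      obtain ⟨h1, rfl⟩ := h
      exact Finset.mem_image.2 ⟨a, Finset.mem_erase.2 ⟨h1, Finset.mem_univ _⟩, rfl⟩
    refine (Finset.card_le_card this).trans (Finset.card_image_le.trans ?_)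
    rw [Finset.card_erase_of_mem (Finset.mem_univ _), Finset.card_univ, hV]
    omega
  have hor : ∀ a : V, (if a ∈ s(x, y) then 1 else 0) ≤
      (if a = x then 1 else 0) + (if a = y then 1 else 0) := by
    intro a
    simp only [Sym2.mem_iff]
    split_ifs <;> simp_all
  calc _ ≤ ∑ q ∈ (Finset.univ : Finset V).offDiag, (1 + ((if q.1 = x then 1 else 0) +
        (if q.1 = y then 1 else 0)) + ((if q.2 = x then 1 else 0) + (if q.2 = y then 1 else 0))) :=
        Finset.sum_le_sum fun q _ => Nat.add_le_add (Nat.add_le_add le_rfl (hor _)) (hor _)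
    _ ≤ _ := by
      simp only [Finset.sum_add_distrib]
      have h1 := hfst x
      have h2 := hfst y
      have h3 := hsnd x
      have h4 := hsnd y
      have h5 : ∑ _q ∈ (Finset.univ : Finset V).offDiag, 1 = (N + 1) * N := by
        rw [← Finset.card_eq_sum_ones, Finset.offDiag_card, Finset.card_univ, hV, Nat.mul_succ,
          Nat.add_sub_cancel]
      omega

theorem sum_steinerCost_mergeCost_le {V : Type*} [Fintype V] [DecidableEq V] {N : ℕ}
    (hV : Fintype.card V = N + 1) (T : Finset V) (c : Sym2 V → ℝ) :
    ∑ q ∈ (Finset.univ : Finset V).offDiag.attach,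
      steinerCost (T.image (mergeVertex (Finset.mem_offDiag.1 q.2).2.2))
        (mergeCost q.1.1 q.1.2 c) ≤ ((N + 1) * N + 4 * N : ℕ) * steinerCost T c := by
  obtain ⟨F, hF, hc⟩ := exists_cost_eq_steinerCost T c
  refine (Finset.sum_le_sum fun q _ => steinerCost_mergeCost_le
    (Finset.mem_offDiag.1 q.2).2.2 T c hF).trans ?_
  rw [Finset.sum_attach (Finset.univ : Finset V).offDiag (fun q => ∑ e ∈ F,
    (1 + (if q.1 ∈ e then 1 else 0) + (if q.2 ∈ e then 1 else 0)) * ENNReal.ofReal (c e)),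
    Finset.sum_comm, ← hc, cost, Finset.mul_sum]
  refine Finset.sum_le_sum fun e _ => ?_
  rw [← Finset.sum_mul]
  refine mul_le_mul_left ?_ _
  have h := sum_offDiag_mem_le hV e
  have h2 : ((∑ q ∈ (Finset.univ : Finset V).offDiag,
      (1 + (if q.1 ∈ e then 1 else 0) + (if q.2 ∈ e then 1 else 0)) : ℕ) : ℝ≥0∞) ≤
      (((N + 1) * N + 4 * N : ℕ) : ℝ≥0∞) := by exact_mod_cast h
  refine le_trans (le_of_eq ?_) h2
  push_cast
  rfl

/-- Sum over the (N + 1)N ordered pairs to be identified. An edge is overcharged only if a member of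
the pair is one of its two ends, which adds at most 4N. The M(M - 1) pairs of terminals contribute
1/(M - 1) each, in total M. -/
theorem meanSteinerNum_pred_le_aux {N M : ℕ} (hM : 1 ≤ M) (hMN : M ≤ N + 1) :
    ((N + 1) * N : ℕ) * meanSteinerNum N (min M N) ≤
      ((N + 1) * N + 4 * N : ℕ) * meanSteinerNum (N + 1) M + M := by
  set T := Finset.univ.filter fun i : Fin (N + 1) => (i : ℕ) < M with hT
  have hcard : T.card = M := card_fin_filter_lt hMN
  have hV : Fintype.card (Fin (N + 1)) = N + 1 := Fintype.card_fin _
  have h1 := Finset.sum_le_sum fun q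
      (_ : q ∈ (Finset.univ : Finset (Fin (N + 1))).offDiag.attach) =>
    meanSteinerNum_le_meanSteiner_merge (Finset.mem_offDiag.1 q.2).2.2 hV hcard
  rw [Finset.sum_const, Finset.card_attach, Finset.offDiag_card, Finset.card_univ, hV,
    nsmul_eq_mul, show (N + 1) * (N + 1) - (N + 1) = (N + 1) * N by
      rw [Nat.mul_succ, Nat.add_sub_cancel], Finset.sum_add_distrib] at h1
  refine h1.trans (add_le_add ?_ ?_)
  · have h2 : ∀ q : {q // q ∈ (Finset.univ : Finset (Fin (N + 1))).offDiag},
        meanSteiner (T.image (mergeVertex (Finset.mem_offDiag.1 q.2).2.2)) =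
        ∫⁻ c, steinerCost (T.image (mergeVertex (Finset.mem_offDiag.1 q.2).2.2))
          (mergeCost q.1.1 q.1.2 c) ∂(Measure.pi fun _ : Sym2 (Fin (N + 1)) => expMeasure 1) := by
      intro q
      rw [meanSteiner, ← map_mergeCost (Finset.mem_offDiag.1 q.2).2.2,
        lintegral_map (by fun_prop) (measurable_mergeCost _ _)]
    rw [Finset.sum_congr rfl fun q _ => h2 q, ← lintegral_finsetSum _ (fun q _ => by
      exact (measurable_steinerCost _).comp (measurable_mergeCost _ _))]
    refine (lintegral_mono fun c => sum_steinerCost_mergeCost_le hV T c).trans ?_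
    rw [lintegral_const_mul _ (by fun_prop)]
    rfl
  · rw [Finset.sum_attach (Finset.univ : Finset (Fin (N + 1))).offDiag (fun q =>
      if q.1 ∈ T ∧ q.2 ∈ T then ENNReal.ofReal (1 / ((M : ℝ) - 1)) else 0), Finset.sum_ite,
      Finset.sum_const_zero, add_zero, Finset.sum_const, nsmul_eq_mul]
    have h3 : (Finset.univ : Finset (Fin (N + 1))).offDiag.filter (fun q => q.1 ∈ T ∧ q.2 ∈ T) =
        T.offDiag := by
      ext q
      simp only [Finset.mem_filter, Finset.mem_offDiag, Finset.mem_univ, true_and]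
      tauto
    rw [h3, Finset.offDiag_card, hcard, ← ENNReal.ofReal_natCast, ← ENNReal.ofReal_natCast M,
      ← ENNReal.ofReal_mul (Nat.cast_nonneg _)]
    refine ENNReal.ofReal_le_ofReal ?_
    rw [Nat.cast_sub (Nat.le_mul_of_pos_left _ hM), Nat.cast_mul]
    have hM1 : (1 : ℝ) ≤ M := by exact_mod_cast hM
    rcases eq_or_lt_of_le hM1 with h | h
    · rw [← h]; norm_num
    · have : (M : ℝ) - 1 ≠ 0 := by linarith
      refine le_of_eq ?_
      field_simp

/-- After division by (N + 1)N, the mean cost being at most 4, the error is (16N + N + 1)/((N + 1)N)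
≤ 17/N. -/
theorem meanSteinerNum_pred_le {N M : ℕ} (hN : 1 ≤ N) (hM : 1 ≤ M) (hMN : M ≤ N + 1) :
    meanSteinerNum N (min M N) ≤ meanSteinerNum (N + 1) M + ENNReal.ofReal (17 / N) := by
  have h := meanSteinerNum_pred_le_aux hM hMN
  have hN0 : (0 : ℝ) < N := by exact_mod_cast hN
  have hne : (((N + 1) * N : ℕ) : ℝ≥0∞) ≠ 0 := by
    exact_mod_cast (by positivity : (N + 1) * N ≠ 0)
  rw [← ENNReal.mul_le_mul_iff_right hne (ENNReal.natCast_ne_top _), mul_add]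
  refine h.trans ?_
  rw [Nat.cast_add, add_mul, add_assoc]
  refine add_le_add le_rfl ?_
  calc (((4 * N : ℕ) : ℝ≥0∞) * meanSteinerNum (N + 1) M + (M : ℝ≥0∞))
      ≤ ((4 * N : ℕ) : ℝ≥0∞) * ENNReal.ofReal 4 + ((N + 1 : ℕ) : ℝ≥0∞) := by
        refine add_le_add (mul_le_mul_right (meanSteinerNum_le_four _ _) _) ?_
        exact_mod_cast hMN
    _ ≤ _ := by
        rw [← ENNReal.ofReal_natCast, ← ENNReal.ofReal_natCast (N + 1),
          ← ENNReal.ofReal_natCast ((N + 1) * N), ← ENNReal.ofReal_mul (by positivity),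
          ← ENNReal.ofReal_mul (by positivity), ← ENNReal.ofReal_add (by positivity)
          (by positivity)]
        refine ENNReal.ofReal_le_ofReal ?_
        push_cast
        have : ((N : ℝ) + 1) * N * (17 / N) = 17 * (N + 1) := by field_simp
        rw [this]
        linarith

theorem meanSteinerNum_sub_le {N M : ℕ} (hM : 1 ≤ M) (hMN : M ≤ N) (a : ℕ) (ha : 2 * a ≤ N)
    (hN : 2 ≤ N) :
    meanSteinerNum (N - a) (min M (N - a)) ≤
      meanSteinerNum N M + ENNReal.ofReal (34 * a / N) := by
  have hN0 : (0 : ℝ) < N := by exact_mod_cast (by omega : 0 < N)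
  induction a with
  | zero => simp [min_eq_left hMN]
  | succ a ih =>
    have h1 := ih (by omega)
    obtain ⟨L, hL⟩ : ∃ L, N - a = L + 1 := ⟨N - a - 1, by omega⟩
    have hL' : N - (a + 1) = L := by omega
    rw [hL] at h1
    have h2 := meanSteinerNum_pred_le (N := L) (M := min M (L + 1)) (by omega) (by omega) (by omega)
    rw [show min (min M (L + 1)) L = min M L by omega] at h2
    rw [hL']
    refine h2.trans ((add_le_add h1 le_rfl).trans ?_)
    rw [add_assoc]
    refine add_le_add le_rfl ?_
    rw [← ENNReal.ofReal_add (by positivity) (by positivity)]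
    refine ENNReal.ofReal_le_ofReal ?_
    have hL0 : (0 : ℝ) < L := by exact_mod_cast (by omega : 0 < L)
    -- At least half of the vertices remain, so each deletion costs at most 34/N.
    have h3 : (N : ℝ) ≤ 2 * L := by exact_mod_cast (by omega : N ≤ 2 * L)
    have h4 : 17 / (L : ℝ) ≤ 34 / N := by rw [div_le_div_iff₀ hL0 hN0]; linarith
    push_cast
    calc _ ≤ 34 * (a : ℝ) / N + 34 / N := by gcongr
      _ = _ := by ring

end MergeBounds


/-! ### Number of edges of a cheap tree -/

section EdgeCount

variable {V : Type*} [Fintype V] [DecidableEq V]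

/-- An exponential sum over the trees rooted at `r`, the parent of `v` being `p v`. -/
noncomputable def treeSum (l : ℝ) (r : V) (c : Sym2 V → ℝ) : ℝ≥0∞ :=
  ∑ S ∈ (Finset.univ.erase r).powerset,
    ∑ p ∈ Fintype.piFinset fun v => if v ∈ S then insert r S else {r},
      if (S.image fun v => s(v, p v)).card = S.card then
        ∏ e ∈ S.image fun v => s(v, p v), ENNReal.ofReal (Real.exp (1 - l * c e)) else 0

@[fun_prop]
theorem measurable_treeSum (l : ℝ) (r : V) : Measurable (treeSum l r) := by
  unfold treeSum
  refine Finset.measurable_fun_sum _ fun S _ => Finset.measurable_fun_sum _ fun p _ => ?_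
  split_ifs
  · fun_prop
  · fun_prop

/-- By x ≤ exp x with x = |S| - l·cost, the number of edges is at most l·cost plus an exponential
that occurs as one term of `treeSum`. The correction thus depends on no particular tree. -/
theorem IsRootedTree.card_le {r : V} {S : Finset V} {p : V → V} {d : V → ℕ}
    (h : IsRootedTree r S p d) {l : ℝ} (hl : 0 ≤ l) (c : Sym2 V → ℝ) :
    (S.card : ℝ≥0∞) ≤ ENNReal.ofReal l * ∑ v ∈ S, ENNReal.ofReal (c s(v, p v)) +
      treeSum l r c := by
  -- Outside `S` the parent map is normalised to `r`, so that it lies in the index set of `treeSum`.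
  set p' : V → V := fun v => if v ∈ S then p v else r with hp'
  have hedge : ∀ v ∈ S, s(v, p' v) = s(v, p v) := fun v hv => by simp [hp', hv]
  have himage : (S.image fun v => s(v, p' v)) = S.image fun v => s(v, p v) :=
    Finset.image_congr hedge
  have hcard : (S.image fun v => s(v, p v)).card = S.card := Finset.card_image_of_injOn h.injOn
  have hterm : ENNReal.ofReal (Real.exp (S.card - l * ∑ v ∈ S, c s(v, p v))) ≤ treeSum l r c := by
    have h1 : ENNReal.ofReal (Real.exp (S.card - l * ∑ v ∈ S, c s(v, p v))) =
        ∏ e ∈ S.image fun v => s(v, p v), ENNReal.ofReal (Real.exp (1 - l * c e)) := by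
      rw [← ENNReal.ofReal_prod_of_nonneg (fun _ _ => (Real.exp_pos _).le), ← Real.exp_sum,
        Finset.sum_image h.injOn, Finset.sum_sub_distrib, ← Finset.mul_sum]
      simp
    have hS : S ∈ (Finset.univ.erase r).powerset := by
      rw [Finset.mem_powerset]
      exact fun v hv => Finset.mem_erase.2 ⟨fun e => h.root_notMem (e ▸ hv), Finset.mem_univ _⟩
    have hp : p' ∈ Fintype.piFinset fun v => if v ∈ S then insert r S else {r} := by
      rw [Fintype.mem_piFinset]
      intro v
      by_cases hv : v ∈ S
      · simpa [hp', hv] using h.parent_mem v hv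
      · simp [hp', hv]
    rw [h1, treeSum]
    refine le_trans ?_ (Finset.single_le_sum (f := fun S =>
      ∑ p ∈ Fintype.piFinset fun v => if v ∈ S then insert r S else {r},
      if (S.image fun v => s(v, p v)).card = S.card then
        ∏ e ∈ S.image fun v => s(v, p v), ENNReal.ofReal (Real.exp (1 - l * c e)) else 0)
      (fun _ _ => zero_le) hS)
    refine le_trans ?_ (Finset.single_le_sum (f := fun p =>
      if (S.image fun v => s(v, p v)).card = S.card then
        ∏ e ∈ S.image fun v => s(v, p v), ENNReal.ofReal (Real.exp (1 - l * c e)) else 0)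
      (fun _ _ => zero_le) hp)
    rw [himage, if_pos hcard]
  have hsum : ENNReal.ofReal (l * ∑ v ∈ S, c s(v, p v)) ≤
      ENNReal.ofReal l * ∑ v ∈ S, ENNReal.ofReal (c s(v, p v)) := by
    rw [ENNReal.ofReal_mul hl]
    exact mul_le_mul_right (Finset.le_sum_of_subadditive ENNReal.ofReal ENNReal.ofReal_zero.le
      (fun _ _ => ENNReal.ofReal_add_le) _ _) _
  calc (S.card : ℝ≥0∞) = ENNReal.ofReal (l * ∑ v ∈ S, c s(v, p v) +
        (S.card - l * ∑ v ∈ S, c s(v, p v))) := by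
        rw [add_sub_cancel, ENNReal.ofReal_natCast]
    _ ≤ _ := ENNReal.ofReal_add_le
    _ ≤ _ := by
      refine add_le_add hsum (le_trans (ENNReal.ofReal_le_ofReal ?_) hterm)
      linarith [Real.add_one_le_exp (S.card - l * ∑ v ∈ S, c s(v, p v))]

/-- Distinct edges are independent and each factor has mean e/(1 + l). A vertex set of size L
carries at most (L + 1)^L parent maps. -/
theorem lintegral_treeSum_le_sum {l : ℝ} (hl : 0 ≤ l) (r : V) :
    ∫⁻ c, treeSum l r c ∂(Measure.pi fun _ : Sym2 V => expMeasure 1) ≤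
      ∑ S ∈ (Finset.univ.erase r).powerset,
        ENNReal.ofReal (((S.card + 1 : ℕ) * (Real.exp 1 / (1 + l))) ^ S.card) := by
  have hX : iIndepFun (fun (e : Sym2 V) (c : Sym2 V → ℝ) =>
      ENNReal.ofReal (Real.exp (1 - l * c e))) (Measure.pi fun _ : Sym2 V => expMeasure 1) :=
    iIndepFun_pi (X := fun _ x => ENNReal.ofReal (Real.exp (1 - l * x)))
      (fun _ => by fun_prop)
  have hmean : ∀ e : Sym2 V, ∫⁻ c, ENNReal.ofReal (Real.exp (1 - l * c e))
      ∂(Measure.pi fun _ : Sym2 V => expMeasure 1) = ENNReal.ofReal (Real.exp 1 / (1 + l)) := by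
    intro e
    have h1 := (measurePreserving_eval (fun _ : Sym2 V => expMeasure 1) e).lintegral_comp
      (f := fun x => ENNReal.ofReal (Real.exp (1 - l * x))) (by fun_prop)
    refine h1.trans ?_
    have h2 : ∀ x : ℝ, ENNReal.ofReal (Real.exp (1 - l * x)) =
        ENNReal.ofReal (Real.exp 1) * ENNReal.ofReal (Real.exp (-(l * x))) := fun x => by
      rw [← ENNReal.ofReal_mul (Real.exp_pos _).le, ← Real.exp_add]
      rfl
    simp_rw [h2]
    rw [lintegral_const_mul _ (by fun_prop), lintegral_exp_neg_mul_expMeasure one_pos hl,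
      ← ENNReal.ofReal_mul (Real.exp_pos _).le, mul_one_div]
  unfold treeSum
  rw [lintegral_finsetSum _ (fun S _ => by
    refine Finset.measurable_fun_sum _ fun p _ => ?_
    split_ifs <;> fun_prop)]
  refine Finset.sum_le_sum fun S _ => ?_
  rw [lintegral_finsetSum _ (fun p _ => by split_ifs <;> fun_prop)]
  have hterm : ∀ p ∈ Fintype.piFinset (fun v => if v ∈ S then insert r S else {r}),
      ∫⁻ c, (if (S.image fun v => s(v, p v)).card = S.card then
        ∏ e ∈ S.image fun v => s(v, p v), ENNReal.ofReal (Real.exp (1 - l * c e)) else 0)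
        ∂(Measure.pi fun _ : Sym2 V => expMeasure 1) ≤
      ENNReal.ofReal ((Real.exp 1 / (1 + l)) ^ S.card) := by
    intro p _
    split_ifs with h
    · rw [lintegral_prod_eq_prod_lintegral_of_indepFun _ _ hX (fun e => by fun_prop),
        Finset.prod_congr rfl (fun e _ => hmean e), Finset.prod_const, h,
        ENNReal.ofReal_pow (by positivity)]
    · simp
  refine (Finset.sum_le_card_nsmul _ _ _ hterm).trans ?_
  have hcard : (Fintype.piFinset (fun v => if v ∈ S then insert r S else {r})).card ≤
      (S.card + 1) ^ S.card := by
    rw [Fintype.card_piFinset]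
    simp only [apply_ite Finset.card, Finset.card_singleton, Finset.prod_ite_mem,
      Finset.univ_inter, Finset.prod_const]
    exact Nat.pow_le_pow_left (Finset.card_insert_le _ _) _
  rw [nsmul_eq_mul, mul_pow, ENNReal.ofReal_mul (by positivity)]
  refine mul_le_mul_left ?_ _
  rw [← Nat.cast_pow, ENNReal.ofReal_natCast]
  exact_mod_cast hcard

/-- The choice l = 2e²N beats the entropy N^L/L! · (L + 1)^L ≤ e·(eN)^L and leaves a geometric
series. -/
theorem choose_mul_pow_le {N L : ℕ} (hN : 1 ≤ N) :
    (N.choose L : ℝ) * ((L + 1 : ℕ) * (Real.exp 1 / (1 + 2 * Real.exp 2 * N))) ^ L ≤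
      Real.exp 1 * (1 / 2) ^ L := by
  have hN0 : (0 : ℝ) < N := by exact_mod_cast hN
  have h1 : (N.choose L : ℝ) ≤ (N : ℝ) ^ L / L.factorial := Nat.choose_le_pow_div L N
  have h2 := Real.pow_div_factorial_le_exp (x := ((L + 1 : ℕ) : ℝ)) (by positivity) L
  have h3 : Real.exp 1 / (1 + 2 * Real.exp 2 * N) ≤ Real.exp 1 / (2 * Real.exp 2 * N) := by
    gcongr
    linarith
  have h4 : Real.exp ((L + 1 : ℕ) : ℝ) = Real.exp 1 * Real.exp 1 ^ L := by
    rw [← Real.exp_nat_mul, ← Real.exp_add]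
    push_cast
    ring_nf
  have h5 : Real.exp 2 = Real.exp 1 * Real.exp 1 := by rw [← Real.exp_add]; norm_num
  calc _ ≤ (N : ℝ) ^ L / L.factorial *
        ((L + 1 : ℕ) * (Real.exp 1 / (2 * Real.exp 2 * N))) ^ L := by gcongr
    _ = (((L + 1 : ℕ) : ℝ) ^ L / L.factorial) * (N * (Real.exp 1 / (2 * Real.exp 2 * N))) ^ L := by
      rw [mul_pow, mul_pow]; ring
    _ ≤ Real.exp ((L + 1 : ℕ) : ℝ) * (N * (Real.exp 1 / (2 * Real.exp 2 * N))) ^ L := by gcongr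
    _ = Real.exp 1 * (Real.exp 1 * (N * (Real.exp 1 / (2 * Real.exp 2 * N)))) ^ L := by
      rw [h4, mul_assoc, ← mul_pow]
    _ = Real.exp 1 * (1 / 2) ^ L := by
      rw [h5]
      have := (Real.exp_pos 1).ne'
      congr 2
      field_simp

theorem lintegral_treeSum_le (r : V) :
    ∫⁻ c, treeSum (2 * Real.exp 2 * Fintype.card V) r c
      ∂(Measure.pi fun _ : Sym2 V => expMeasure 1) ≤ ENNReal.ofReal 6 := by
  set N := Fintype.card V with hN
  have hN1 : 1 ≤ N := Fintype.card_pos_iff.2 ⟨r⟩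
  have hE : Real.exp 1 ≤ 3 := by linarith [Real.exp_one_lt_d9]
  refine (lintegral_treeSum_le_sum (by positivity) r).trans ?_
  rw [Finset.sum_powerset_apply_card (fun L =>
    ENNReal.ofReal (((L + 1 : ℕ) * (Real.exp 1 / (1 + 2 * Real.exp 2 * N))) ^ L)),
    Finset.card_erase_of_mem (Finset.mem_univ _), Finset.card_univ, ← hN]
  calc _ ≤ ∑ L ∈ Finset.range (N - 1 + 1), ENNReal.ofReal (3 * (1 / 2) ^ L) := by
        refine Finset.sum_le_sum fun L _ => ?_
        rw [nsmul_eq_mul, ← ENNReal.ofReal_natCast, ← ENNReal.ofReal_mul (by positivity)]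
        refine ENNReal.ofReal_le_ofReal ?_
        have h1 : ((N - 1).choose L : ℝ) ≤ (N.choose L : ℝ) := by
          exact_mod_cast Nat.choose_le_choose L (Nat.sub_le N 1)
        calc _ ≤ (N.choose L : ℝ) *
              ((L + 1 : ℕ) * (Real.exp 1 / (1 + 2 * Real.exp 2 * N))) ^ L := by gcongr
          _ ≤ Real.exp 1 * (1 / 2) ^ L := choose_mul_pow_le hN1
          _ ≤ _ := by gcongr
    _ = ENNReal.ofReal (∑ L ∈ Finset.range (N - 1 + 1), 3 * (1 / 2 : ℝ) ^ L) := by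
        rw [ENNReal.ofReal_sum_of_nonneg fun L _ => by positivity]
    _ ≤ _ := by
        refine ENNReal.ofReal_le_ofReal ?_
        rw [← Finset.mul_sum]
        have := sum_geometric_two_le (N - 1 + 1)
        linarith

end EdgeCount


/-! ### Mean cost of growing levels and of the final cut -/

section MeanLabel

variable {V : Type*} [Fintype V] [DecidableEq V]

/-- The expectation of `labelCost` for independent mean one exponential costs. -/
noncomputable def meanLabel (k : ℕ) (L : V → ℕ∞) (T : Finset V) : ℝ≥0∞ :=
  ∫⁻ c, labelCost k L T c ∂(Measure.pi fun _ : Sym2 V => expMeasure 1)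

theorem lintegral_ofReal_eval {ι : Type*} [Fintype ι] {s : ℝ} (hs : 0 < s) (i : ι) :
    ∫⁻ y, ENNReal.ofReal (y i) ∂(Measure.pi fun _ : ι => expMeasure s) =
      ENNReal.ofReal (1 / s) := by
  have := isProbabilityMeasure_expMeasure hs
  rw [← lintegral_ofReal_expMeasure hs]
  exact (measurePreserving_eval (fun _ : ι => expMeasure s) i).lintegral_comp
    (f := fun x => ENNReal.ofReal x) (by fun_prop)

theorem lintegral_ofReal_inf' {ι : Type*} [Fintype ι] {s : ℝ} (hs : 0 < s) {g : Finset ι}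
    (hg : g.Nonempty) :
    ∫⁻ y, ENNReal.ofReal (g.inf' hg y) ∂(Measure.pi fun _ : ι => expMeasure s) =
      ENNReal.ofReal (1 / (g.card * s)) := by
  have h := map_inf'_pi_expMeasure (fun _ : ι => s) (fun _ => hs) (fun _ : Unit => g)
    (fun _ => hg) (fun _ _ h => absurd rfl h)
  simp only [Finset.sum_const, nsmul_eq_mul] at h
  have hg0 : (0 : ℝ) < g.card := by exact_mod_cast hg.card_pos
  rw [← lintegral_ofReal_eval (ι := Unit) (by positivity) (), ← h,
    lintegral_map (by fun_prop) (by fun_prop)]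

/-- The `t` cheapest of at least `t * β` elements. -/
theorem lintegral_iInf_powersetCard_le {ι : Type*} [Fintype ι] [DecidableEq ι] {s : ℝ}
    (hs : 0 < s) {B : Finset ι} {t β : ℕ} (hβ : 1 ≤ β) (hB : t * β ≤ B.card) :
    ∫⁻ y, ⨅ A ∈ B.powersetCard t, ∑ x ∈ A, ENNReal.ofReal (y x)
        ∂(Measure.pi fun _ : ι => expMeasure s) ≤ ENNReal.ofReal (t / (β * s)) := by
  -- Split t·β elements into t blocks of size β and take the cheapest of each: a block minimum has
  -- mean 1/(βs).
  obtain ⟨B', hB'B, hB'⟩ := Finset.exists_subset_card_eq hB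
  have e : Fin t × Fin β ≃ {x // x ∈ B'} := Fintype.equivOfCardEq (by simp [hB'])
  have : Nonempty (Fin β) := ⟨⟨0, hβ⟩⟩
  let f : Fin t × Fin β → ι := fun q => e q
  have hf : Function.Injective f := Subtype.val_injective.comp e.injective
  let g : Fin t → Finset ι := fun l => Finset.univ.image fun q => f (l, q)
  have hg : ∀ l, (g l).Nonempty := fun l => Finset.univ_nonempty.image _
  have hgc : ∀ l, (g l).card = β := fun l => by
    rw [Finset.card_image_of_injective _ (fun a b h => by simpa using hf h), Finset.card_univ,
      Fintype.card_fin]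
  have hpt : ∀ y : ι → ℝ, ⨅ A ∈ B.powersetCard t, ∑ x ∈ A, ENNReal.ofReal (y x) ≤
      ∑ l, ENNReal.ofReal ((g l).inf' (hg l) y) := by
    intro y
    choose x hx hmin using fun l => Finset.exists_mem_eq_inf' (hg l) y
    have hxl : ∀ l, ∃ q, f (l, q) = x l := fun l => by
      obtain ⟨q, -, hq⟩ := Finset.mem_image.1 (hx l)
      exact ⟨q, hq⟩
    have hinj : Function.Injective x := by
      intro l l' h
      obtain ⟨q, hq⟩ := hxl l
      obtain ⟨q', hq'⟩ := hxl l'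
      rw [← hq, ← hq'] at h
      exact (Prod.mk.inj (hf h)).1
    have hmem : Finset.univ.image x ∈ B.powersetCard t := by
      rw [Finset.mem_powersetCard, Finset.card_image_of_injective _ hinj, Finset.card_univ,
        Fintype.card_fin]
      refine ⟨Finset.image_subset_iff.2 fun l _ => ?_, rfl⟩
      obtain ⟨q, hq⟩ := hxl l
      rw [← hq]
      exact hB'B (e (l, q)).2
    refine (iInf₂_le _ hmem).trans (le_of_eq ?_)
    rw [Finset.sum_image fun a _ b _ h => hinj h]
    exact Finset.sum_congr rfl fun l _ => by rw [hmin l]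
  refine (lintegral_mono hpt).trans ?_
  rw [lintegral_finsetSum _ fun l _ => by fun_prop]
  simp_rw [lintegral_ofReal_inf' hs, hgc]
  rw [Finset.sum_const, Finset.card_univ, Fintype.card_fin, nsmul_eq_mul,
    ← ENNReal.ofReal_natCast, ← ENNReal.ofReal_mul (by positivity), mul_one_div]

theorem lintegral_comp_cross {A : Finset V} (hA : A.Nonempty)
    {B : ({x // x ∉ A} → ℝ) → (Sym2 {x // x ∉ A} → ℝ) → ℝ≥0∞}
    (hB : Measurable (Function.uncurry B)) :
    ∫⁻ c, B (fun x => A.inf' hA fun a => c s(a, (x : V))) (fun e => c (e.map Subtype.val))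
        ∂(Measure.pi fun _ : Sym2 V => expMeasure 1) =
      ∫⁻ q, Function.uncurry B q ∂((Measure.pi fun _ : {x // x ∉ A} => expMeasure A.card).prod
        (Measure.pi fun _ : Sym2 {x // x ∉ A} => expMeasure 1)) := by
  rw [← map_inf'_cross_pi_expMeasure hA, lintegral_map hB (by fun_prop)]
  rfl

/-- The new level is chosen by looking only at the costs leaving `A`. The remaining edges are
independent of the choice, so a bound `W` valid for every choice may be added. -/
theorem meanLabel_le_step {k j : ℕ} (hjk : j ≤ k) {L : V → ℕ∞} (T : Finset V) {A : Finset V}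
    (hA : A.Nonempty) (hL : ∀ a ∈ A, L a ≤ j) {ι : Type*} (I : Finset ι)
    (A' : ι → Finset {x // x ∉ A}) (L' : ι → {x // x ∉ A} → ℕ∞)
    (hL' : ∀ i ∈ I, ∀ x ∈ A' i, (j + 1 : ℕ∞) ≤ L' i x) (hLL' : ∀ i ∈ I, ∀ x ∉ A' i, L x ≤ L' i x)
    {W : ℝ≥0∞} (hW : ∀ i ∈ I, meanLabel k (L' i) (T.subtype (· ∉ A)) ≤ W) :
    meanLabel k L T ≤ ∫⁻ y, ⨅ i ∈ I, ∑ x ∈ A' i, ENNReal.ofReal (y x)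
      ∂(Measure.pi fun _ : {x // x ∉ A} => expMeasure A.card) + W := by
  have hA0 : (0 : ℝ) < A.card := by exact_mod_cast hA.card_pos
  have := isProbabilityMeasure_expMeasure hA0
  set B : ({x // x ∉ A} → ℝ) → (Sym2 {x // x ∉ A} → ℝ) → ℝ≥0∞ := fun y c' =>
    ⨅ i ∈ I, (∑ x ∈ A' i, ENNReal.ofReal (y x) + labelCost k (L' i) (T.subtype (· ∉ A)) c')
    with hBdef
  have hB : Measurable (Function.uncurry B) := by
    refine Measurable.biInf _ I.countable_toSet fun i _ => ?_
    fun_prop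
  have h1 : meanLabel k L T ≤ ∫⁻ c, B (fun x => A.inf' hA fun a => c s(a, (x : V)))
      (fun e => c (e.map Subtype.val)) ∂(Measure.pi fun _ : Sym2 V => expMeasure 1) :=
    lintegral_mono fun c => le_iInf₂ fun i hi =>
      labelCost_le_sum_add hjk T hA hL (A' i) (hL' i hi) (hLL' i hi) c
  refine h1.trans ?_
  rw [lintegral_comp_cross hA hB, lintegral_prod _ hB.aemeasurable]
  have h2 : ∀ y, ∫⁻ c', Function.uncurry B (y, c')
      ∂(Measure.pi fun _ : Sym2 {x // x ∉ A} => expMeasure 1) ≤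
      (⨅ i ∈ I, ∑ x ∈ A' i, ENNReal.ofReal (y x)) + W := by
    intro y
    simp_rw [ENNReal.iInf_add]
    refine le_iInf₂ fun i hi => ?_
    calc _ ≤ ∫⁻ c', (∑ x ∈ A' i, ENNReal.ofReal (y x) +
          labelCost k (L' i) (T.subtype (· ∉ A)) c')
          ∂(Measure.pi fun _ : Sym2 {x // x ∉ A} => expMeasure 1) :=
          lintegral_mono fun c' => iInf₂_le i hi
      _ ≤ _ := by
        rw [lintegral_add_left measurable_const, lintegral_const, measure_univ, mul_one]
        exact add_le_add le_rfl (hW i hi)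
  refine (lintegral_mono h2).trans (le_of_eq ?_)
  rw [lintegral_add_right _ measurable_const, lintegral_const, measure_univ, mul_one]

/-- The bound for the cost of a Steiner tree with `M` terminals among `N` vertices that is cut into
pieces of depth `D`, each piece being joined to a set of `s` further vertices. -/
noncomputable def cutCost (N M s D : ℕ) : ℝ≥0∞ :=
  meanSteinerNum N M + (ENNReal.ofReal (2 * Real.exp 2 * N) * meanSteinerNum N M +
    ENNReal.ofReal 6) * ENNReal.ofReal (1 / s) / (D + 1 : ℕ)

theorem cutCost_mono {N M M' s D : ℕ} (h : M ≤ M') : cutCost N M s D ≤ cutCost N M' s D := by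
  unfold cutCost
  have := meanSteinerNum_mono (N := N) h
  gcongr

/-- The tree is optimal for the edges outside `A` and therefore independent of the shortcut costs,
so each of its |S| potential shortcuts has mean 1/|A|. In the terminal count `b` adds one, hence the
hypothesis `hM`. -/
theorem meanLabel_le_cutCost {k K D : ℕ} (hk : K + 1 + D ≤ k) {L : V → ℕ∞} {T A : Finset V}
    (hA : A.Nonempty) (hL : ∀ a ∈ A, L a ≤ K) {b : V} (hbA : b ∉ A) (hb : L b ≤ 1) {N M : ℕ}
    (hN : Fintype.card V = N + A.card) (hM : T.card + 1 ≤ M) :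
    meanLabel k L T ≤ cutCost N (min M N) A.card D := by
  have hA0 : (0 : ℝ) < A.card := by exact_mod_cast hA.card_pos
  have := isProbabilityMeasure_expMeasure hA0
  set b' : {x // x ∉ A} := ⟨b, hbA⟩ with hb'
  have hN' : Fintype.card {x // x ∉ A} = N := by
    rw [Fintype.card_subtype_compl, hN]; simp
  set T' := insert b' (T.subtype (· ∉ A)) with hT'
  have hT'c : T'.card ≤ min M N := by
    refine le_min ?_ (hN' ▸ Finset.card_le_univ _)
    refine (Finset.card_insert_le _ _).trans (le_trans (Nat.add_le_add_right ?_ 1) hM)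
    rw [Finset.card_subtype]
    exact Finset.card_filter_le _ _
  refine le_trans ?_ (cutCost_mono hT'c)
  set P : Finset {x // x ∉ A} × ({x // x ∉ A} → {x // x ∉ A}) → Prop := fun q =>
    ∃ d, IsRootedTree b' q.1 q.2 d ∧ T' ⊆ insert b' q.1 with hP
  -- Taking the infimum over all trees, and bounding it by the optimal tree only after fixing `c'`,
  -- avoids a measurable choice of that tree.
  set B : ({x // x ∉ A} → ℝ) → (Sym2 {x // x ∉ A} → ℝ) → ℝ≥0∞ := fun y c' =>
    ⨅ q ∈ {q | P q}, (∑ v ∈ q.1, ENNReal.ofReal (c' s(v, q.2 v)) +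
      (∑ v ∈ q.1, ENNReal.ofReal (y v)) / (D + 1 : ℕ)) with hBdef
  have hB : Measurable (Function.uncurry B) := by
    refine Measurable.biInf _ (Set.to_countable _) fun i _ => ?_
    fun_prop
  have h1 : meanLabel k L T ≤ ∫⁻ c, B (fun x => A.inf' hA fun a => c s(a, (x : V)))
      (fun e => c (e.map Subtype.val)) ∂(Measure.pi fun _ : Sym2 V => expMeasure 1) := by
    refine lintegral_mono fun c => le_iInf₂ fun q hq => ?_
    obtain ⟨d, hd, hT⟩ := hq
    exact labelCost_le_tree_add_div hk hA hL (b := b') hb hd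
      ((Finset.subset_insert _ _).trans hT) c
  refine h1.trans ?_
  rw [lintegral_comp_cross hA hB, lintegral_prod_symm' _ hB]
  set l : ℝ := 2 * Real.exp 2 * N with hl
  have h2 : ∀ c', ∫⁻ y, Function.uncurry B (y, c')
      ∂(Measure.pi fun _ : {x // x ∉ A} => expMeasure A.card) ≤
      steinerCost T' c' + (ENNReal.ofReal l * steinerCost T' c' + treeSum l b' c') *
        ENNReal.ofReal (1 / A.card) / (D + 1 : ℕ) := by
    intro c'
    obtain ⟨S, p, d, hd, hT, hcost⟩ :=
      exists_isRootedTree_sum_le_steinerCost (Finset.mem_insert_self b' _ : b' ∈ T') c'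
    calc _ ≤ ∫⁻ y, (∑ v ∈ S, ENNReal.ofReal (c' s(v, p v)) +
          (∑ v ∈ S, ENNReal.ofReal (y v)) / (D + 1 : ℕ))
          ∂(Measure.pi fun _ : {x // x ∉ A} => expMeasure A.card) :=
          lintegral_mono fun y => iInf₂_le (S, p) (show P (S, p) from ⟨d, hd, hT⟩)
      _ = ∑ v ∈ S, ENNReal.ofReal (c' s(v, p v)) +
          S.card * ENNReal.ofReal (1 / A.card) / (D + 1 : ℕ) := by
        rw [lintegral_add_left measurable_const, lintegral_const, measure_univ, mul_one]
        simp_rw [div_eq_mul_inv]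
        rw [lintegral_mul_const _ (by fun_prop), lintegral_finsetSum _ fun v _ => by fun_prop,
          Finset.sum_congr rfl (fun v _ => lintegral_ofReal_eval hA0 v), Finset.sum_const,
          nsmul_eq_mul, one_div, one_mul]
      _ ≤ _ := by
        refine add_le_add hcost (ENNReal.div_le_div_right (mul_le_mul_left ?_ _) _)
        refine (hd.card_le (l := l) (by positivity) c').trans ?_
        exact add_le_add (mul_le_mul_right hcost _) le_rfl
  refine (lintegral_mono h2).trans ?_
  simp_rw [div_eq_mul_inv]
  rw [lintegral_add_left (by fun_prop), lintegral_mul_const _ (by fun_prop),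
    lintegral_mul_const _ (by fun_prop), lintegral_add_left (by fun_prop),
    lintegral_const_mul _ (by fun_prop)]
  have h3 : ∫⁻ c', steinerCost T' c' ∂(Measure.pi fun _ : Sym2 {x // x ∉ A} => expMeasure 1) =
      meanSteinerNum N T'.card := meanSteiner_eq hN' rfl
  have h4 := lintegral_treeSum_le b'
  rw [hN'] at h4
  rw [h3, cutCost, div_eq_mul_inv, div_eq_mul_inv]
  gcongr

/-- The bound for the cost of successive levels of the given sizes, the first of which is joined to
`s` vertices, when at least `Q` candidates are available at each level. -/
noncomputable def levelCost (Q : ℕ) : ℕ → List ℕ → ℝ≥0∞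
  | _, [] => 0
  | s, t :: l => ENNReal.ofReal (t / ((Q / t : ℕ) * s)) + levelCost Q t l

end MeanLabel

/-- Each level is deleted after use, so the number `N` of final vertices does not depend on the
choices. The reserve `B` keeps `Q` candidates available at each level and never contains `b`. With
no level left, the default of `getLastD` is the current set `A`. -/
theorem meanLabel_le_levelCost.{u} {Q N M D k : ℕ} (l : List ℕ) :
    ∀ (V : Type u) [Fintype V] [DecidableEq V] {j : ℕ} {L : V → ℕ∞} {T A B : Finset V} {b : V},
      j + l.length + 1 + D ≤ k → (∀ t ∈ l, 1 ≤ t ∧ t ≤ Q) → A.Nonempty → (∀ a ∈ A, L a ≤ j) →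
      b ∉ A → b ∉ B → L b ≤ 1 → Fintype.card V = N + l.sum + A.card → T.card + 1 ≤ M →
      Disjoint A B → Q + l.sum ≤ B.card →
      meanLabel k L T ≤ levelCost Q A.card l + cutCost N (min M N) (l.getLastD A.card) D := by
  induction l with
  | nil =>
    intro V _ _ j L T A B b hk _ hA hL hbA _ hb hN hM _ _
    simp only [levelCost, zero_add, List.getLastD_nil]
    exact meanLabel_le_cutCost (by simpa using hk) hA hL hbA hb (by simpa using hN) hM
  | cons t l ih =>
    intro V _ _ j L T A B b hk hl hA hL hbA hbB hb hN hM hAB hQ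
    have ht := hl t List.mem_cons_self
    have hA0 : (0 : ℝ) < A.card := by exact_mod_cast hA.card_pos
    simp only [List.length_cons, List.sum_cons] at hk hN hQ
    set B' : Finset {x // x ∉ A} := B.subtype (· ∉ A) with hB'
    have hB'c : B'.card = B.card := by
      rw [hB', Finset.card_subtype, Finset.filter_true_of_mem]
      exact fun x hx hxA => Finset.disjoint_left.1 hAB hxA hx
    have hcardV : Fintype.card {x // x ∉ A} = N + l.sum + t := by
      rw [Fintype.card_subtype_compl]
      simp only [Fintype.card_coe]
      omega
    have hstep := meanLabel_le_step (k := k) (j := j) (by omega) T hA hL (B'.powersetCard t) id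
      (fun A' x => if x ∈ A' then (j + 1 : ℕ) else L x)
      (fun A' _ x hx => by
        have : x ∈ A' := hx
        simp [this])
      (fun A' _ x hx => by
        have : x ∉ A' := hx
        simp [this])
      (W := levelCost Q t l + cutCost N (min M N) (l.getLastD t) D)
      (fun A' hA' => by
        rw [Finset.mem_powersetCard] at hA'
        have hbA' : (⟨b, hbA⟩ : {x // x ∉ A}) ∉ A' := fun h => hbB (by
          simpa [hB'] using hA'.1 h)
        have h := ih {x // x ∉ A} (j := j + 1)
          (L := fun x => if x ∈ A' then (j + 1 : ℕ) else L x) (T := T.subtype (· ∉ A)) (A := A')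
          (B := B' \ A') (b := ⟨b, hbA⟩) (by omega)
          (fun t' ht' => hl t' (List.mem_cons_of_mem _ ht'))
          (Finset.card_pos.1 (by omega)) (fun a ha => by simp [ha]) hbA'
          (fun h => hbB (by simpa [hB'] using (Finset.mem_sdiff.1 h).1)) (by simpa [hbA'] using hb)
          (by rw [hcardV, hA'.2])
          (le_trans (Nat.add_le_add_right (by
            rw [Finset.card_subtype]; exact Finset.card_filter_le _ _) 1) hM)
          Finset.disjoint_sdiff
          (by rw [Finset.card_sdiff_of_subset hA'.1, hB'c, hA'.2]; omega)
        rwa [hA'.2] at h)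
    refine hstep.trans ?_
    rw [levelCost, add_assoc, List.getLastD_cons]
    refine add_le_add ?_ le_rfl
    refine lintegral_iInf_powersetCard_le hA0 (Nat.div_pos ht.2 ht.1) ?_
    rw [hB'c]
    have := Nat.mul_div_le Q t
    omega

/-- The first step also attaches the root `b` of the later tree, as the cheapest neighbour of `r` in
the separate reserve `B₀`. Since `b` takes the place of `r`, at most `M` terminals remain. -/
theorem meanLabel_root_le {V : Type*} [Fintype V] [DecidableEq V] {k Q N M D t : ℕ} {l : List ℕ}
    {L : V → ℕ∞} {T B₀ B : Finset V} {r : V} (hk : l.length + 2 + D ≤ k) (ht : 1 ≤ t ∧ t ≤ Q)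
    (hl : ∀ t ∈ l, 1 ≤ t ∧ t ≤ Q) (hL : L r = 0) (hr : r ∈ T)
    (hM : T.card ≤ M) (hN : Fintype.card V = N + l.sum + t + 1) (hB₀ : B₀.Nonempty)
    (hrB₀ : r ∉ B₀) (hrB : r ∉ B) (hBB : Disjoint B₀ B) (hQ : Q + l.sum + t ≤ B.card) :
    meanLabel k L T ≤ ENNReal.ofReal (1 / B₀.card) + levelCost Q 1 (t :: l) +
      cutCost N (min M N) (l.getLastD t) D := by
  have hcardV : Fintype.card {x // x ∉ ({r} : Finset V)} = N + l.sum + t := by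
    rw [Fintype.card_subtype_compl, hN]; simp
  have hsub : ∀ s : Finset V, r ∉ s → (s.subtype (· ∉ ({r} : Finset V))).card = s.card := by
    intro s hs
    rw [Finset.card_subtype, Finset.filter_true_of_mem]
    rintro x hx hxr
    exact hs (Finset.mem_singleton.1 hxr ▸ hx)
  have hTc : (T.subtype (· ∉ ({r} : Finset V))).card + 1 ≤ M := by
    rw [Finset.card_subtype]
    refine le_trans (Finset.card_lt_card ?_) hM
    exact Finset.filter_ssubset.2 ⟨r, hr, by simp⟩
  set B₀' := B₀.subtype (· ∉ ({r} : Finset V)) with hB₀'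
  set B' := B.subtype (· ∉ ({r} : Finset V)) with hB'
  have hB₀ne : B₀'.Nonempty := Finset.card_pos.1 (by rw [hsub _ hrB₀]; exact hB₀.card_pos)
  have hdisj : ∀ x ∈ B₀', x ∉ B' := fun x hx hx' =>
    Finset.disjoint_left.1 hBB (Finset.mem_subtype.1 hx) (Finset.mem_subtype.1 hx')
  have hstep := meanLabel_le_step (k := k) (j := 0) (by omega) T (Finset.singleton_nonempty r)
    (L := L) (by simp [hL]) (B₀' ×ˢ B'.powersetCard t) (fun q => insert q.1 q.2)
    (fun q x => if x ∈ insert q.1 q.2 then 1 else L x)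
    (fun q _ x hx => by simp only [if_pos hx]; simp)
    (fun q _ x hx => by simp only [if_neg hx]; exact le_rfl)
    (W := levelCost Q t l + cutCost N (min M N) (l.getLastD t) D)
    (fun q hq => by
      obtain ⟨hq1, hq2⟩ := Finset.mem_product.1 hq
      rw [Finset.mem_powersetCard] at hq2
      have h := meanLabel_le_levelCost (Q := Q) (N := N) (M := M) (D := D) (k := k) l
        {x // x ∉ ({r} : Finset V)} (j := 1)
        (L := fun x => if x ∈ insert q.1 q.2 then 1 else L x)
        (T := T.subtype (· ∉ ({r} : Finset V))) (A := q.2) (B := B' \ q.2) (b := q.1) (by omega) hl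
        (Finset.card_pos.1 (by omega)) (fun a ha => by simp [ha]) (fun h => hdisj _ hq1 (hq2.1 h))
        (fun h => hdisj _ hq1 (Finset.mem_sdiff.1 h).1) (by simp) (by rw [hcardV, hq2.2]) hTc
        Finset.disjoint_sdiff
        (by rw [Finset.card_sdiff_of_subset hq2.1, hsub _ hrB, hq2.2]; omega)
      rwa [hq2.2] at h)
  refine hstep.trans ?_
  have hpt : ∀ y : {x // x ∉ ({r} : Finset V)} → ℝ,
      ⨅ i ∈ B₀' ×ˢ B'.powersetCard t, ∑ x ∈ insert i.1 i.2, ENNReal.ofReal (y x) ≤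
      ENNReal.ofReal (B₀'.inf' hB₀ne y) +
        ⨅ A ∈ B'.powersetCard t, ∑ x ∈ A, ENNReal.ofReal (y x) := by
    intro y
    obtain ⟨b, hb, hby⟩ := Finset.exists_mem_eq_inf' hB₀ne y
    rw [hby]
    simp_rw [ENNReal.add_iInf]
    refine le_iInf₂ fun A hA => (iInf₂_le (b, A) (Finset.mk_mem_product hb hA)).trans ?_
    rw [Finset.sum_insert fun h => hdisj _ hb ((Finset.mem_powersetCard.1 hA).1 h)]
  rw [levelCost, ← add_assoc, ← add_assoc]
  refine add_le_add (add_le_add ((lintegral_mono hpt).trans ?_) le_rfl) le_rfl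
  rw [lintegral_add_left (by fun_prop)]
  have h1 : (0 : ℝ) < (({r} : Finset V).card : ℝ) := by simp
  refine add_le_add ?_ ?_
  · rw [lintegral_ofReal_inf' h1, hsub _ hrB₀]
    simp
  · have := lintegral_iInf_powersetCard_le h1 (B := B') (t := t) (β := Q / t)
      (Nat.div_pos ht.2 ht.1) (by
        rw [hsub _ hrB]
        have := Nat.mul_div_le Q t
        omega)
    simpa using this


/-! ### From edge sets to Steiner trees as subgraphs -/

section Subgraph

variable {V : Type*} [DecidableEq V]

/-- The subgraph of the complete graph formed by a parent structure. -/
def IsRootedTree.toSubgraph {r : V} {S : Finset V} {p : V → V} {d : V → ℕ}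
    (h : IsRootedTree r S p d) : (⊤ : SimpleGraph V).Subgraph where
  verts := insert r (S : Set V)
  Adj u v := (u ∈ S ∧ v = p u) ∨ (v ∈ S ∧ u = p v)
  adj_sub := by
    rintro u v (⟨hu, rfl⟩ | ⟨hv, rfl⟩)
    · exact h.parent_ne hu
    · exact (h.parent_ne hv).symm
  edge_vert := by
    rintro u v (⟨hu, rfl⟩ | ⟨hv, rfl⟩)
    · exact Or.inr hu
    · exact h.parent_mem v hv
  symm := ⟨fun u v huv => huv.symm⟩

namespace IsRootedTree

variable {r : V} {S : Finset V} {p : V → V} {d : V → ℕ}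

theorem edgeSet_toSubgraph (h : IsRootedTree r S p d) :
    h.toSubgraph.edgeSet = ((S.image fun v => s(v, p v) : Finset (Sym2 V)) : Set (Sym2 V)) := by
  ext e
  induction e with
  | _ u v =>
    simp only [SimpleGraph.Subgraph.mem_edgeSet, Finset.coe_image, Set.mem_image,
      Finset.mem_coe, toSubgraph, Sym2.eq_iff]
    constructor
    · rintro (⟨hu, rfl⟩ | ⟨hv, rfl⟩)
      · exact ⟨u, hu, Or.inl ⟨rfl, rfl⟩⟩
      · exact ⟨v, hv, Or.inr ⟨rfl, rfl⟩⟩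
    · rintro ⟨x, hx, ⟨rfl, rfl⟩ | ⟨rfl, rfl⟩⟩
      · exact Or.inl ⟨hx, rfl⟩
      · exact Or.inr ⟨hx, rfl⟩

omit [DecidableEq V] in
theorem exists_walk_toSubgraph (h : IsRootedTree r S p d) (m : ℕ) :
    ∀ v (hv : v ∈ h.toSubgraph.verts), d v = m →
      ∃ q : h.toSubgraph.coe.Walk ⟨r, Or.inl rfl⟩ ⟨v, hv⟩, q.length = m := by
  induction m with
  | zero =>
    intro v hv hd
    have hvr : v = r := hv.resolve_right fun hS => by
      have := h.depth_parent v hS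
      omega
    subst hvr
    exact ⟨.nil, rfl⟩
  | succ m ih =>
    intro v hv hd
    have hvS : v ∈ S := hv.resolve_left (by rintro rfl; rw [h.depth_root] at hd; omega)
    have hd' := h.depth_parent v hvS
    obtain ⟨q, hq⟩ := ih (p v) (h.parent_mem v hvS) (by omega)
    have hadj : h.toSubgraph.coe.Adj ⟨p v, h.parent_mem v hvS⟩ ⟨v, hv⟩ := Or.inr ⟨hvS, rfl⟩
    exact ⟨q.concat hadj, by rw [SimpleGraph.Walk.length_concat, hq]⟩

theorem isTree_toSubgraph [Finite V] (h : IsRootedTree r S p d) : h.toSubgraph.coe.IsTree := by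
  rw [SimpleGraph.isTree_iff_connected_and_card]
  constructor
  · have : Nonempty h.toSubgraph.verts := ⟨⟨r, Or.inl rfl⟩⟩
    refine SimpleGraph.Connected.mk fun u v => ?_
    obtain ⟨q, -⟩ := h.exists_walk_toSubgraph _ u u.2 rfl
    obtain ⟨q', -⟩ := h.exists_walk_toSubgraph _ v v.2 rfl
    exact ⟨q.reverse.append q'⟩
  · have h1 : Nat.card h.toSubgraph.coe.edgeSet = S.card := by
      rw [Nat.card_coe_set_eq, ← Set.ncard_image_of_injective _
        (Sym2.map.injective (Subtype.val_injective (p := (· ∈ h.toSubgraph.verts)))),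
        SimpleGraph.Subgraph.image_coe_edgeSet_coe, h.edgeSet_toSubgraph, Set.ncard_coe_finset,
        Finset.card_image_of_injOn h.injOn]
    have h2 : Nat.card h.toSubgraph.verts = S.card + 1 := by
      have : h.toSubgraph.verts = ((insert r S : Finset V) : Set V) := by simp [toSubgraph]
      rw [this, Nat.card_eq_card_toFinset, Finset.toFinset_coe,
        Finset.card_insert_of_notMem h.root_notMem]
    rw [h1, h2]

omit [DecidableEq V] in
theorem hasDepthAtMost_toSubgraph (h : IsRootedTree r S p d) {k : ℕ} (hk : ∀ v ∈ S, d v ≤ k) :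
    HasDepthAtMost r k h.toSubgraph := by
  refine ⟨Or.inl rfl, fun v => ?_⟩
  obtain ⟨q, hq⟩ := h.exists_walk_toSubgraph _ v v.2 rfl
  refine (SimpleGraph.Walk.edist_le q).trans ?_
  rw [hq]
  rcases v.2 with hv | hv
  · rw [hv, h.depth_root]; simp
  · exact_mod_cast hk v hv

theorem isSteinerTree_toSubgraph [Finite V] (h : IsRootedTree r S p d) {T : Finset V}
    (hT : T ⊆ insert r S) : IsSteinerTree T h.toSubgraph :=
  ⟨fun v hv => by simpa [toSubgraph] using hT hv, h.isTree_toSubgraph⟩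

end IsRootedTree

variable [Fintype V]

omit [DecidableEq V] in
theorem weight_eq_sum (c : Sym2 V → ℝ) {H : (⊤ : SimpleGraph V).Subgraph} {F : Finset (Sym2 V)}
    (hF : H.edgeSet = F) : weight (fun e => c e) H = ∑ e ∈ F, c e := by
  classical
  unfold weight
  rw [← Finset.sum_filter]
  refine Finset.sum_bij (fun e _ => e.1) ?_ ?_ ?_ ?_
  · intro e he
    have := (Finset.mem_filter.1 he).2
    rwa [hF] at this
  · exact fun e _ e' _ h => Subtype.ext h
  · intro e he
    have he' : e ∈ H.edgeSet := by rw [hF]; exact he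
    exact ⟨⟨e, H.edgeSet_subset he'⟩, by simpa using he', rfl⟩
  · exact fun _ _ => rfl

omit [DecidableEq V] in
theorem weight_nonneg {G : SimpleGraph V} {w : G.edgeSet → ℝ} (hw : ∀ e, 0 ≤ w e)
    (H : G.Subgraph) : 0 ≤ weight w H :=
  Finset.sum_nonneg fun e _ => by split_ifs <;> [exact hw e; exact le_rfl]

omit [Fintype V] in
theorem isRootedTree_star {T : Finset V} (r : V) :
    IsRootedTree r (T.erase r) (fun _ => r) (fun v => if v = r then 0 else 1) :=
  ⟨by simp, by simp, fun _ _ => Or.inl rfl, fun v hv => by simp [Finset.ne_of_mem_erase hv]⟩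

theorem exists_isSteinerTree_hasDepthAtMost (T : Finset V) (r : V) {k : ℕ} (hk : 1 ≤ k) :
    ∃ H : (⊤ : SimpleGraph V).Subgraph, IsSteinerTree T H ∧ HasDepthAtMost r k H := by
  have h := isRootedTree_star (T := T) r
  refine ⟨h.toSubgraph, h.isSteinerTree_toSubgraph ?_, h.hasDepthAtMost_toSubgraph ?_⟩
  · intro v hv
    by_cases hvr : v = r <;> simp [hvr, hv]
  · intro v hv
    simpa [Finset.ne_of_mem_erase hv] using hk

theorem steinerCost_le_minSteinerWeight {T : Finset V} {c : Sym2 V → ℝ} (hc : ∀ e, 0 ≤ c e)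
    (r : V) :
    steinerCost T c ≤
      ENNReal.ofReal (minSteinerWeight (fun e : (⊤ : SimpleGraph V).edgeSet => c e) T) := by
  classical
  obtain ⟨H₀, hH₀, -⟩ := exists_isSteinerTree_hasDepthAtMost T r (k := 1) le_rfl
  obtain ⟨⟨H, hH, hw⟩, -⟩ := isLeast_minSteinerWeight
    (fun e : (⊤ : SimpleGraph V).edgeSet => c e) T ⟨H₀, hH₀⟩
  have hF : H.edgeSet = (H.edgeSet.toFinite.toFinset : Set (Sym2 V)) := by simp
  rw [← hw, weight_eq_sum c hF, ENNReal.ofReal_sum_of_nonneg fun e _ => hc e]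
  refine steinerCost_le (fun s hs t ht => ?_) c
  refine reachable_of_forall_adj (G := H.coe) Subtype.val (fun u v huv => ?_)
    (hH.2.connected.preconnected ⟨s, hH.1 s hs⟩ ⟨t, hH.1 t ht⟩)
  refine SimpleGraph.Adj.reachable (edgeGraph_adj.2 ⟨?_, fun h => huv.ne (Subtype.ext h)⟩)
  simpa using huv

/-- The labels of the root of a tree of bounded depth. -/
def rootLabel (r v : V) : ℕ∞ := if v = r then 0 else ⊤

/-- Breadth-first search from `r` in an admissible edge set, truncated at distance `k`, is closed
under parents and still reaches every terminal. Only this inequality is needed for X_k, and only the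
opposite one for X. -/
theorem minDepthSteinerWeight_le_labelCost {T : Finset V} {c : Sym2 V → ℝ} (hc : ∀ e, 0 ≤ c e)
    (r : V) (k : ℕ) :
    ENNReal.ofReal (minDepthSteinerWeight (fun e : (⊤ : SimpleGraph V).edgeSet => c e) T r k) ≤
      labelCost k (rootLabel r) T c := by
  refine le_iInf₂ fun F hF => ?_
  obtain ⟨S, p, h, hadj, hS⟩ := exists_isRootedTree (edgeGraph F) r
  set S' := S.filter fun v => (edgeGraph F).dist r v ≤ k with hS'
  have h' : IsRootedTree r S' p ((edgeGraph F).dist r) := by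
    refine ⟨fun hr => h.root_notMem (Finset.mem_filter.1 hr).1, h.depth_root, fun v hv => ?_,
      fun v hv => h.depth_parent v (Finset.mem_filter.1 hv).1⟩
    obtain ⟨hv, hk⟩ := Finset.mem_filter.1 hv
    refine (h.parent_mem v hv).imp_right fun hp => Finset.mem_filter.2 ⟨hp, ?_⟩
    have := h.depth_parent v hv
    omega
  have hT : T ⊆ insert r S' := by
    intro t ht
    obtain ⟨u, q, hq⟩ := hF t ht
    have hu : u = r := by
      by_contra hu
      simp [rootLabel, hu] at hq
    subst hu
    by_cases htr : t = u
    · simp [htr]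
    · refine Finset.mem_insert_of_mem (Finset.mem_filter.2 ⟨(hS t).2 ⟨htr, ⟨q⟩⟩, ?_⟩)
      refine (SimpleGraph.dist_le q).trans ?_
      simpa [rootLabel] using hq
  have hk : ∀ v ∈ S', (edgeGraph F).dist r v ≤ k := fun v hv => (Finset.mem_filter.1 hv).2
  have hmem : IsSteinerTree T h'.toSubgraph ∧ HasDepthAtMost r k h'.toSubgraph :=
    ⟨h'.isSteinerTree_toSubgraph hT, h'.hasDepthAtMost_toSubgraph hk⟩
  have hle := (isLeast_minDepthSteinerWeight (fun e : (⊤ : SimpleGraph V).edgeSet => c e) T r k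
    ⟨_, hmem⟩).2 ⟨_, hmem, rfl⟩
  refine (ENNReal.ofReal_le_ofReal hle).trans ?_
  rw [weight_eq_sum c h'.edgeSet_toSubgraph, ENNReal.ofReal_sum_of_nonneg fun e _ => hc e]
  refine cost_mono c (Finset.image_subset_iff.2 fun v hv => ?_)
  exact (edgeGraph_adj.1 (hadj v (Finset.mem_filter.1 hv).1)).1

-- A path has fewer edges than there are vertices, so for k ≥ n the depth condition is void.
omit [DecidableEq V] in
theorem hasDepthAtMost_of_card_le {T : Finset V} {r : V} (hr : r ∈ T) {k : ℕ}
    (hk : Fintype.card V ≤ k) {H : (⊤ : SimpleGraph V).Subgraph} (hH : IsSteinerTree T H) :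
    HasDepthAtMost r k H := by
  classical
  refine ⟨hH.1 r hr, fun v => ?_⟩
  obtain ⟨q, hq⟩ := (hH.2.connected.preconnected ⟨r, hH.1 r hr⟩ v).exists_isPath
  refine (SimpleGraph.Walk.edist_le q).trans ?_
  have h1 := hq.length_lt
  have h2 := Fintype.card_subtype_le (· ∈ H.verts)
  have h3 : q.length < Fintype.card {x // x ∈ H.verts} := by convert h1
  exact_mod_cast (by omega : q.length ≤ k)

omit [DecidableEq V] in
theorem minDepthSteinerWeight_eq_minSteinerWeight {T : Finset V} {r : V} (hr : r ∈ T) {k : ℕ}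
    (hk : Fintype.card V ≤ k) (w : (⊤ : SimpleGraph V).edgeSet → ℝ) :
    minDepthSteinerWeight w T r k = minSteinerWeight w T := by
  unfold minDepthSteinerWeight minSteinerWeight
  congr 2
  ext H
  exact ⟨fun h => h.1, fun h => ⟨h, hasDepthAtMost_of_card_le hr hk h⟩⟩

/-- The star at `r` is admissible. This yields integrability and settles small n. -/
theorem meanLabel_rootLabel_le_card {k : ℕ} (hk : 1 ≤ k) (r : V) (T : Finset V) :
    meanLabel k (rootLabel r) T ≤ T.card := by
  have hpt : ∀ c : Sym2 V → ℝ,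
      labelCost k (rootLabel r) T c ≤ ∑ v ∈ T, ENNReal.ofReal (c s(v, r)) := by
    intro c
    refine le_trans (labelCost_le (F := T.image fun v => s(v, r)) (fun t ht => ?_) c)
      (cost_image_le c T _)
    refine ⟨r, ?_⟩
    by_cases htr : t = r
    · subst htr
      exact ⟨.nil, by simp [rootLabel]⟩
    · have hadj : (edgeGraph (T.image fun v => s(v, r))).Adj r t := edgeGraph_adj.2
        ⟨Finset.mem_image.2 ⟨t, ht, Sym2.eq_swap⟩, Ne.symm htr⟩
      exact ⟨hadj.toWalk, by simpa [rootLabel] using hk⟩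
  refine (lintegral_mono hpt).trans ?_
  rw [lintegral_finsetSum _ fun v _ => by fun_prop]
  simp_rw [lintegral_ofReal_eval one_pos]
  simp

end Subgraph

/-! ### Transfer from random weights on a probability space to the product measure -/

section Law

variable {V : Type*} [Fintype V]

theorem measurable_minDepthSteinerWeight {G : SimpleGraph V} (T : Finset V) (r : V) (k : ℕ) :
    Measurable fun w : G.edgeSet → ℝ => minDepthSteinerWeight w T r k := by
  classical
  unfold minDepthSteinerWeight
  simp_rw [sInf_image']
  refine Measurable.iInf fun H => Finset.measurable_sum _ fun e _ => ?_
  split_ifs <;> fun_prop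

theorem measurable_minSteinerWeight {G : SimpleGraph V} (T : Finset V) :
    Measurable fun w : G.edgeSet → ℝ => minSteinerWeight w T := by
  classical
  unfold minSteinerWeight
  simp_rw [sInf_image']
  refine Measurable.iInf fun H => Finset.measurable_sum _ fun e _ => ?_
  split_ifs <;> fun_prop

theorem map_eq_map_pi_sym2 {G : SimpleGraph V} {Ω : Type*} [MeasurableSpace Ω] {P : Measure Ω}
    [IsProbabilityMeasure P] {w : G.edgeSet → Ω → ℝ}
    (hw : ∀ e, HasLaw (w e) (expMeasure 1) P) (hi : iIndepFun w P) :
    P.map (fun ω e => w e ω) =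
      (Measure.pi fun _ : Sym2 V => expMeasure 1).map fun c (e : G.edgeSet) => c e := by
  classical
  rw [map_comp_pi_expMeasure one_pos _ Subtype.val_injective, hi.map_fun_eq_pi_map
    fun e => (hw e).aemeasurable]
  congr
  ext1 e
  exact (hw e).map_eq

variable [DecidableEq V]

/-- Both weights depend only on the joint law of the edges, so the expectations can be computed on
`Sym2 V`. Finiteness of the mean of X_k comes from the star, and 0 ≤ X ≤ X_k almost surely then
handles X. -/
theorem integrable_and_integral_sub_le {T : Finset V} {r : V} {k : ℕ} (hk : 1 ≤ k)
    {Ω : Type*} [MeasurableSpace Ω] {P : Measure Ω} [IsProbabilityMeasure P]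
    {w : (⊤ : SimpleGraph V).edgeSet → Ω → ℝ} (hw : ∀ e, HasLaw (w e) (expMeasure 1) P)
    (hi : iIndepFun w P) :
    Integrable (fun ω => minDepthSteinerWeight (fun e => w e ω) T r k) P ∧
    Integrable (fun ω => minSteinerWeight (fun e => w e ω) T) P ∧
    ∀ E : ℝ, 0 ≤ E → meanLabel k (rootLabel r) T ≤ meanSteiner T + ENNReal.ofReal E →
      ∫ ω, (minDepthSteinerWeight (fun e => w e ω) T r k -
        minSteinerWeight (fun e => w e ω) T) ∂P ≤ E := by
  set μ := Measure.pi fun _ : Sym2 V => expMeasure 1 with hμ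
  set f : (Sym2 V → ℝ) → (⊤ : SimpleGraph V).edgeSet → ℝ := fun c e => c e with hf
  have hfm : Measurable f := by fun_prop
  have hwm : AEMeasurable (fun ω e => w e ω) P :=
    aemeasurable_pi_lambda _ fun e => (hw e).aemeasurable
  have hlaw := map_eq_map_pi_sym2 hw hi
  have hX := measurable_minSteinerWeight (G := (⊤ : SimpleGraph V)) T
  have hXk := measurable_minDepthSteinerWeight (G := (⊤ : SimpleGraph V)) T r k
  obtain ⟨H₀, hH₀⟩ := exists_isSteinerTree_hasDepthAtMost T r hk
  have hnn : ∀ᵐ c ∂μ, ∀ e, 0 ≤ c e := ae_nonneg_pi_expMeasure fun _ => 1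
  have hpos : ∀ c : Sym2 V → ℝ, (∀ e, 0 ≤ c e) → 0 ≤ minSteinerWeight (f c) T := by
    intro c hc
    obtain ⟨⟨H, -, hH⟩, -⟩ := isLeast_minSteinerWeight (f c) T ⟨H₀, hH₀.1⟩
    rw [← hH]
    exact weight_nonneg (fun e => hc e) H
  have hle : ∀ c, minSteinerWeight (f c) T ≤ minDepthSteinerWeight (f c) T r k := by
    intro c
    obtain ⟨⟨H, hH, hHw⟩, -⟩ := isLeast_minDepthSteinerWeight (f c) T r k ⟨H₀, hH₀⟩
    rw [← hHw]
    exact (isLeast_minSteinerWeight (f c) T ⟨H₀, hH₀.1⟩).2 ⟨H, hH.1, rfl⟩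
  have hbound : ∫⁻ c, ENNReal.ofReal (minDepthSteinerWeight (f c) T r k) ∂μ ≤
      meanLabel k (rootLabel r) T := by
    refine lintegral_mono_ae ?_
    filter_upwards [hnn] with c hc
    exact minDepthSteinerWeight_le_labelCost hc r k
  have hfin : meanLabel k (rootLabel r) T < ∞ :=
    (meanLabel_rootLabel_le_card hk r T).trans_lt (ENNReal.natCast_lt_top _)
  have hik : Integrable (fun c => minDepthSteinerWeight (f c) T r k) μ := by
    refine ⟨(hXk.comp hfm).aestronglyMeasurable, ?_⟩
    rw [hasFiniteIntegral_iff_ofReal]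
    · exact hbound.trans_lt hfin
    · filter_upwards [hnn] with c hc
      exact (hpos c hc).trans (hle c)
  have hi' : Integrable (fun c => minSteinerWeight (f c) T) μ := by
    refine hik.mono (hX.comp hfm).aestronglyMeasurable ?_
    filter_upwards [hnn] with c hc
    rw [Real.norm_of_nonneg (hpos c hc), Real.norm_of_nonneg ((hpos c hc).trans (hle c))]
    exact hle c
  have htrans : ∀ {g : ((⊤ : SimpleGraph V).edgeSet → ℝ) → ℝ}, Measurable g →
      (Integrable (fun ω => g fun e => w e ω) P ↔ Integrable (fun c => g (f c)) μ) := by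
    intro g hg
    have h1 := integrable_map_measure (μ := P) (f := fun ω e => w e ω) (g := g)
      hg.aestronglyMeasurable hwm
    have h2 := integrable_map_measure (μ := μ) (f := f) (g := g)
      hg.aestronglyMeasurable hfm.aemeasurable
    rw [hlaw] at h1
    exact h1.symm.trans h2
  refine ⟨(htrans hXk).2 hik, (htrans hX).2 hi', fun E hE h => ?_⟩
  have heq : ∫ ω, (minDepthSteinerWeight (fun e => w e ω) T r k -
      minSteinerWeight (fun e => w e ω) T) ∂P =
      ∫ c, (minDepthSteinerWeight (f c) T r k - minSteinerWeight (f c) T) ∂μ := by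
    have hg : Measurable fun u : (⊤ : SimpleGraph V).edgeSet → ℝ =>
        minDepthSteinerWeight u T r k - minSteinerWeight u T := hXk.sub hX
    rw [← integral_map (μ := μ) (f := fun u => minDepthSteinerWeight u T r k - minSteinerWeight u T)
      hfm.aemeasurable hg.aestronglyMeasurable, ← hlaw, integral_map hwm hg.aestronglyMeasurable]
  rw [heq, integral_sub hik hi', sub_le_iff_le_add', integral_eq_lintegral_of_nonneg_ae
    (by filter_upwards [hnn] with c hc using (hpos c hc).trans (hle c)) hik.1]
  have hS : meanSteiner T ≤ ENNReal.ofReal (∫ c, minSteinerWeight (f c) T ∂μ) := by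
    rw [ofReal_integral_eq_lintegral_ofReal hi'
      (by filter_upwards [hnn] with c hc using hpos c hc)]
    refine lintegral_mono_ae ?_
    filter_upwards [hnn] with c hc
    exact steinerCost_le_minSteinerWeight hc r
  have hS0 : 0 ≤ ∫ c, minSteinerWeight (f c) T ∂μ :=
    integral_nonneg_of_ae (by filter_upwards [hnn] with c hc using hpos c hc)
  refine ENNReal.toReal_le_of_le_ofReal (by positivity) ?_
  rw [ENNReal.ofReal_add hS0 hE]
  exact (hbound.trans h).trans (add_le_add hS le_rfl)

end Law


/-! ### Doubly exponential level sizes -/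

section Levels

/-- The sizes of the levels decrease doubly exponentially towards the root. -/
noncomputable def levelRatio (i : ℕ) : ℝ := Real.exp (-2 * 2 ^ i) / 2 ^ (i + 1)

theorem levelRatio_pos (i : ℕ) : 0 < levelRatio i := by
  unfold levelRatio; positivity

/-- This identity fixes the form of `levelRatio`: joining the level of index i to the level i + 1
before it costs about x·2^(-i)/n, which is summable. -/
theorem levelRatio_sq (i : ℕ) : levelRatio i ^ 2 = levelRatio (i + 1) * (1 / 2) ^ i := by
  unfold levelRatio
  rw [div_pow, ← Real.exp_nat_mul]
  have : ((2 : ℕ) : ℝ) * (-2 * 2 ^ i) = -2 * 2 ^ (i + 1) := by push_cast; ring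
  rw [this, one_div, inv_pow]
  field_simp
  ring

theorem exp_neg_two_lt : Real.exp (-2) < 1 / 7 := by
  have h : Real.exp 2 = Real.exp 1 ^ 2 := by rw [← Real.exp_nat_mul]; norm_num
  rw [Real.exp_neg, inv_eq_one_div, h]
  have := Real.exp_one_gt_d9
  exact one_div_lt_one_div_of_lt (by norm_num) (by nlinarith)

theorem exp_two_lt : Real.exp 2 < 8 := by
  have h : Real.exp 2 = Real.exp 1 ^ 2 := by rw [← Real.exp_nat_mul]; norm_num
  rw [h]
  have := Real.exp_one_lt_d9
  have := Real.exp_pos 1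
  nlinarith

theorem levelRatio_le (i : ℕ) : levelRatio i ≤ (1 / 7) * (1 / 2) ^ (i + 1) := by
  unfold levelRatio
  have h1 : Real.exp (-2 * 2 ^ i) ≤ 1 / 7 := by
    refine le_trans (Real.exp_le_exp.2 ?_) exp_neg_two_lt.le
    have : (1 : ℝ) ≤ 2 ^ i := one_le_pow₀ (by norm_num)
    linarith
  rw [div_eq_mul_inv, one_div_pow, one_div (2 ^ (i + 1) : ℝ)]
  gcongr

/-- The sizes of the levels, in the order of increasing distance from the root. -/
noncomputable def levelSizes (x : ℝ) : ℕ → List ℕ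
  | 0 => []
  | i + 1 => ⌈x * levelRatio i⌉₊ :: levelSizes x i

theorem length_levelSizes (x : ℝ) (i : ℕ) : (levelSizes x i).length = i := by
  induction i with
  | zero => rfl
  | succ i ih => rw [levelSizes, List.length_cons, ih]

variable {x : ℝ} (hx : 0 < x)
include hx

theorem sum_levelSizes_le (i : ℕ) : ((levelSizes x i).sum : ℝ) ≤ i + x / 7 * (1 - (1 / 2) ^ i) := by
  induction i with
  | zero => simp [levelSizes]
  | succ i ih =>
    rw [levelSizes, List.sum_cons]
    simp only [Nat.cast_add, Nat.cast_one]
    have h1 := (Nat.ceil_lt_add_one (mul_pos hx (levelRatio_pos i)).le).le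
    have h2 := mul_le_mul_of_nonneg_left (levelRatio_le i) hx.le
    have h3 : x / 7 * (1 - (1 / 2) ^ (i + 1)) =
      x / 7 * (1 - (1 / 2) ^ i) + x * (1 / 7 * (1 / 2) ^ (i + 1)) := by ring
    rw [h3]
    linarith

theorem one_le_of_mem_levelSizes {i t : ℕ} (ht : t ∈ levelSizes x i) :
    1 ≤ t ∧ (t : ℝ) ≤ x / 7 + 1 := by
  induction i with
  | zero => simp [levelSizes] at ht
  | succ i ih =>
    rw [levelSizes, List.mem_cons] at ht
    rcases ht with rfl | ht
    · have h0 := mul_pos hx (levelRatio_pos i)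
      refine ⟨Nat.ceil_pos.2 h0, (Nat.ceil_lt_add_one h0.le).le.trans ?_⟩
      have h2 := mul_le_mul_of_nonneg_left (levelRatio_le i) hx.le
      have h3 : (1 / 2 : ℝ) ^ (i + 1) ≤ 1 := pow_le_one₀ (by norm_num) (by norm_num)
      nlinarith
    · exact ih ht

/-- The geometric terms add up to O(x/Q). The summand 2i comes from rounding each size up to an
integer and is the reason why the number of levels must be O(x). -/
theorem levelCost_levelSizes_le {Q : ℕ} (i : ℕ) :
    ∀ {s : ℕ}, (∀ t ∈ levelSizes x i, t ≤ Q) → 1 ≤ s → x * levelRatio i ≤ s →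
      levelCost Q s (levelSizes x i) ≤
        ENNReal.ofReal (2 / Q * (4 * x * (1 - (1 / 2) ^ i) + 2 * i)) := by
  induction i with
  | zero => intro s _ _ _; simp [levelSizes, levelCost]
  | succ i ih =>
    intro s hQ hs hxs
    have h0 := mul_pos hx (levelRatio_pos i)
    rw [levelSizes, levelCost]
    set t := ⌈x * levelRatio i⌉₊ with ht
    have ht1 : 1 ≤ t := Nat.ceil_pos.2 h0
    have htQ : t ≤ Q := hQ t (by rw [levelSizes]; exact List.mem_cons_self)
    have hxt : x * levelRatio i ≤ t := Nat.le_ceil _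
    have htx : (t : ℝ) < x * levelRatio i + 1 := Nat.ceil_lt_add_one h0.le
    refine (add_le_add le_rfl (ih (fun t' ht' => hQ t' (by
      rw [levelSizes]; exact List.mem_cons_of_mem _ ht')) ht1 hxt)).trans ?_
    have ht0 : (0 : ℝ) < t := by exact_mod_cast ht1
    have hs0 : (1 : ℝ) ≤ s := by exact_mod_cast hs
    have hQ0 : (0 : ℝ) < Q := by exact_mod_cast ht1.trans htQ
    have hp : (1 / 2 : ℝ) ^ i ≤ 1 := pow_le_one₀ (by norm_num) (by norm_num)
    have hp0 : (0 : ℝ) < (1 / 2) ^ i := by positivity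
    have hfloor : (Q : ℝ) / (2 * t) ≤ (Q / t : ℕ) := by
      rw [div_le_iff₀ (by positivity)]
      have h1 : Q < (Q / t + 1) * t := by
        have := Nat.lt_div_mul_add (a := Q) ht1
        rw [add_mul, one_mul]; exact this
      have h2 : 1 ≤ Q / t := Nat.div_pos htQ ht1
      have h1' : (Q : ℝ) < ((Q / t : ℕ) + 1) * t := by exact_mod_cast h1
      have h2' : (1 : ℝ) ≤ (Q / t : ℕ) := by exact_mod_cast h2
      nlinarith
    have hsq : (t : ℝ) ^ 2 / s ≤ 2 * x * (1 / 2) ^ i + 2 := by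
      rw [div_le_iff₀ (by linarith)]
      have h1 : (t : ℝ) ^ 2 ≤ 2 * (x * levelRatio i) ^ 2 + 2 := by
        nlinarith [sq_nonneg (x * levelRatio i - 1)]
      have h2 : (x * levelRatio i) ^ 2 = (x * levelRatio (i + 1)) * (x * (1 / 2) ^ i) := by
        rw [mul_pow, levelRatio_sq]; ring
      have h3 : (x * levelRatio (i + 1)) * (x * (1 / 2) ^ i) ≤ s * (x * (1 / 2) ^ i) := by
        gcongr
      nlinarith
    rw [← ENNReal.ofReal_add (by positivity)
      (by have := sub_nonneg.2 hp; positivity)]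
    refine ENNReal.ofReal_le_ofReal ?_
    have hstep : (t : ℝ) / ((Q / t : ℕ) * s) ≤ 2 / Q * (2 * x * (1 / 2) ^ i + 2) := by
      calc (t : ℝ) / ((Q / t : ℕ) * s) ≤ t / (Q / (2 * t) * s) := by gcongr
        _ = 2 / Q * ((t : ℝ) ^ 2 / s) := by field_simp
        _ ≤ _ := by gcongr
    refine (add_le_add hstep le_rfl).trans (le_of_eq ?_)
    push_cast
    ring

omit hx in
theorem getLastD_levelSizes (i s : ℕ) :
    (levelSizes x (i + 1)).getLastD s = ⌈x * levelRatio 0⌉₊ := by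
  induction i generalizing s with
  | zero => rfl
  | succ i ih => rw [levelSizes, List.getLastD_cons, ih]

end Levels

/-! ### Choice of parameters and conclusion -/

/-- Deletion costs 34·3ε = 102ε, so the mean on the smaller graph is at most 106q by ε ≤ q, and the
edge count at most 1702nq. With |A| ≥ εn/16 and D + 1 ≥ Δ the shortcuts cost 16·1702·q/(εΔ) =
27232ε. -/
theorem cutCost_le {N M s D a n : ℕ} {X : ℝ≥0∞} {q ε Δ : ℝ} (hε : 0 < ε) (hεq : ε ≤ q)
    (hΔ : 0 < Δ) (hεΔ : q / Δ = ε ^ 2) (hn : 0 < n) (hnq : 1 ≤ n * q) (hN : N ≤ n)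
    (hX : X ≤ ENNReal.ofReal (4 * q)) (hXN : meanSteinerNum N M ≤ X + ENNReal.ofReal (34 * a / n))
    (ha : (a : ℝ) ≤ 3 * ε * n) (hs : ε * n * levelRatio 0 ≤ s) (hD : Δ ≤ D + 1) :
    cutCost N M s D ≤ X + ENNReal.ofReal (102 * ε + 27232 * ε) := by
  have hq : 0 < q := hε.trans_le hεq
  have hn0 : (0 : ℝ) < n := by exact_mod_cast hn
  have hs0 : (0 : ℝ) < s := lt_of_lt_of_le (mul_pos (by positivity) (levelRatio_pos 0)) hs
  have han : 34 * (a : ℝ) / n ≤ 102 * ε := by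
    rw [div_le_iff₀ hn0]
    linarith
  have h1 : meanSteinerNum N M ≤ X + ENNReal.ofReal (102 * ε) :=
    hXN.trans (add_le_add le_rfl (ENNReal.ofReal_le_ofReal han))
  have h2 : meanSteinerNum N M ≤ ENNReal.ofReal (106 * q) := by
    refine h1.trans ((add_le_add hX le_rfl).trans ?_)
    rw [← ENNReal.ofReal_add (by positivity) (by positivity)]
    exact ENNReal.ofReal_le_ofReal (by linarith)
  have he := exp_two_lt
  have hNn : (N : ℝ) ≤ n := by exact_mod_cast hN
  have h3 : ENNReal.ofReal (2 * Real.exp 2 * N) * meanSteinerNum N M + ENNReal.ofReal 6 ≤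
      ENNReal.ofReal (1702 * (n * q)) := by
    calc _ ≤ ENNReal.ofReal (16 * n) * ENNReal.ofReal (106 * q) + ENNReal.ofReal 6 := by
          gcongr
          linarith
      _ = ENNReal.ofReal (16 * n * (106 * q) + 6) := by
          rw [← ENNReal.ofReal_mul (by positivity),
            ENNReal.ofReal_add (by positivity) (by norm_num)]
      _ ≤ _ := ENNReal.ofReal_le_ofReal (by linarith)
  have h4 : (1 : ℝ) / s ≤ 16 / (ε * n) := by
    have h5 : levelRatio 0 = 1 / (2 * Real.exp 2) := by
      unfold levelRatio
      rw [pow_zero, mul_one, Real.exp_neg]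
      field_simp
      norm_num
    rw [div_le_div_iff₀ hs0 (by positivity)]
    rw [h5, mul_one_div, div_le_iff₀ (by positivity)] at hs
    nlinarith
  unfold cutCost
  rw [ENNReal.ofReal_add (by positivity) (by positivity), ← add_assoc]
  refine add_le_add h1 ?_
  calc _ ≤ ENNReal.ofReal (1702 * (n * q)) * ENNReal.ofReal (16 / (ε * n)) /
        ENNReal.ofReal Δ := by
        gcongr
        rw [← ENNReal.ofReal_natCast]
        exact ENNReal.ofReal_le_ofReal (by push_cast; exact hD)
    _ = ENNReal.ofReal (1702 * (n * q) * (16 / (ε * n)) / Δ) := by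
        rw [← ENNReal.ofReal_mul (by positivity), ENNReal.ofReal_div_of_pos hΔ]
    _ ≤ _ := by
        refine ENNReal.ofReal_le_ofReal (le_of_eq ?_)
        have : q = ε ^ 2 * Δ := by rw [← hεΔ]; field_simp
        rw [this]
        field_simp
        norm_num

theorem meanLabel_rootLabel_le_add {V : Type*} [Fintype V] [DecidableEq V] {T : Finset V} {r : V}
    (hr : r ∈ T) {n m k K : ℕ} {q ε Δ : ℝ} (hV : Fintype.card V = n) (hT : T.card = m)
    (hn : 1000 ≤ n) (hq : q = m * (1 + Real.log (n / m)) / n) (hnq : 1 ≤ n * q) (hε : 0 < ε)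
    (hε1 : ε ≤ 1) (hεq : ε ≤ q) (hΔ : 0 < Δ) (hεΔ : q / Δ = ε ^ 2) (hK : 1 ≤ K)
    (hKk : K + 1 ≤ k) (hΔk : Δ ≤ (k : ℝ) - K) (hKn : (K + 1 : ℝ) ≤ n / 16)
    (hKε : (K + 1 : ℝ) ≤ 2 * ε * n) (hKr : n * levelRatio K ≤ 1) :
    meanLabel k (rootLabel r) T ≤ meanSteiner T + ENNReal.ofReal (28000 * ε) := by
  obtain ⟨i, rfl⟩ := Nat.exists_eq_add_of_le' hK
  have hn0 : (1000 : ℝ) ≤ n := by exact_mod_cast hn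
  set x := ε * n with hxdef
  have hx : 0 < x := by positivity
  have hxn : x ≤ n := by nlinarith
  set t := ⌈x * levelRatio i⌉₊ with ht
  set S := (levelSizes x (i + 1)).sum with hS
  have hSl : S = t + (levelSizes x i).sum := by rw [hS, levelSizes, List.sum_cons]
  have hSle : (S : ℝ) ≤ (i + 1 : ℕ) + x / 7 := by
    refine (sum_levelSizes_le hx (i + 1)).trans ?_
    have : (0 : ℝ) < (1 / 2) ^ (i + 1) := by positivity
    nlinarith
  have hQr : ((n / 4 : ℕ) : ℝ) ≤ n / 4 := Nat.cast_div_le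
  have hQr' : (n : ℝ) / 8 ≤ (n / 4 : ℕ) := by
    have h : n ≤ 8 * (n / 4) := by omega
    have h' : (n : ℝ) ≤ 8 * (n / 4 : ℕ) := by exact_mod_cast h
    linarith
  have hmem : ∀ t' ∈ levelSizes x (i + 1), 1 ≤ t' ∧ t' ≤ n / 4 := fun t' ht' => by
    obtain ⟨h1, h2⟩ := one_le_of_mem_levelSizes hx ht'
    refine ⟨h1, (Nat.le_div_iff_mul_le (by norm_num)).2 ?_⟩
    have : (t' : ℝ) * 4 ≤ n := by nlinarith
    exact_mod_cast this
  -- Room for the reserve of `b`, the levels, `n / 4` spare candidates and the root.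
  have hcap : (n / 4) + S + (n / 4) + 1 ≤ n := by
    have : (((n / 4 : ℕ) + S + (n / 4 : ℕ) + 1 : ℝ)) ≤ n := by
      push_cast at hSle hKn
      linarith
    exact_mod_cast this
  have hcap' : 2 * (S + 1) ≤ n := by
    have : (2 * (S + 1) : ℝ) ≤ n := by
      push_cast at hSle hKn
      linarith
    exact_mod_cast this
  have hmn : m ≤ n := by rw [← hV, ← hT]; exact Finset.card_le_univ T
  have hm : 1 ≤ m := by rw [← hT]; exact Finset.card_pos.2 ⟨r, hr⟩
  have herase : (Finset.univ.erase r).card = n - 1 := by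
    rw [Finset.card_erase_of_mem (Finset.mem_univ r), Finset.card_univ, hV]
  obtain ⟨B₀, hB₀, hB₀c⟩ := Finset.exists_subset_card_eq
    (show n / 4 ≤ (Finset.univ.erase r).card by omega)
  -- The vertices deleted before the final tree is built: all levels and the root.
  set a := S + 1 with ha
  have hmain := meanLabel_root_le (k := k) (Q := n / 4) (N := n - a) (M := m)
    (D := k - (i + 1) - 1) (t := t) (l := levelSizes x i) (L := rootLabel r) (T := T) (B₀ := B₀)
    (B := Finset.univ.erase r \ B₀) (r := r) (by rw [length_levelSizes]; omega)
    (hmem t (by rw [levelSizes]; exact List.mem_cons_self))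
    (fun t' ht' => hmem t' (by rw [levelSizes]; exact List.mem_cons_of_mem _ ht'))
    (by simp [rootLabel]) hr hT.le (by omega) (Finset.card_pos.1 (by omega))
    (fun h => by simpa using hB₀ h) (by simp) Finset.disjoint_sdiff
    (by rw [Finset.card_sdiff_of_subset hB₀]; omega)
  have hlast : (levelSizes x i).getLastD t = ⌈x * levelRatio 0⌉₊ := by
    rw [← getLastD_levelSizes i 0, levelSizes, List.getLastD_cons]
  rw [hlast, hB₀c] at hmain
  -- The cut depth takes up all remaining levels: D + 1 = k - K, with K = i + 1.
  have hD : Δ ≤ ((k - (i + 1) - 1 : ℕ) : ℝ) + 1 := by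
    have : ((k - (i + 1) - 1 : ℕ) : ℝ) + 1 = (k : ℝ) - (i + 1 : ℕ) := by
      rw [eq_sub_iff_add_eq]
      have : k - (i + 1) - 1 + 1 + (i + 1) = k := by omega
      exact_mod_cast this
    rw [this]; exact hΔk
  have haε : (a : ℝ) ≤ 3 * ε * n := by
    rw [ha]
    push_cast at hSle hKε ⊢
    rw [hxdef] at hSle
    nlinarith
  have hcut := cutCost_le (N := n - a) (M := min m (n - a)) (D := k - (i + 1) - 1) (a := a)
    (s := ⌈x * levelRatio 0⌉₊) hε hεq hΔ hεΔ (by omega) hnq (Nat.sub_le _ _)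
    (by rw [hq]; exact meanSteinerNum_le hm hmn)
    (meanSteinerNum_sub_le hm hmn a (by omega) (by omega)) haε (Nat.le_ceil _) hD
  have hlev := levelCost_levelSizes_le hx (Q := n / 4) (i + 1) (s := 1)
    (fun t' ht' => (hmem t' ht').2) le_rfl (by
      have := levelRatio_pos (i + 1)
      rw [hxdef]
      push_cast
      nlinarith)
  have hlev' : levelCost (n / 4) 1 (levelSizes x (i + 1)) ≤ ENNReal.ofReal (128 * ε) := by
    refine hlev.trans (ENNReal.ofReal_le_ofReal ?_)
    have hp : (0 : ℝ) < (1 / 2) ^ (i + 1) := by positivity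
    have hp' : (1 / 2 : ℝ) ^ (i + 1) ≤ 1 := pow_le_one₀ (by norm_num) (by norm_num)
    have hp'' := sub_nonneg.2 hp'
    calc 2 / ((n / 4 : ℕ) : ℝ) * (4 * x * (1 - (1 / 2) ^ (i + 1)) + 2 * (i + 1 : ℕ))
        ≤ 2 / (n / 8) * (4 * x + 2 * (i + 1 : ℕ)) := by
          have hle : 4 * x * (1 - (1 / 2) ^ (i + 1)) ≤ 4 * x := by nlinarith [mul_pos hx hp]
          gcongr 2 / ?_ * (?_ + _)
      _ ≤ 2 / (n / 8) * (8 * ε * n) := by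
          gcongr
          rw [hxdef]
          linarith
      _ = 128 * ε := by field_simp; norm_num
  have hfirst : ENNReal.ofReal (1 / (n / 4 : ℕ)) ≤ ENNReal.ofReal (16 * ε) := by
    refine ENNReal.ofReal_le_ofReal ?_
    rw [div_le_iff₀ (by linarith)]
    have h1 : (1 : ℝ) ≤ 2 * ε * n :=
      le_trans (by push_cast; linarith [Nat.cast_nonneg (α := ℝ) i]) hKε
    nlinarith
  rw [meanSteiner_eq hV hT]
  rw [levelSizes] at hlev'
  refine hmain.trans ((add_le_add (add_le_add hfirst hlev') hcut).trans ?_)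
  rw [add_left_comm, ← ENNReal.ofReal_add (by positivity) (by positivity),
    ← ENNReal.ofReal_add (by positivity) (by positivity)]
  refine add_le_add le_rfl (ENNReal.ofReal_le_ofReal ?_)
  linarith


theorem sq_add_one_le_two_pow (K : ℕ) : (K + 1) ^ 2 ≤ 4 * 2 ^ K := by
  rcases lt_or_ge K 3 with h | h
  · interval_cases K <;> norm_num
  · induction K, h using Nat.le_induction with
    | base => norm_num
    | succ K hK ih => rw [pow_succ 2 K]; nlinarith

/-- Take 2^K ≤ log n < 2^(K + 1). The upper inequality makes n·`levelRatio K` at most 1, so that the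
single root can serve as the level of index K. -/
theorem exists_level_count {n : ℕ} (hn : 1000 ≤ n) :
    ∃ K : ℕ, 1 ≤ K ∧ (K : ℝ) ≤ Real.logb 2 (Real.log n) ∧ (K + 1 : ℝ) ≤ n / 16 ∧
      (K + 1 : ℝ) ^ 2 ≤ 4 * Real.log n ∧ n * levelRatio K ≤ 1 := by
  have hn0 : (1000 : ℝ) ≤ n := by exact_mod_cast hn
  have hlog : 2 ≤ Real.log n := by
    rw [Real.le_log_iff_exp_le (by linarith)]
    linarith [exp_two_lt]
  obtain ⟨K, hK, hK'⟩ := exists_nat_pow_near (x := Real.log n) (by linarith)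
    (one_lt_two : (1 : ℝ) < 2)
  refine ⟨K, ?_, ?_, ?_, ?_, ?_⟩
  · by_contra h
    have h0 : K = 0 := by omega
    rw [h0] at hK'
    norm_num at hK'
    linarith
  · rw [Real.le_logb_iff_rpow_le one_lt_two (by linarith), Real.rpow_natCast]
    exact hK
  · have h1 : (K + 1 : ℝ) ≤ 2 ^ K := by exact_mod_cast Nat.lt_two_pow_self
    have h2 : Real.log n = Real.log (n / 32) + 5 * Real.log 2 := by
      rw [Real.log_div (by linarith) (by norm_num), show (32 : ℝ) = 2 ^ 5 by norm_num,
        Real.log_pow]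
      push_cast
      ring
    have h3 := Real.log_le_sub_one_of_pos (show (0 : ℝ) < n / 32 by linarith)
    have h4 := Real.log_two_lt_d9
    linarith
  · have h : ((K + 1 : ℕ) : ℝ) ^ 2 ≤ 4 * 2 ^ K := by exact_mod_cast sq_add_one_le_two_pow K
    push_cast at h
    linarith
  · have h1 : levelRatio K ≤ Real.exp (-2 * 2 ^ K) := by
      unfold levelRatio
      exact div_le_self (Real.exp_pos _).le (one_le_pow₀ (by norm_num))
    have h2 : Real.exp (-2 * 2 ^ K) ≤ (n : ℝ)⁻¹ := by
      rw [← Real.exp_log (show (0 : ℝ) < n by linarith), ← Real.exp_neg]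
      refine Real.exp_le_exp.2 ?_
      rw [pow_succ] at hK'
      linarith
    calc n * levelRatio K ≤ n * (n : ℝ)⁻¹ := by
          have := h1.trans h2
          gcongr
      _ = 1 := mul_inv_cancel₀ (by linarith)

end BoundedDepthSteiner

open BoundedDepthSteiner

theorem theorem4 :
    ∃ C : ℝ, 0 < C ∧
      ∀ (n m k : ℕ) (Δ : ℝ), 2 ≤ m → m ≤ n →
        (k : ℝ) = Real.logb 2 (Real.log n) + Δ →
        (n : ℝ) / (m * Real.log (Real.exp 1 * n / m)) ≤ Δ →
      ∀ (T : Finset (Fin n)) (r : Fin n), T.card = m → r ∈ T →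
      ∀ (Ω : Type*) [MeasurableSpace Ω] (P : Measure Ω) [IsProbabilityMeasure P]
        (w : (⊤ : SimpleGraph (Fin n)).edgeSet → Ω → ℝ),
        (∀ e, HasLaw (w e) (expMeasure 1) P) → iIndepFun w P →
        Integrable (fun ω => BoundedDepthSteiner.minDepthSteinerWeight (fun e => w e ω) T r k) P ∧
        Integrable (fun ω => BoundedDepthSteiner.minSteinerWeight (fun e => w e ω) T) P ∧
        ∫ ω, (BoundedDepthSteiner.minDepthSteinerWeight (fun e => w e ω) T r k -
            BoundedDepthSteiner.minSteinerWeight (fun e => w e ω) T) ∂P ≤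
          C * Real.sqrt (m * Real.log (Real.exp 1 * n / m) / (n * Δ)) := by
  -- For n < 1000 the excess is at most m ≤ 1000 while ε ≥ 1/(2n) ≥ 1/2000, which dictates this
  -- constant. For larger n, 28000 suffices.
  refine ⟨2000000, by norm_num, ?_⟩
  intro n m k Δ hm hmn hk hΔ T r hT hr Ω _ P _ w hw hi
  have hm0 : (2 : ℝ) ≤ m := by exact_mod_cast hm
  have hmn0 : (m : ℝ) ≤ n := by exact_mod_cast hmn
  have hn0 : (2 : ℝ) ≤ n := hm0.trans hmn0
  have hlogmn : 0 ≤ Real.log (n / m) := Real.log_nonneg ((one_le_div (by linarith)).2 hmn0)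
  have hlogm : Real.log m ≤ m := (Real.log_le_sub_one_of_pos (by linarith)).trans (by linarith)
  have hlog2 : 1 / 2 < Real.log n := by
    have := Real.log_le_log (by norm_num) hn0
    linarith [Real.log_two_gt_d9]
  have hlog : Real.log (Real.exp 1 * n / m) = 1 + Real.log (n / m) := by
    rw [mul_div_assoc, Real.log_mul (Real.exp_pos 1).ne' (by positivity), Real.log_exp]
  rw [hlog] at hΔ ⊢
  set q : ℝ := m * (1 + Real.log (n / m)) / n with hq
  have hnq : n * q = m * (1 + Real.log (n / m)) := by rw [hq]; field_simp
  have hnq1 : 1 ≤ n * q := by rw [hnq]; nlinarith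
  have hnqlog : Real.log n ≤ n * q := by
    have : Real.log n = Real.log (n / m) + Real.log m := by
      rw [Real.log_div (by positivity) (by positivity)]; ring
    rw [hnq, this]
    nlinarith
  have hq0 : 0 < q := by rw [hq]; positivity
  have hq1 : q ≤ 1 := by
    have h1 := Real.log_le_sub_one_of_pos (show (0 : ℝ) < n / m by positivity)
    have h2 : m * (1 + Real.log (n / m)) ≤ m * (n / m) := by
      gcongr; linarith
    rw [mul_div_cancel₀ _ (by positivity)] at h2
    rw [hq]
    exact (div_le_one (by linarith)).2 h2
  have hΔq : 1 ≤ Δ * q := by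
    have h1 : (n : ℝ) / (m * (1 + Real.log (n / m))) = 1 / q := by rw [hq, one_div_div]
    rw [h1, div_le_iff₀ hq0] at hΔ
    exact hΔ
  have hΔ1 : 1 ≤ Δ := by
    by_contra! h
    nlinarith
  have hlogb : -1 < Real.logb 2 (Real.log n) := by
    rw [Real.lt_logb_iff_rpow_lt one_lt_two (by linarith), Real.rpow_neg_one]
    linarith
  have hk1 : 1 ≤ k := by
    have : (0 : ℝ) < k := by linarith
    exact_mod_cast this
  obtain ⟨h1, h2, h3⟩ := integrable_and_integral_sub_le (T := T) (r := r) hk1 hw hi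
  refine ⟨h1, h2, ?_⟩
  have hqΔ : m * (1 + Real.log (n / m)) / (n * Δ) = q / Δ := by rw [hq, div_div]
  rw [hqΔ]
  set ε := Real.sqrt (q / Δ) with hε
  have hε0 : 0 < ε := Real.sqrt_pos.2 (by positivity)
  have hεsq : q / Δ = ε ^ 2 := (Real.sq_sqrt (by positivity)).symm
  -- For k ≥ n nothing is to be proved. Otherwise Δ ≤ n, so (εn)² = n·nq/Δ ≥ nq ≥ log n, and the K
  -- rounding errors are O(εn).
  rcases le_or_gt n k with hnk | hnk
  · have h0 : ∀ ω, minDepthSteinerWeight (fun e => w e ω) T r k =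
        minSteinerWeight (fun e => w e ω) T := fun ω =>
      minDepthSteinerWeight_eq_minSteinerWeight hr (by rwa [Fintype.card_fin]) _
    simp only [h0, sub_self, integral_zero]
    positivity
  · have hΔn : Δ ≤ n := by
      have : (k : ℝ) + 1 ≤ n := by exact_mod_cast hnk
      linarith
    have hεn : Real.log n ≤ (ε * n) ^ 2 := by
      rw [mul_pow, ← hεsq, div_mul_eq_mul_div, le_div_iff₀ (by linarith)]
      nlinarith
    rcases lt_or_ge n 1000 with hn | hn
    · have hn' : (n : ℝ) ≤ 1000 := by exact_mod_cast hn.le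
      have hεn' : 1 / 2 ≤ ε * n := by
        by_contra! h
        have : 0 ≤ ε * n := by positivity
        nlinarith
      refine (h3 m (by positivity) ?_).trans ?_
      · refine (meanLabel_rootLabel_le_card hk1 r T).trans ?_
        rw [hT, ENNReal.ofReal_natCast]
        exact le_add_self
      · nlinarith
    · obtain ⟨K, hK1, hKlog, hKn, hKsq, hKr⟩ := exists_level_count hn
      -- Equivalent to Δq ≥ 1, the lower bound assumed for Δ.
      have hεq : ε ≤ q := by
        refine abs_le_of_sq_le_sq' ?_ hq0.le |>.2
        rw [← hεsq, div_le_iff₀ (by linarith)]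
        nlinarith
      have hKΔ : Δ ≤ (k : ℝ) - K := by linarith
      refine (h3 (28000 * ε) (by positivity) ?_).trans (by linarith)
      refine meanLabel_rootLabel_le_add hr (Fintype.card_fin n) hT hn hq hnq1 hε0
        (hεq.trans hq1) hεq (by linarith) hεsq hK1 ?_ hKΔ hKn ?_ hKr
      · have : (K + 1 : ℝ) ≤ k := by linarith
        exact_mod_cast this
      · refine abs_le_of_sq_le_sq' ?_ (by positivity) |>.2
        have : (2 * ε * n) ^ 2 = 4 * (ε * n) ^ 2 := by ring
        rw [this]
        linarith
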